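/- **Definitions.** *MK* is Morse–Kelley class theory in the two-sorted language of sets and classes: Extensionality, Pairing, Infinity, Union and Power Set for sets; Foundation and Extensionality for classes; Replacement for class functions; Class-Comprehension for all formulas, with set and class quantifiers and parameters; and Global Choice (there is a class well-ordering of the universe of sets). *MK\** is MK together with the Class-Bounding scheme $$\forall x\,\exists A\,\varphi(x,A)\to\exists B\,\forall x\,\exists y\,\varphi(x,(B)_y),\qquad (B)_y=\{z\mid (y,z)\in B\}.$$ A model $(M,\mathcal C)=\langle M,\in,\mathcal C\rangle$ consists of a transitive set $M$ and a set $\mathcal C$ of subsets of $M$ (the classes). It is a *$\beta$-model* if every $R\in\mathcal C$ is well-founded (as a binary relation) in $(M,\mathcal C)$ if and only if it is really well-founded. *SetMK\** is the following first-order theory of sets: $\mathrm{ZFC}^-$ (ZFC without Power Set, with the Bounding scheme $\forall x\in a\,\exists y\,\varphi(x,y)\to\exists b\,\forall x\in a\,\exists y\in b\,\varphi(x,y)$, and with choice in the form that every set can be well-ordered), and there is a strongly inaccessible cardinal $\kappa$ such that every set can be mapped injectively into $\kappa$. A pair $(M_0,R)$ with $M_0,R\in\mathcal C$, $R\subseteq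 M_0\times M_0$, is a *coding pair* in $(M,\mathcal C)$ if $M_0$ has a distinguished element $a$ such that - for every $z\in M_0$ there is a unique $n\in\mathbb N$ such that $z$ has $R$-distance $n$ from $a$, i.e. such that there is a chain $z\,R\,z_{n-1}\,R\cdots R\,z_1\,R\,a$; - if $y\ne z$, $y\,R\,x$ and $z\,R\,x$, then $(M_0,R)\restriction y\not\cong(M_0,R)\restriction z$, where $(M_0,R)\restriction y$ is $R$ restricted to $y$ together with all elements connected to $y$ by an $R$-chain; - if $y\neq z$ have the same $R$-distance from $a$ and $v\,R\,y$, then not $v\,R\,z$; - $R$ is well-founded. Let $b\approx c$ if $(M_0,R)\restriction b\cong(M_0,R)\restriction c$, and let $(\tilde M_0,\tilde R)$ be the quotient of $(M_0,R)$ by $\approx$, with $[b]\,\tilde R\,[c]$ if $b_0\,R\,c_0$ for some $b_0\approx b$, $c_0\approx c$. The coding pair $(M_0,R)$ is a *coding pair for $x$* if $x$ is the unique set such that $(\tilde M_0,\tilde R)\cong(\mathrm{TC}(\{x\}),\in)$. **Theorem.** Let $(M,\mathcal C)$ be a $\beta$-model of MK\*, and let $$M^+=\{x\mid\text{there is a coding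 pair in }(M,\mathcal C)\text{ for }x\}.$$ Then $M^+$ is a set, and it is the unique transitive set with the following three properties: - (a) $M^+\models\mathrm{SetMK}^*$; - (b) $\mathcal C=P(M)\cap M^+$; - (c) for some $\kappa\in M^+$: $M=V_\kappa^{M^+}$, $\kappa$ is the largest cardinal in $M^+$, and $\kappa$ is strongly inaccessible in $M^+$. Here "unique" means that every transitive set $N$ that satisfies (a), (b) and (c) with $N$ in place of $M^+$ is equal to $M^+$. -/

import Mathlib

universe u

/-! ### First-order set theory: structures `(A, E)` with one binary relation

All notions below are evaluated *inside* the structure: every quantifier ranges over `A`. -/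

namespace SetTheoryModel

/-- The only relation symbol of the language of set theory, a binary one. -/
inductive MemSymbol : ℕ → Type
  | mem : MemSymbol 2

/-- The first-order language of set theory. -/
def setLang : FirstOrder.Language.{0, 0} := ⟨fun _ => Empty, MemSymbol⟩

variable {A : Type*}

/-- The structure `(A, E)`. -/
@[reducible] def setStructure (E : A → A → Prop) : setLang.Structure A where
  funMap := fun f _ => Empty.elim f
  RelMap := fun r v => match r, v with
    | .mem, v => E (v 0) (v 1)

/-- `(A, E) ⊨ φ[v]`. -/
def Sat (E : A → A → Prop) {n : ℕ} (φ : setLang.Formula (Fin n)) (v : Fin n → A) : Prop :=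
  @FirstOrder.Language.Formula.Realize setLang A (setStructure E) (Fin n) φ v

/-- `z = {x, y}`. -/
def IsPairSet (E : A → A → Prop) (z x y : A) : Prop := ∀ w, E w z ↔ w = x ∨ w = y

/-- `p = ⟨x, y⟩ = {{x}, {x, y}}`. -/
def IsOrdPair (E : A → A → Prop) (p x y : A) : Prop :=
  ∃ s t, IsPairSet E s x x ∧ IsPairSet E t x y ∧ IsPairSet E p s t

/-- `⟨x, y⟩ ∈ f`. -/
def Related (E : A → A → Prop) (f x y : A) : Prop := ∃ p, E p f ∧ IsOrdPair E p x y

/-- `f` is a function from `a` to `b`. -/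
def IsFunc (E : A → A → Prop) (f a b : A) : Prop :=
  (∀ p, E p f → ∃ x y, E x a ∧ E y b ∧ IsOrdPair E p x y) ∧
  ∀ x, E x a → ∃! y, Related E f x y

/-- `f` is an injective function from `a` to `b`. -/
def IsInjection (E : A → A → Prop) (f a b : A) : Prop :=
  IsFunc E f a b ∧ ∀ x x' y, Related E f x y → Related E f x' y → x = x'

/-- `f` is a bijection from `a` onto `b`. -/
def IsBijection (E : A → A → Prop) (f a b : A) : Prop :=
  IsInjection E f a b ∧ ∀ y, E y b → ∃ x, E x a ∧ Related E f x y

/-- `t` is transitive. -/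
def IsTrans (E : A → A → Prop) (t : A) : Prop := ∀ x, E x t → ∀ y, E y x → E y t

/-- `a` is an ordinal (in the presence of Foundation: a transitive set of transitive sets). -/
def IsOrd (E : A → A → Prop) (a : A) : Prop := IsTrans E a ∧ ∀ x, E x a → IsTrans E x

/-- `a` is a nonzero limit ordinal. -/
def IsLimitOrd (E : A → A → Prop) (a : A) : Prop :=
  IsOrd E a ∧ (∃ x, E x a) ∧ ∀ x, E x a → ∃ y, E y a ∧ E x y

/-- `k` is a cardinal: an ordinal that is not equinumerous with any smaller ordinal. -/
def IsCard (E : A → A → Prop) (k : A) : Prop :=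
  IsOrd E k ∧ ∀ a, E a k → ¬ ∃ f, IsBijection E f a k

/-- `p` is the power set of `a`. -/
def IsPowerSet (E : A → A → Prop) (p a : A) : Prop := ∀ z, E z p ↔ ∀ w, E w z → E w a

/-- `k` is a strongly inaccessible cardinal: uncountable, regular and a strong limit
(where the power sets of the smaller ordinals are required to exist). -/
structure IsStronglyInaccessible (E : A → A → Prop) (k : A) : Prop where
  card : IsCard E k
  uncountable : ∃ w, E w k ∧ IsLimitOrd E w
  regular : ∀ a, E a k → ∀ f, IsFunc E f a k →
    ∃ b, E b k ∧ ∀ x y, Related E f x y → E y b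
  strongLimit : ∀ a, E a k → ∃ p, IsPowerSet E p a ∧
    ∃ b, E b k ∧ ∃ f, IsInjection E f p b

/-- `k` is the largest cardinal. -/
def IsLargestCard (E : A → A → Prop) (k : A) : Prop :=
  IsCard E k ∧ ∀ m, IsCard E m → m = k ∨ E m k

/-- `f` is a function with domain `t` that satisfies the recursion of the rank function,
`f(y) = {β | β ≤ f(z) for some z ∈ y} = sup {f(z) + 1 | z ∈ y}`. -/
def IsRankFunc (E : A → A → Prop) (f t : A) : Prop :=
  (∃ b, IsFunc E f t b) ∧
  ∀ y a, Related E f y a → ∀ β, E β a ↔ ∃ z c, E z y ∧ Related E f z c ∧ (β = c ∨ E β c)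

/-- `x ∈ V_k`, i.e. the rank of `x` is less than `k`; the rank is computed by a rank function
on a transitive set that contains `x`. -/
def InV (E : A → A → Prop) (k x : A) : Prop :=
  ∃ t f, IsTrans E t ∧ E x t ∧ IsRankFunc E f t ∧ ∃ r, Related E f x r ∧ E r k

/-- `r` (a set of ordered pairs) well-orders `x`. -/
def IsWellOrderOf (E : A → A → Prop) (r x : A) : Prop :=
  (∀ a, E a x → ¬ Related E r a a) ∧
  (∀ a b c, E a x → E b x → E c x → Related E r a b → Related E r b c → Related E r a c) ∧
  (∀ a b, E a x → E b x → a = b ∨ Related E r a b ∨ Related E r b a) ∧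
  ∀ y, (∃ a, E a y) → (∀ a, E a y → E a x) →
    ∃ a, E a y ∧ ∀ b, E b y → b = a ∨ Related E r a b

/-- `y = x ∪ {x}`. -/
def IsSucc (E : A → A → Prop) (y x : A) : Prop := ∀ w, E w y ↔ E w x ∨ w = x

/-- There is an infinite set (a set that contains `∅` and is closed under `x ↦ x ∪ {x}`). -/
def Infinity (E : A → A → Prop) : Prop :=
  ∃ x, (∃ e, E e x ∧ ∀ w, ¬ E w e) ∧ ∀ y, E y x → ∃ s, E s x ∧ IsSucc E s y

/-- ZFC without the power set axiom, with the Bounding (Collection) scheme (from which, with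
Separation, the Replacement scheme follows) and with choice in the form that every set can be
well-ordered. -/
structure ZFCMinus (E : A → A → Prop) : Prop where
  extensionality : ∀ x y, (∀ z, E z x ↔ E z y) → x = y
  foundation : ∀ x, (∃ y, E y x) → ∃ y, E y x ∧ ∀ z, E z x → ¬ E z y
  pairing : ∀ x y, ∃ z, IsPairSet E z x y
  union : ∀ x, ∃ y, ∀ w, E w y ↔ ∃ z, E z x ∧ E w z
  infinity : Infinity E
  separation : ∀ (n : ℕ) (φ : setLang.Formula (Fin (n + 1))) (p : Fin n → A) (a : A),
    ∃ b, ∀ x, E x b ↔ E x a ∧ Sat E φ (Fin.cons x p)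
  bounding : ∀ (n : ℕ) (φ : setLang.Formula (Fin (n + 2))) (p : Fin n → A) (a : A),
    (∀ x, E x a → ∃ y, Sat E φ (Fin.cons x (Fin.cons y p))) →
    ∃ b, ∀ x, E x a → ∃ y, E y b ∧ Sat E φ (Fin.cons x (Fin.cons y p))
  choice : ∀ x, ∃ r, IsWellOrderOf E r x

/-- The axioms of SetMK*: ZFC⁻ (with Bounding), and there is a strongly inaccessible cardinal
`κ` such that every set can be mapped injectively into `κ`. -/
structure SetMKStar (E : A → A → Prop) : Prop where
  zfcMinus : ZFCMinus E
  inaccessible : ∃ k, IsStronglyInaccessible E k ∧ ∀ x, ∃ f, IsInjection E f x k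

end SetTheoryModel

/-! ### Morse–Kelley class theory: two-sorted structures `(S, K, E, F)`

`S` is the sort of sets, `K` the sort of classes, `E` is membership of sets in sets and `F` is
membership of sets in classes. -/

namespace ClassTheoryModel

open SetTheoryModel

/-- Formulas of two-sorted class theory with `n` free set variables and `m` free class variables
(de Bruijn indices: a quantifier binds the variable with index `0`). -/
inductive ClassFormula : ℕ → ℕ → Type
  | eqSet {n m : ℕ} (i j : Fin n) : ClassFormula n m
  | eqClass {n m : ℕ} (i j : Fin m) : ClassFormula n m
  | memSet {n m : ℕ} (i j : Fin n) : ClassFormula n m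
  | memClass {n m : ℕ} (i : Fin n) (j : Fin m) : ClassFormula n m
  | neg {n m : ℕ} (φ : ClassFormula n m) : ClassFormula n m
  | and {n m : ℕ} (φ ψ : ClassFormula n m) : ClassFormula n m
  | allSet {n m : ℕ} (φ : ClassFormula (n + 1) m) : ClassFormula n m
  | allClass {n m : ℕ} (φ : ClassFormula n (m + 1)) : ClassFormula n m

variable {S K : Type*}

/-- Truth of a formula of class theory at the set assignment `s` and class assignment `C`. -/
def Holds (E : S → S → Prop) (F : S → K → Prop) :
    {n m : ℕ} → ClassFormula n m → (Fin n → S) → (Fin m → K) → Prop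
  | _, _, .eqSet i j, s, _ => s i = s j
  | _, _, .eqClass i j, _, C => C i = C j
  | _, _, .memSet i j, s, _ => E (s i) (s j)
  | _, _, .memClass i j, s, C => F (s i) (C j)
  | _, _, .neg φ, s, C => ¬ Holds E F φ s C
  | _, _, .and φ ψ, s, C => Holds E F φ s C ∧ Holds E F ψ s C
  | _, _, .allSet φ, s, C => ∀ x : S, Holds E F φ (Fin.cons x s) C
  | _, _, .allClass φ, s, C => ∀ X : K, Holds E F φ s (Fin.cons X C)

/-- `⟨x, y⟩ ∈ G` for a class `G`. -/
def CRelated (E : S → S → Prop) (F : S → K → Prop) (G : K) (x y : S) : Prop :=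
  ∃ p, F p G ∧ IsOrdPair E p x y

/-- The class `G` is a function. -/
def IsClassFunc (E : S → S → Prop) (F : S → K → Prop) (G : K) : Prop :=
  (∀ p, F p G → ∃ x y, IsOrdPair E p x y) ∧
  ∀ x y y', CRelated E F G x y → CRelated E F G x y' → y = y'

/-- The class `W` is a well-ordering of the universe of sets. -/
def IsGlobalWellOrder (E : S → S → Prop) (F : S → K → Prop) (W : K) : Prop :=
  (∀ a, ¬ CRelated E F W a a) ∧
  (∀ a b c, CRelated E F W a b → CRelated E F W b c → CRelated E F W a c) ∧
  (∀ a b, a = b ∨ CRelated E F W a b ∨ CRelated E F W b a) ∧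
  ∀ X : K, (∃ a, F a X) → ∃ a, F a X ∧ ∀ b, F b X → b = a ∨ CRelated E F W a b

/-- The axioms of Morse–Kelley class theory MK. -/
structure MK (E : S → S → Prop) (F : S → K → Prop) : Prop where
  extensionality : ∀ x y, (∀ z, E z x ↔ E z y) → x = y
  pairing : ∀ x y, ∃ z, IsPairSet E z x y
  infinity : Infinity E
  union : ∀ x, ∃ y, ∀ w, E w y ↔ ∃ z, E z x ∧ E w z
  powerSet : ∀ x, ∃ p, IsPowerSet E p x
  foundation : ∀ X : K, (∃ x, F x X) → ∃ x, F x X ∧ ∀ y, F y X → ¬ E y x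
  classExtensionality : ∀ X Y : K, (∀ z, F z X ↔ F z Y) → X = Y
  replacement : ∀ G : K, IsClassFunc E F G → ∀ x, ∃ y, ∀ w,
    E w y ↔ ∃ z, E z x ∧ CRelated E F G z w
  comprehension : ∀ (n m : ℕ) (φ : ClassFormula (n + 1) m) (s : Fin n → S) (C : Fin m → K),
    ∃ Y : K, ∀ x, F x Y ↔ Holds E F φ (Fin.cons x s) C
  globalChoice : ∃ W : K, IsGlobalWellOrder E F W

/-- The axioms of MK*: MK together with the Class-Bounding scheme
`∀ x ∃ A φ(x, A) → ∃ B ∀ x ∃ y φ(x, (B)_y)` where `(B)_y = {z | ⟨y, z⟩ ∈ B}`. -/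
structure MKStar (E : S → S → Prop) (F : S → K → Prop) : Prop where
  mkAxioms : MK E F
  classBounding : ∀ (n m : ℕ) (φ : ClassFormula (n + 1) (m + 1)) (s : Fin n → S) (C : Fin m → K),
    (∀ x, ∃ A : K, Holds E F φ (Fin.cons x s) (Fin.cons A C)) →
    ∃ B : K, ∀ x, ∃ y, ∃ A : K, (∀ z, F z A ↔ CRelated E F B y z) ∧
      Holds E F φ (Fin.cons x s) (Fin.cons A C)

/-- The class `R` is well-founded in the sense of the model: every nonempty class of the model
has an `R`-minimal element. -/
def WellFoundedIn (E : S → S → Prop) (F : S → K → Prop) (R : K) : Prop :=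
  ∀ X : K, (∃ x, F x X) → ∃ x, F x X ∧ ∀ y, F y X → ¬ CRelated E F R y x

end ClassTheoryModel

/-! ### Models given by sets, `β`-models -/

open SetTheoryModel ClassTheoryModel

/-- Membership between the elements of `N` and the elements of `D`. -/
def memRel (N D : ZFSet.{u}) : {x : ZFSet.{u} // x ∈ N} → {X : ZFSet.{u} // X ∈ D} → Prop :=
  fun x y => x.1 ∈ y.1

/-- The binary relation given by the ordered pairs in `R`. -/
def pairRel (R : ZFSet.{u}) : ZFSet.{u} → ZFSet.{u} → Prop := fun x y => ZFSet.pair x y ∈ R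

/-- `(M, C)` is a `β`-model of MK*: `M` is transitive, every class is a subset of `M`, the axioms
of MK* hold in `⟨M, ∈, C⟩`, and a class is well-founded in `(M, C)` if and only if it is
well-founded. -/
structure IsBetaModelMKStar (M C : ZFSet.{u}) : Prop where
  transitive : M.IsTransitive
  subset : ∀ X ∈ C, X ⊆ M
  mkStar : MKStar (memRel M M) (memRel M C)
  beta : ∀ R : {X : ZFSet.{u} // X ∈ C},
    WellFoundedIn (memRel M M) (memRel M C) R ↔ WellFounded (pairRel R.1)

/-! ### Coding pairs -/

/-- There is an `R`-chain `z R z_{n-1} R ⋯ R z_1 R a` of length `n` from `z` to `a`. -/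
def HasDist (R : ZFSet.{u}) : ℕ → ZFSet.{u} → ZFSet.{u} → Prop
  | 0, z, a => z = a
  | n + 1, z, a => ∃ w, pairRel R z w ∧ HasDist R n w a

/-- The subtree at `y`: `y` together with all elements that are connected to `y` by an
`R`-chain. -/
def Subtree (R y : ZFSet.{u}) : Type (u + 1) :=
  {z : ZFSet.{u} // Relation.ReflTransGen (pairRel R) z y}

/-- The relation `R` on the subtree at `y`. -/
def subtreeRel (R y : ZFSet.{u}) : Subtree R y → Subtree R y → Prop :=
  fun v w => pairRel R v.1 w.1

/-- The subtrees at `y` and at `z` are isomorphic. -/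
def SubtreeIso (R y z : ZFSet.{u}) : Prop := Nonempty (subtreeRel R y ≃r subtreeRel R z)

/-- `(M₀, R)` is a coding pair, with distinguished element `a`, over the family `C` of classes. -/
structure IsCodingPair (C M₀ R a : ZFSet.{u}) : Prop where
  mem_dom : M₀ ∈ C
  mem_rel : R ∈ C
  top_mem : a ∈ M₀
  rel_on : ∀ p ∈ R, ∃ x ∈ M₀, ∃ y ∈ M₀, p = ZFSet.pair x y
  dist : ∀ z ∈ M₀, ∃! n, HasDist R n z a
  not_iso : ∀ x ∈ M₀, ∀ y ∈ M₀, ∀ z ∈ M₀, y ≠ z → pairRel R y x → pairRel R z x →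
    ¬ SubtreeIso R y z
  disjoint : ∀ n, ∀ y ∈ M₀, ∀ z ∈ M₀, HasDist R n y a → HasDist R n z a → y ≠ z →
    ∀ v, pairRel R v y → ¬ pairRel R v z
  wf : WellFounded (pairRel R)

/-- Nodes are identified if their subtrees are isomorphic. -/
def nodeSetoid (M₀ R : ZFSet.{u}) : Setoid {z : ZFSet.{u} // z ∈ M₀} where
  r a b := SubtreeIso R a.1 b.1
  iseqv :=
    ⟨fun _ => ⟨RelIso.refl _⟩, fun ⟨e⟩ => ⟨e.symm⟩, fun ⟨e⟩ ⟨f⟩ => ⟨e.trans f⟩⟩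

/-- The relation on the quotient of `(M₀, R)`: two equivalence classes are related if they have
`R`-related members. -/
def quotRel (M₀ R : ZFSet.{u}) :
    Quotient (nodeSetoid M₀ R) → Quotient (nodeSetoid M₀ R) → Prop :=
  fun p q => ∃ a b : {z : ZFSet.{u} // z ∈ M₀},
    Quotient.mk (nodeSetoid M₀ R) a = p ∧ Quotient.mk (nodeSetoid M₀ R) b = q ∧ pairRel R a.1 b.1

/-- The transitive closure `TC({x})` of `{x}`. -/
def TCSingleton (x : ZFSet.{u}) : Type (u + 1) :=
  {y : ZFSet.{u} // Relation.ReflTransGen (fun v w : ZFSet.{u} => v ∈ w) y x}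

/-- Membership on `TC({x})`. -/
def tcMem (x : ZFSet.{u}) : TCSingleton x → TCSingleton x → Prop := fun v w => v.1 ∈ w.1

/-- `(M₀, R)` is a coding pair for `x`: it is a coding pair and `x` is the unique set such that
the quotient of `(M₀, R)` is isomorphic to `(TC({x}), ∈)`. -/
def IsCodingPairFor (C M₀ R x : ZFSet.{u}) : Prop :=
  (∃ a, IsCodingPair C M₀ R a) ∧
  Nonempty (quotRel M₀ R ≃r tcMem x) ∧
  ∀ y, Nonempty (quotRel M₀ R ≃r tcMem y) → y = x

/-- The collection `M⁺` of all sets for which there is a coding pair. -/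
def codedSets (C : ZFSet.{u}) : Set ZFSet.{u} := {x | ∃ M₀ R, IsCodingPairFor C M₀ R x}

/-- `N` is a transitive set such that `N ⊨ SetMK*`, `C = P(M) ∩ N`, and `M = V_κ^N` for some `κ`
which is the largest cardinal of `N` and strongly inaccessible in `N`. -/
structure IsAssociatedModel (M C N : ZFSet.{u}) : Prop where
  transitive : N.IsTransitive
  setMKStar : SetMKStar (memRel N N)
  classes : C = M.powerset ∩ N
  sets : ∃ k : {x : ZFSet.{u} // x ∈ N},
    (∀ x : ZFSet.{u}, x ∈ M ↔ ∃ h : x ∈ N, InV (memRel N N) k ⟨x, h⟩) ∧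
    IsLargestCard (memRel N N) k ∧ IsStronglyInaccessible (memRel N N) k

/-! A class `X` and a point `a` of `M` code the set `collapse X a`, the Mostowski collapse of `a`
under `X`, where an ill-founded `X` counts as the empty relation. `codedModel M C` consists of all
these collapses and turns out to be `M⁺`. The tree conditions on coding pairs enter only at the end:
isomorphism of subtrees amounts to equality of collapses (`IsCodingPair.subtreeIso_iff`), and every
code can be pruned and unravelled into a coding pair (`exists_isCodingPair`).

Since `(M, C)` is a `β`-model, well-foundedness of a class is definable in it. Two codes have the
same collapse exactly if some class is a bisimulation between them (`exists_isBisim`), so equality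
and membership of coded sets are definable, and with them the truth of every formula in the coded
model (`dfn_realize`). Class-Bounding, with the sections of a class glued into one relation
(`exists_sectionImage`), gives Bounding for coded sets (`exists_coded_bound`); with Comprehension
this yields Separation and the other closure properties.

Let `κ` be the set of ordinals of `M`. Global Choice, rearranged to have initial segments in `M`,
enumerates every coded set in order type at most `κ` (`exists_enumeration`). So `κ` is the largest
cardinal, and Replacement and Power Set in `M` make it strongly inaccessible.

For uniqueness, let `N` satisfy (a), (b) and (c). A transitive set of `N` is injected into `κ`, and
its membership relation copied along the injection is a class, so its elements are coded. Conversely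
`N` can form the collapse of every well-founded class (`IsAssociatedModel.eq_codedModel`). -/

set_option linter.unusedSectionVars false

namespace ClassTheoryModel

open SetTheoryModel

/-! ### Definability with parameters in two-sorted structures -/

section Definability

variable {S K : Type*} {E : S → S → Prop} {F : S → K → Prop}

/-- The maps need not be injective, so weakening, permutation and identification of variables are
all covered. Under a quantifier the map is extended to fix the bound index `0`. -/
theorem exists_renaming {n m : ℕ} (φ : ClassFormula n m) :
    ∀ {n' m' : ℕ} (f : Fin n → Fin n') (g : Fin m → Fin m'), ∃ ψ : ClassFormula n' m',
      ∀ (s : Fin n' → S) (C : Fin m' → K),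
        Holds E F ψ s C ↔ Holds E F φ (s ∘ f) (C ∘ g) := by
  induction φ with
  | eqSet i j => exact fun f g => ⟨.eqSet (f i) (f j), fun s C => Iff.rfl⟩
  | eqClass i j => exact fun f g => ⟨.eqClass (g i) (g j), fun s C => Iff.rfl⟩
  | memSet i j => exact fun f g => ⟨.memSet (f i) (f j), fun s C => Iff.rfl⟩
  | memClass i j => exact fun f g => ⟨.memClass (f i) (g j), fun s C => Iff.rfl⟩
  | neg φ ih =>
    intro n' m' f g
    obtain ⟨ψ, h⟩ := ih f g
    exact ⟨.neg ψ, fun s C => not_congr (h s C)⟩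
  | and φ ψ ih₁ ih₂ =>
    intro n' m' f g
    obtain ⟨ψ₁, h₁⟩ := ih₁ f g
    obtain ⟨ψ₂, h₂⟩ := ih₂ f g
    exact ⟨.and ψ₁ ψ₂, fun s C => and_congr (h₁ s C) (h₂ s C)⟩
  | allSet φ ih =>
    intro n' m' f g
    obtain ⟨ψ, h⟩ := ih (Fin.cons 0 (Fin.succ ∘ f)) g
    refine ⟨.allSet ψ, fun s C => forall_congr' fun x => (h _ _).trans ?_⟩
    rw [show (Fin.cons x s : Fin (n' + 1) → S) ∘ (Fin.cons 0 (Fin.succ ∘ f)) =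
      Fin.cons x (s ∘ f) from funext fun i => by cases i using Fin.cases <;> rfl]
  | allClass φ ih =>
    intro n' m' f g
    obtain ⟨ψ, h⟩ := ih f (Fin.cons 0 (Fin.succ ∘ g))
    refine ⟨.allClass ψ, fun s C => forall_congr' fun x => (h _ _).trans ?_⟩
    rw [show (Fin.cons x C : Fin (m' + 1) → K) ∘ (Fin.cons 0 (Fin.succ ∘ g)) =
      Fin.cons x (C ∘ g) from funext fun i => by cases i using Fin.cases <;> rfl]

/-- The predicate `P` of `n` sets and `m` classes is definable with parameters in `(S, K, E, F)`:
each free variable of the defining formula is an argument of `P` or a parameter. -/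
class Dfn (E : S → S → Prop) (F : S → K → Prop) {n m : ℕ}
    (P : (Fin n → S) → (Fin m → K) → Prop) : Prop where
  out : ∃ (n' m' : ℕ) (φ : ClassFormula n' m') (σ : Fin n' → Fin n ⊕ S) (τ : Fin m' → Fin m ⊕ K),
    ∀ s C, Holds E F φ (fun i => Sum.elim s id (σ i)) (fun j => Sum.elim C id (τ j)) ↔ P s C

/-- `t` is a set variable or a set parameter. -/
class SetTerm {n m : ℕ} (t : (Fin n → S) → (Fin m → K) → S) : Prop where
  out : ∃ a : Fin n ⊕ S, ∀ s C, t s C = Sum.elim s id a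

/-- `t` is a class variable or a class parameter. -/
class ClassTerm {n m : ℕ} (t : (Fin n → S) → (Fin m → K) → K) : Prop where
  out : ∃ a : Fin m ⊕ K, ∀ s C, t s C = Sum.elim C id a

variable {n m : ℕ}

instance (i : Fin n) : SetTerm (fun (s : Fin n → S) (_ : Fin m → K) => s i) := ⟨.inl i, fun _ _ => rfl⟩
instance (c : S) : SetTerm (fun (_ : Fin n → S) (_ : Fin m → K) => c) := ⟨.inr c, fun _ _ => rfl⟩
instance (i : Fin m) : ClassTerm (fun (_ : Fin n → S) (C : Fin m → K) => C i) := ⟨.inl i, fun _ _ => rfl⟩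
instance (c : K) : ClassTerm (fun (_ : Fin n → S) (_ : Fin m → K) => c) := ⟨.inr c, fun _ _ => rfl⟩

theorem Dfn.congr {P Q : (Fin n → S) → (Fin m → K) → Prop} (hP : Dfn E F P)
    (h : ∀ s C, Q s C ↔ P s C) : Dfn E F Q := by
  rwa [show Q = P from funext fun s => funext fun C => propext (h s C)]

/-- Terms are only variables or parameters, so substitution just composes assignments. Later
instances are proved for distinct variables and carried over to arbitrary terms by this lemma. -/
theorem Dfn.subst {k l : ℕ} {P : (Fin k → S) → (Fin l → K) → Prop} (hP : Dfn E F P)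
    (t : Fin k → (Fin n → S) → (Fin m → K) → S) (T : Fin l → (Fin n → S) → (Fin m → K) → K)
    (ht : ∀ i, SetTerm (t i)) (hT : ∀ j, ClassTerm (T j)) :
    Dfn E F (fun s C => P (fun i => t i s C) (fun j => T j s C)) := by
  obtain ⟨n', m', φ, σ, τ, h⟩ := hP
  choose a ha using fun i => (ht i).out
  choose b hb using fun i => (hT i).out
  refine ⟨n', m', φ, fun i => Sum.elim a .inr (σ i), fun j => Sum.elim b .inr (τ j),
    fun s C => Iff.trans (Iff.of_eq ?_) (h _ _)⟩
  congr 1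
  · funext i
    rcases hσ : σ i with j | c <;> simp [hσ, ha]
  · funext i
    rcases hτ : τ i with j | c <;> simp [hτ, hb]

/-- Turns a definability hypothesis at one fixed arity into an instance at every arity, as is needed
when `P` occurs under quantifiers. -/
theorem Dfn.apply₁ {P : S → Prop} (h : Dfn E F fun (s : Fin 1 → S) (_ : Fin 0 → K) => P (s 0))
    {n m : ℕ} (x : (Fin n → S) → (Fin m → K) → S) [SetTerm x] :
    Dfn E F (fun s C => P (x s C)) :=
  Dfn.subst h ![x] ![] (by simpa) (by simp)

theorem Dfn.apply₂ {P : S → S → Prop}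
    (h : Dfn E F fun (s : Fin 2 → S) (_ : Fin 0 → K) => P (s 0) (s 1))
    {n m : ℕ} (x y : (Fin n → S) → (Fin m → K) → S) [SetTerm x] [SetTerm y] :
    Dfn E F (fun s C => P (x s C) (y s C)) :=
  Dfn.subst h ![x, y] ![] (by simp [Fin.forall_fin_two, *]) (by simp)

theorem Dfn.applyClass {P : S → K → S → Prop}
    (h : Dfn E F fun (s : Fin 2 → S) (C : Fin 1 → K) => P (s 0) (C 0) (s 1))
    {n m : ℕ} (x y : (Fin n → S) → (Fin m → K) → S) (X : (Fin n → S) → (Fin m → K) → K)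
    [SetTerm x] [SetTerm y] [ClassTerm X] :
    Dfn E F (fun s C => P (x s C) (X s C) (y s C)) :=
  Dfn.subst h ![x, y] ![X] (by simp [Fin.forall_fin_two, *]) (by simpa)

theorem dfn_eqSet (t₁ t₂ : (Fin n → S) → (Fin m → K) → S) [h₁ : SetTerm t₁] [h₂ : SetTerm t₂] :
    Dfn E F (fun s C => t₁ s C = t₂ s C) := by
  obtain ⟨a, ha⟩ := h₁
  obtain ⟨b, hb⟩ := h₂
  exact ⟨2, 0, .eqSet 0 1, ![a, b], Fin.elim0, fun s C => by simp [Holds, ha, hb]⟩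

theorem dfn_memSet (t₁ t₂ : (Fin n → S) → (Fin m → K) → S) [h₁ : SetTerm t₁] [h₂ : SetTerm t₂] :
    Dfn E F (fun s C => E (t₁ s C) (t₂ s C)) := by
  obtain ⟨a, ha⟩ := h₁
  obtain ⟨b, hb⟩ := h₂
  exact ⟨2, 0, .memSet 0 1, ![a, b], Fin.elim0, fun s C => by simp [Holds, ha, hb]⟩

theorem dfn_memClass (t₁ : (Fin n → S) → (Fin m → K) → S) (t₂ : (Fin n → S) → (Fin m → K) → K)
    [h₁ : SetTerm t₁] [h₂ : ClassTerm t₂] : Dfn E F (fun s C => F (t₁ s C) (t₂ s C)) := by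
  obtain ⟨a, ha⟩ := h₁
  obtain ⟨b, hb⟩ := h₂
  exact ⟨1, 1, .memClass 0 0, ![a], ![b], fun s C => by simp [Holds, ha, hb]⟩

instance (t₁ t₂ : (Fin n → S) → (Fin m → K) → S) [SetTerm t₁] [SetTerm t₂] :
    Dfn E F (fun s C => t₁ s C = t₂ s C) := dfn_eqSet t₁ t₂

instance (P : (Fin n → S) → (Fin m → K) → Prop) [h : Dfn E F P] :
    Dfn E F (fun s C => ¬ P s C) := by
  obtain ⟨n', m', φ, σ, τ, h⟩ := h
  exact ⟨n', m', .neg φ, σ, τ, fun s C => not_congr (h s C)⟩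

instance dfn_and (P Q : (Fin n → S) → (Fin m → K) → Prop) [hP : Dfn E F P] [hQ : Dfn E F Q] :
    Dfn E F (fun s C => P s C ∧ Q s C) := by
  obtain ⟨n₁, m₁, φ, σ₁, τ₁, h₁⟩ := hP
  obtain ⟨n₂, m₂, ψ, σ₂, τ₂, h₂⟩ := hQ
  obtain ⟨φ', hφ⟩ := exists_renaming (E := E) (F := F) φ (Fin.castAdd n₂) (Fin.castAdd m₂)
  obtain ⟨ψ', hψ⟩ := exists_renaming (E := E) (F := F) ψ (Fin.natAdd n₁) (Fin.natAdd m₁)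
  refine ⟨n₁ + n₂, m₁ + m₂, .and φ' ψ', Fin.append σ₁ σ₂, Fin.append τ₁ τ₂, fun s C => ?_⟩
  simp only [Holds, hφ, hψ, ← h₁, ← h₂, Function.comp_def, Fin.append_left, Fin.append_right]

instance (P Q : (Fin n → S) → (Fin m → K) → Prop) [Dfn E F P] [Dfn E F Q] :
    Dfn E F (fun s C => P s C ∨ Q s C) :=
  Dfn.congr (P := fun s C => ¬ (¬ P s C ∧ ¬ Q s C)) inferInstance fun _ _ => or_iff_not_and_not

instance (P Q : (Fin n → S) → (Fin m → K) → Prop) [Dfn E F P] [Dfn E F Q] :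
    Dfn E F (fun s C => P s C → Q s C) :=
  Dfn.congr (P := fun s C => ¬ (P s C ∧ ¬ Q s C)) inferInstance fun _ _ => by tauto

instance (P Q : (Fin n → S) → (Fin m → K) → Prop) [Dfn E F P] [Dfn E F Q] :
    Dfn E F (fun s C => P s C ↔ Q s C) :=
  Dfn.congr (P := fun s C => (P s C → Q s C) ∧ (Q s C → P s C)) inferInstance
    fun _ _ => iff_def

variable [Nonempty S] [Nonempty K]

instance (P : (Fin n → S) → (Fin m → K) → S → Prop)
    [h : Dfn E F (n := n + 1) (fun s C => P (fun i => s i.succ) C (s 0))] :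
    Dfn E F (fun s C => ∀ x : S, P s C x) := by
  obtain ⟨n', m', φ, σ, τ, h⟩ := h
  obtain ⟨φ', hφ⟩ := exists_renaming (E := E) (F := F) φ
    (fun i => Sum.elim (fun j : Fin (n + 1) => Fin.cases (motive := fun _ => Fin (n' + 1)) 0
      (fun _ => i.succ) j) (fun _ => i.succ) (σ i)) id
  -- The positions captured by the new quantifier no longer read this assignment, so an arbitrary
  -- element of `S` fills them.
  refine ⟨n', m', .allSet φ', fun i => Sum.elim (fun j : Fin (n + 1) =>
    Fin.cases (motive := fun _ => Fin n ⊕ S) (.inr (Classical.arbitrary S)) .inl j) .inr (σ i), τ,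
    fun s C => forall_congr' fun x => (hφ _ _).trans ((Iff.of_eq ?_).trans
      (h (Fin.cons x s) C))⟩
  congr 1
  funext i
  simp only [Function.comp]
  rcases hσ : σ i with j | c
  · cases j using Fin.cases <;> simp [hσ]
  · simp [hσ]

instance (P : (Fin n → S) → (Fin m → K) → K → Prop)
    [h : Dfn E F (m := m + 1) (fun s C => P s (fun i => C i.succ) (C 0))] :
    Dfn E F (fun s C => ∀ X : K, P s C X) := by
  obtain ⟨n', m', φ, σ, τ, h⟩ := h
  obtain ⟨φ', hφ⟩ := exists_renaming (E := E) (F := F) φ id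
    (fun i => Sum.elim (fun j : Fin (m + 1) => Fin.cases (motive := fun _ => Fin (m' + 1)) 0
      (fun _ => i.succ) j) (fun _ => i.succ) (τ i))
  refine ⟨n', m', .allClass φ', σ, fun i => Sum.elim (fun j : Fin (m + 1) =>
    Fin.cases (motive := fun _ => Fin m ⊕ K) (.inr (Classical.arbitrary K)) .inl j) .inr (τ i),
    fun s C => forall_congr' fun x => (hφ _ _).trans ((Iff.of_eq ?_).trans
      (h s (Fin.cons x C)))⟩
  congr 1
  funext i
  simp only [Function.comp]
  rcases hτ : τ i with j | c
  · cases j using Fin.cases <;> simp [hτ]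
  · simp [hτ]

instance (P : (Fin n → S) → (Fin m → K) → S → Prop)
    [Dfn E F (n := n + 1) (fun s C => P (fun i => s i.succ) C (s 0))] :
    Dfn E F (fun s C => ∃ x : S, P s C x) :=
  Dfn.congr (P := fun s C => ¬ ∀ x : S, ¬ P s C x) inferInstance fun s C => by simp

instance (P : (Fin n → S) → (Fin m → K) → K → Prop)
    [Dfn E F (m := m + 1) (fun s C => P s (fun i => C i.succ) (C 0))] :
    Dfn E F (fun s C => ∃ X : K, P s C X) :=
  Dfn.congr (P := fun s C => ¬ ∀ X : K, ¬ P s C X) inferInstance fun s C => by simp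

/-- A statement about parameters alone has a fixed truth value, so a tautology or a contradiction
defines it, in whatever terms it is expressed. -/
instance (p : Prop) : Dfn E F (fun (_ : Fin n → S) (_ : Fin m → K) => p) := by
  by_cases hp : p
  · exact Dfn.congr (P := fun _ _ => ∀ x : S, x = x) inferInstance fun s C => by simp [hp]
  · exact Dfn.congr (P := fun _ _ => ¬ ∀ x : S, x = x) inferInstance fun s C => by simp [hp]

/-- Comprehension in semantic form: the formula is supplied by instance search. -/
theorem MK.exists_class (h : MK E F) (P : S → Prop)
    [hP : Dfn E F (fun (s : Fin 1 → S) (_ : Fin 0 → K) => P (s 0))] :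
    ∃ Y : K, ∀ x, F x Y ↔ P x := by
  obtain ⟨n', m', φ, σ, τ, hφ⟩ := hP
  obtain ⟨φ', hφ'⟩ := exists_renaming (E := E) (F := F) φ
    (fun i => Sum.elim (fun _ => (0 : Fin (n' + 1))) (fun _ => i.succ) (σ i)) id
  obtain ⟨Y, hY⟩ := h.comprehension n' m' φ'
    (fun i => Sum.elim (fun _ => Classical.arbitrary S) id (σ i))
    (fun i => Sum.elim Fin.elim0 id (τ i))
  refine ⟨Y, fun x => (hY x).trans ((hφ' _ _).trans
    (Iff.trans (Iff.of_eq ?_) (hφ (fun _ => x) Fin.elim0)))⟩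
  congr 1
  · funext i
    simp only [Function.comp]
    rcases hσ : σ i with j | c <;> simp [hσ]

theorem MKStar.exists_bound (h : MKStar E F) (P : S → K → Prop)
    [hP : Dfn E F (fun (s : Fin 1 → S) (C : Fin 1 → K) => P (s 0) (C 0))]
    (hex : ∀ x, ∃ A, P x A) :
    ∃ B : K, ∀ x, ∃ y, ∃ A : K, (∀ z, F z A ↔ CRelated E F B y z) ∧ P x A := by
  obtain ⟨n', m', φ, σ, τ, hφ⟩ := hP
  obtain ⟨φ', hφ'⟩ := exists_renaming (E := E) (F := F) φ
    (fun i => Sum.elim (fun _ => (0 : Fin (n' + 1))) (fun _ => i.succ) (σ i))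
    (fun i => Sum.elim (fun _ => (0 : Fin (m' + 1))) (fun _ => i.succ) (τ i))
  have key : ∀ x A, Holds E F φ'
      (Fin.cons x fun i => Sum.elim (fun _ => Classical.arbitrary S) id (σ i))
      (Fin.cons A fun i => Sum.elim (fun _ => Classical.arbitrary K) id (τ i)) ↔ P x A := by
    intro x A
    refine (hφ' _ _).trans (Iff.trans (Iff.of_eq ?_) (hφ (fun _ => x) fun _ => A))
    congr 1
    · funext i
      simp only [Function.comp]
      rcases hσ : σ i with j | c <;> simp [hσ]
    · funext i
      simp only [Function.comp]
      rcases hτ : τ i with j | c <;> simp [hτ]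
  obtain ⟨B, hB⟩ := h.classBounding n' m' φ' _ _ fun x => (hex x).imp fun A => (key x A).2
  exact ⟨B, fun x => (hB x).imp fun y => Exists.imp fun A hA => ⟨hA.1, (key x A).1 hA.2⟩⟩

end Definability

/-! ### From class formulas to first-order formulas of set theory -/

section SetLanguage

open FirstOrder

variable {A : Type*} {E : A → A → Prop}

/-- A one-sorted structure is a two-sorted one in which both sorts and both membership relations
coincide. The definability instances thereby also serve Separation and Bounding in models of `ZFC⁻`.
-/
theorem exists_setFormula {n m : ℕ} (φ : ClassFormula n m) :
    ∃ ψ : setLang.Formula (Fin n ⊕ Fin m), ∀ s C : _ → A,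
      @Language.Formula.Realize setLang A (setStructure E) _ ψ (Sum.elim s C) ↔
        Holds E E φ s C := by
  let := setStructure E
  induction φ with
  | eqSet i j =>
    exact ⟨Language.Term.equal (Language.Term.var (.inl i)) (Language.Term.var (.inl j)), fun s C => by simp [Holds]⟩
  | eqClass i j =>
    exact ⟨Language.Term.equal (Language.Term.var (.inr i)) (Language.Term.var (.inr j)), fun s C => by simp [Holds]⟩
  | memSet i j =>
    exact ⟨Language.Relations.formula₂ (L := setLang) MemSymbol.mem (Language.Term.var (.inl i)) (Language.Term.var (.inl j)),
      fun s C => Iff.rfl⟩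
  | memClass i j =>
    exact ⟨Language.Relations.formula₂ (L := setLang) MemSymbol.mem (Language.Term.var (.inl i)) (Language.Term.var (.inr j)),
      fun s C => Iff.rfl⟩
  | neg φ ih =>
    obtain ⟨ψ, h⟩ := ih
    exact ⟨ψ.not, fun s C => by simp [Holds, ← h]⟩
  | and φ ψ ih₁ ih₂ =>
    obtain ⟨ψ₁, h₁⟩ := ih₁
    obtain ⟨ψ₂, h₂⟩ := ih₂
    exact ⟨ψ₁ ⊓ ψ₂, fun s C => by simp [Holds, ← h₁, ← h₂]⟩
  | @allSet n m φ ih =>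
    obtain ⟨ψ, h⟩ := ih
    refine ⟨(Language.BoundedFormula.relabel (n := 1) (k := 0) (Sum.elim
      (fun i : Fin (n + 1) => Fin.cases (motive := fun _ => (Fin n ⊕ Fin m) ⊕ Fin 1) (.inr 0)
        (fun j => .inl (.inl j)) i) (fun j => .inl (.inr j))) ψ).all, fun s C => ?_⟩
    simp only [Holds, Language.Formula.Realize, Language.BoundedFormula.realize_all]
    refine forall_congr' fun x => ?_
    rw [← h]
    refine Language.BoundedFormula.realize_relabel.trans (Iff.of_eq ?_)
    simp only [Language.Formula.Realize]
    congr 1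
    · funext i
      rcases i with i | i
      · cases i using Fin.cases <;> rfl
      · rfl
    · exact Subsingleton.elim _ _
  | @allClass n m φ ih =>
    obtain ⟨ψ, h⟩ := ih
    refine ⟨(Language.BoundedFormula.relabel (n := 1) (k := 0) (Sum.elim (fun j => .inl (.inl j))
      (fun i : Fin (m + 1) => Fin.cases (motive := fun _ => (Fin n ⊕ Fin m) ⊕ Fin 1) (.inr 0)
        (fun j => .inl (.inr j)) i)) ψ).all, fun s C => ?_⟩
    simp only [Holds, Language.Formula.Realize, Language.BoundedFormula.realize_all]
    refine forall_congr' fun x => ?_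
    rw [← h]
    refine Language.BoundedFormula.realize_relabel.trans (Iff.of_eq ?_)
    simp only [Language.Formula.Realize]
    congr 1
    · funext i
      rcases i with i | i
      · rfl
      · cases i using Fin.cases <;> rfl
    · exact Subsingleton.elim _ _

theorem exists_formula_of_dfn [Nonempty A] {n : ℕ} (P : (Fin n → A) → Prop)
    [h : Dfn E E (fun s (_ : Fin 0 → A) => P s)] :
    ∃ (k : ℕ) (φ : setLang.Formula (Fin n ⊕ Fin k)) (p : Fin k → A), ∀ s,
      @Language.Formula.Realize setLang A (setStructure E) _ φ (Sum.elim s p) ↔ P s := by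
  let := setStructure E
  obtain ⟨n', m', φ, σ, τ, h⟩ := h
  obtain ⟨ψ, hψ⟩ := exists_setFormula (E := E) φ
  refine ⟨n' + m', ψ.relabel (Sum.elim
    (fun i => Sum.elim .inl (fun _ => .inr (Fin.castAdd m' i)) (σ i))
    (fun j => .inr (Fin.natAdd n' j))),
    Fin.append (fun i => Sum.elim (fun _ => Classical.arbitrary A) id (σ i))
      (fun j => Sum.elim Fin.elim0 id (τ j)), fun s => ?_⟩
  rw [Language.Formula.realize_relabel, ← h s Fin.elim0, ← hψ]
  refine Iff.of_eq (congrArg _ (funext fun i => ?_))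
  rcases i with i | j
  · simp only [Function.comp, Sum.elim_inl]
    rcases hσ : σ i with a | a <;> simp [hσ]
  · simp only [Function.comp, Sum.elim_inr, Fin.append_right]

theorem _root_.SetTheoryModel.ZFCMinus.exists_sep (hN : ZFCMinus E) (P : A → Prop)
    [Nonempty A] [h : Dfn E E (fun (s : Fin 1 → A) (_ : Fin 0 → A) => P (s 0))] (a : A) :
    ∃ b, ∀ x, E x b ↔ E x a ∧ P x := by
  let := setStructure E
  obtain ⟨k, φ, p, hφ⟩ := exists_formula_of_dfn (E := E) (fun s : Fin 1 → A => P (s 0))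
  obtain ⟨b, hb⟩ := hN.separation k (φ.relabel (Sum.elim (fun _ => 0) Fin.succ)) p a
  refine ⟨b, fun x => (hb x).trans (and_congr_right fun _ => ?_)⟩
  rw [Sat, Language.Formula.realize_relabel, ← hφ fun _ => x]
  refine Iff.of_eq (congrArg _ (funext fun i => ?_))
  rcases i with i | j <;> rfl

theorem _root_.SetTheoryModel.ZFCMinus.exists_bound (hN : ZFCMinus E) (P : A → A → Prop)
    [Nonempty A] [h : Dfn E E (fun (s : Fin 2 → A) (_ : Fin 0 → A) => P (s 0) (s 1))] (a : A)
    (hex : ∀ x, E x a → ∃ y, P x y) : ∃ b, ∀ x, E x a → ∃ y, E y b ∧ P x y := by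
  let := setStructure E
  obtain ⟨k, φ, p, hφ⟩ := exists_formula_of_dfn (E := E) (fun s : Fin 2 → A => P (s 0) (s 1))
  have key : ∀ x y, Sat E (φ.relabel (Sum.elim (Fin.cons 0 fun _ => 1)
      (fun j => j.succ.succ))) (Fin.cons x (Fin.cons y p)) ↔ P x y := by
    intro x y
    rw [Sat, Language.Formula.realize_relabel]
    refine Iff.trans (Iff.of_eq (congrArg _ (funext fun i => ?_))) (hφ ![x, y])
    rcases i with i | j
    · fin_cases i <;> rfl
    · rfl
  obtain ⟨b, hb⟩ := hN.bounding k _ p a fun x hx => (hex x hx).imp fun y => (key x y).2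
  exact ⟨b, fun x hx => (hb x hx).imp fun y hy => ⟨hy.1, (key x y).1 hy.2⟩⟩

end SetLanguage

end ClassTheoryModel

/-! ### Absoluteness for transitive sets -/

/-- The elements of `N`. -/
abbrev Elt (N : ZFSet.{u}) : Type (u + 1) := {x : ZFSet.{u} // x ∈ N}

section Transitive

variable {N D : ZFSet.{u}}

theorem isPairSet_iff (hN : N.IsTransitive) {z x y : Elt N} :
    IsPairSet (memRel N N) z x y ↔ z.1 = {x.1, y.1} := by
  constructor
  · intro h
    ext w
    rw [ZFSet.mem_pair]
    constructor
    · intro hw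
      exact ((h ⟨w, hN.subset_of_mem z.2 hw⟩).1 hw).imp (congrArg Subtype.val) (congrArg Subtype.val)
    · rintro (rfl | rfl)
      · exact (h x).2 (.inl rfl)
      · exact (h y).2 (.inr rfl)
  · intro h w
    simp only [memRel, h, ZFSet.mem_pair, Subtype.ext_iff]

theorem isOrdPair_iff (hN : N.IsTransitive) {p x y : Elt N} :
    IsOrdPair (memRel N N) p x y ↔ p.1 = ZFSet.pair x.1 y.1 := by
  simp only [IsOrdPair, isPairSet_iff hN, ZFSet.pair]
  constructor
  · rintro ⟨s, t, hs, ht, hp⟩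
    rw [hp, hs, ht, ZFSet.pair_eq_singleton]
  · intro h
    have hs : {x.1} ∈ N := hN.subset_of_mem p.2 (h ▸ by simp)
    have ht : {x.1, y.1} ∈ N := hN.subset_of_mem p.2 (h ▸ by simp)
    exact ⟨⟨_, hs⟩, ⟨_, ht⟩, by simp, rfl, h⟩

theorem related_iff (hN : N.IsTransitive) {f x y : Elt N} :
    Related (memRel N N) f x y ↔ ZFSet.pair x.1 y.1 ∈ f.1 := by
  simp only [Related, isOrdPair_iff hN]
  constructor
  · rintro ⟨p, hp, h⟩
    exact h ▸ hp
  · intro h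
    exact ⟨⟨_, hN.subset_of_mem f.2 h⟩, h, rfl⟩

theorem cRelated_iff (hN : N.IsTransitive) (hD : ∀ X ∈ D, X ⊆ N) {X : Elt D} {x y : Elt N} :
    CRelated (memRel N N) (memRel N D) X x y ↔ ZFSet.pair x.1 y.1 ∈ X.1 := by
  simp only [CRelated, isOrdPair_iff hN]
  constructor
  · rintro ⟨p, hp, h⟩
    exact h ▸ hp
  · intro h
    exact ⟨⟨_, hD _ X.2 h⟩, h, rfl⟩

theorem isTrans_iff (hN : N.IsTransitive) {t : Elt N} :
    SetTheoryModel.IsTrans (memRel N N) t ↔ t.1.IsTransitive := by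
  constructor
  · intro h x hx y hy
    have hx' := hN.subset_of_mem t.2 hx
    exact h ⟨x, hx'⟩ hx ⟨y, hN.subset_of_mem hx' hy⟩ hy
  · intro h x hx y hy
    exact h _ hx hy

theorem isOrd_iff (hN : N.IsTransitive) {a : Elt N} :
    IsOrd (memRel N N) a ↔ a.1.IsOrdinal := by
  simp only [IsOrd, isTrans_iff hN, ZFSet.isOrdinal_iff_forall_mem_isTransitive]
  exact and_congr_right fun _ => ⟨fun h x hx => h ⟨x, hN.subset_of_mem a.2 hx⟩ hx,
    fun h x hx => h _ hx⟩

theorem mem_of_pair_mem (hN : N.IsTransitive) {x y : ZFSet.{u}} (h : ZFSet.pair x y ∈ N) :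
    x ∈ N ∧ y ∈ N := by
  have h₂ : ({x, y} : ZFSet.{u}) ∈ N := hN.subset_of_mem h (by simp [ZFSet.pair])
  exact ⟨hN.subset_of_mem h₂ (by simp), hN.subset_of_mem h₂ (by simp)⟩

/-- `f` is a function from `a` to `b`. -/
def IsFun (f a b : ZFSet.{u}) : Prop :=
  (∀ p ∈ f, ∃ x ∈ a, ∃ y ∈ b, p = ZFSet.pair x y) ∧ ∀ x ∈ a, ∃! y, ZFSet.pair x y ∈ f

theorem isFunc_iff (hN : N.IsTransitive) {f a b : Elt N} :
    IsFunc (memRel N N) f a b ↔ IsFun f.1 a.1 b.1 := by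
  have hp : ∀ {c : Elt N} {x}, x ∈ c.1 → x ∈ N := fun {c} {x} hx => hN.subset_of_mem c.2 hx
  simp only [IsFunc, IsFun, isOrdPair_iff hN, related_iff hN]
  constructor
  · rintro ⟨h₁, h₂⟩
    refine ⟨fun p hpf => ?_, fun x hx => ?_⟩
    · obtain ⟨x, y, hx, hy, h⟩ := h₁ ⟨p, hp hpf⟩ hpf
      exact ⟨x, hx, y, hy, h⟩
    · obtain ⟨y, hy, hu⟩ := h₂ ⟨x, hp hx⟩ hx
      exact ⟨y, hy, fun z hz => congrArg Subtype.val
        (hu ⟨z, (mem_of_pair_mem hN (hp hz)).2⟩ hz)⟩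
  · rintro ⟨h₁, h₂⟩
    refine ⟨fun p hpf => ?_, fun x hx => ?_⟩
    · obtain ⟨x, hx, y, hy, h⟩ := h₁ p hpf
      exact ⟨⟨x, hp hx⟩, ⟨y, hp hy⟩, hx, hy, h⟩
    · obtain ⟨y, hy, hu⟩ := h₂ x hx
      exact ⟨⟨y, (mem_of_pair_mem hN (hp hy)).2⟩, hy, fun z hz => Subtype.ext (hu z hz)⟩

/-- `f` is an injective function from `a` to `b`. -/
def IsInj (f a b : ZFSet.{u}) : Prop :=
  IsFun f a b ∧ ∀ x x' y, ZFSet.pair x y ∈ f → ZFSet.pair x' y ∈ f → x = x'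

theorem isInjection_iff (hN : N.IsTransitive) {f a b : Elt N} :
    IsInjection (memRel N N) f a b ↔ IsInj f.1 a.1 b.1 := by
  have hp : ∀ {x y}, ZFSet.pair x y ∈ f.1 → x ∈ N ∧ y ∈ N :=
    fun h => mem_of_pair_mem hN (hN.subset_of_mem f.2 h)
  simp only [IsInjection, IsInj, isFunc_iff hN, related_iff hN]
  refine and_congr_right fun _ => ⟨fun h x x' y hx hx' => ?_, fun h x x' y hx hx' => ?_⟩
  · exact congrArg Subtype.val (h ⟨x, (hp hx).1⟩ ⟨x', (hp hx').1⟩ ⟨y, (hp hx).2⟩ hx hx')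
  · exact Subtype.ext (h _ _ _ hx hx')

theorem isBijection_iff (hN : N.IsTransitive) {f a b : Elt N} :
    IsBijection (memRel N N) f a b ↔ IsInj f.1 a.1 b.1 ∧ ∀ y ∈ b.1, ∃ x, ZFSet.pair x y ∈ f.1 := by
  simp only [IsBijection, isInjection_iff hN, related_iff hN]
  refine and_congr_right fun h => ⟨fun h₂ y hy => ?_, fun h₂ y hy => ?_⟩
  · obtain ⟨x, -, hx⟩ := h₂ ⟨y, hN.subset_of_mem b.2 hy⟩ hy
    exact ⟨x, hx⟩
  · obtain ⟨x, hx⟩ := h₂ y hy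
    obtain ⟨x', hx', y', -, he⟩ := h.1.1 _ hx
    obtain ⟨rfl, rfl⟩ := ZFSet.pair_inj.1 he
    exact ⟨⟨x, hN.subset_of_mem a.2 hx'⟩, hx', hx⟩

end Transitive

/-! ### The Mostowski collapse of a relation -/

/-- The relation given by the pairs in `R` if it is well-founded, the empty relation otherwise. -/
def classRel (R : ZFSet.{u}) : ZFSet.{u} → ZFSet.{u} → Prop :=
  fun y x => WellFounded (pairRel R) ∧ pairRel R y x

theorem classRel_wf (R : ZFSet.{u}) : WellFounded (classRel R) := by
  by_cases h : WellFounded (pairRel R)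
  · exact Subrelation.wf (fun h' => h'.2) h
  · exact ⟨fun a => ⟨a, fun b hb => absurd hb.1 h⟩⟩

theorem classRel_iff {R : ZFSet.{u}} (h : WellFounded (pairRel R)) {y x : ZFSet.{u}} :
    classRel R y x ↔ ZFSet.pair y x ∈ R :=
  ⟨fun h' => h'.2, fun h' => ⟨h, h'⟩⟩

theorem mem_sUnion_sUnion_of_pair_mem {R x y : ZFSet.{u}} (h : ZFSet.pair x y ∈ R) :
    x ∈ (ZFSet.sUnion (ZFSet.sUnion R)) ∧ y ∈ (ZFSet.sUnion (ZFSet.sUnion R)) := by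
  simp only [ZFSet.mem_sUnion]
  exact ⟨⟨{x, y}, ⟨_, h, by simp [ZFSet.pair]⟩, by simp⟩,
    ⟨{x, y}, ⟨_, h, by simp [ZFSet.pair]⟩, by simp⟩⟩

/-- The Mostowski collapse of `R` (of the empty relation, if `R` is not well-founded). -/
noncomputable def collapse (R : ZFSet.{u}) : ZFSet.{u} → ZFSet.{u} :=
  (classRel_wf R).fix fun x ih => ZFSet.range fun
    -- Both components of a pair in `R` lie in `⋃⋃R`, so the predecessors of `x` form a set.
    y : {y // y ∈ (ZFSet.sUnion (ZFSet.sUnion R)).sep fun y => classRel R y x} =>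
      ih y.1 (ZFSet.mem_sep.1 y.2).2

theorem mem_collapse {R x z : ZFSet.{u}} :
    z ∈ collapse R x ↔ ∃ y, classRel R y x ∧ z = collapse R y := by
  rw [collapse, WellFounded.fix_eq, ZFSet.mem_range]
  constructor
  · rintro ⟨⟨y, hy⟩, rfl⟩
    exact ⟨y, (ZFSet.mem_sep.1 hy).2, rfl⟩
  · rintro ⟨y, hy, rfl⟩
    exact ⟨⟨y, ZFSet.mem_sep.2 ⟨(mem_sUnion_sUnion_of_pair_mem hy.2).1, hy⟩⟩, rfl⟩

theorem collapse_mem_collapse {R x y : ZFSet.{u}} (h : classRel R y x) :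
    collapse R y ∈ collapse R x :=
  mem_collapse.2 ⟨y, h, rfl⟩

/-! ### The sets and classes of a `β`-model -/

section BetaModel

variable {M C : ZFSet.{u}}

theorem IsBetaModelMKStar.nonempty_sets (hM : IsBetaModelMKStar M C) : Nonempty (Elt M) :=
  let ⟨x, _⟩ := hM.mkStar.mkAxioms.infinity
  ⟨x⟩

theorem IsBetaModelMKStar.nonempty_classes (hM : IsBetaModelMKStar M C) : Nonempty (Elt C) :=
  let ⟨x, _⟩ := hM.mkStar.mkAxioms.globalChoice
  ⟨x⟩

theorem IsBetaModelMKStar.pairSet_mem (hM : IsBetaModelMKStar M C) {x y : ZFSet.{u}} (hx : x ∈ M) (hy : y ∈ M) : ({x, y} : ZFSet.{u}) ∈ M := by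
  obtain ⟨z, hz⟩ := hM.mkStar.mkAxioms.pairing ⟨x, hx⟩ ⟨y, hy⟩
  rw [isPairSet_iff hM.transitive] at hz
  exact hz ▸ z.2

theorem IsBetaModelMKStar.pair_mem (hM : IsBetaModelMKStar M C) {x y : ZFSet.{u}} (hx : x ∈ M) (hy : y ∈ M) : ZFSet.pair x y ∈ M := by
  have h := hM.pairSet_mem hx hx
  rw [ZFSet.pair_eq_singleton] at h
  exact hM.pairSet_mem h (hM.pairSet_mem hx hy)

theorem IsBetaModelMKStar.sUnion_mem (hM : IsBetaModelMKStar M C) {x : ZFSet.{u}} (hx : x ∈ M) : ZFSet.sUnion x ∈ M := by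
  obtain ⟨y, hy⟩ := hM.mkStar.mkAxioms.union ⟨x, hx⟩
  have ht := hM.transitive
  suffices h : ZFSet.sUnion x = y.1 from h ▸ y.2
  ext w
  rw [ZFSet.mem_sUnion]
  constructor
  · rintro ⟨z, hz, hw⟩
    have hzM := ht.subset_of_mem hx hz
    exact (hy ⟨w, ht.subset_of_mem hzM hw⟩).2 ⟨⟨z, hzM⟩, hz, hw⟩
  · intro hw
    obtain ⟨z, hz, hw⟩ := (hy ⟨w, ht.subset_of_mem y.2 hw⟩).1 hw
    exact ⟨z, hz, hw⟩

theorem IsBetaModelMKStar.exists_powerset (hM : IsBetaModelMKStar M C) {x : ZFSet.{u}} (hx : x ∈ M) :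
    ∃ p ∈ M, ∀ z, z ∈ p ↔ z ∈ M ∧ z ⊆ x := by
  obtain ⟨p, hp⟩ := hM.mkStar.mkAxioms.powerSet ⟨x, hx⟩
  have ht := hM.transitive
  have key : ∀ z : Elt M, z.1 ∈ p.1 ↔ z.1 ⊆ x := fun z => (hp z).trans
    ⟨fun h w hw => h ⟨w, ht.subset_of_mem z.2 hw⟩ hw, fun h w hw => h hw⟩
  exact ⟨p, p.2, fun z => ⟨fun hz => ⟨ht.subset_of_mem p.2 hz, (key ⟨z, ht.subset_of_mem p.2 hz⟩).1 hz⟩,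
    fun hz => (key ⟨z, hz.1⟩).2 hz.2⟩⟩

/-! ### Definability of membership, equality and pairs in transitive structures -/

section MemDfn

variable {N D : ZFSet.{u}} {n m : ℕ}

instance dfn_mem (x y : (Fin n → Elt N) → (Fin m → Elt D) → Elt N) [SetTerm x] [SetTerm y] :
    Dfn (memRel N N) (memRel N D) (fun s X => (x s X).1 ∈ (y s X).1) := dfn_memSet x y

instance dfn_mem_class (x : (Fin n → Elt N) → (Fin m → Elt D) → Elt N)
    (Y : (Fin n → Elt N) → (Fin m → Elt D) → Elt D) [SetTerm x] [ClassTerm Y] :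
    Dfn (memRel N N) (memRel N D) (fun s X => (x s X).1 ∈ (Y s X).1) := dfn_memClass x Y

instance (x y : (Fin n → Elt N) → (Fin m → Elt D) → Elt N) [SetTerm x] [SetTerm y] :
    Dfn (memRel N N) (memRel N D) (fun s X => memRel N N (x s X) (y s X)) := dfn_memSet x y

instance (x : (Fin n → Elt N) → (Fin m → Elt D) → Elt N)
    (Y : (Fin n → Elt N) → (Fin m → Elt D) → Elt D) [SetTerm x] [ClassTerm Y] :
    Dfn (memRel N N) (memRel N D) (fun s X => memRel N D (x s X) (Y s X)) := dfn_memClass x Y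

instance dfn_val_eq (x y : (Fin n → Elt N) → (Fin m → Elt D) → Elt N) [SetTerm x] [SetTerm y] :
    Dfn (memRel N N) (memRel N D) (fun s X => (x s X).1 = (y s X).1) :=
  (dfn_eqSet x y).congr fun _ _ => Subtype.ext_iff.symm

instance dfn_eq_pair [Fact N.IsTransitive] [Nonempty (Elt N)] [Nonempty (Elt D)]
    (p x y : (Fin n → Elt N) → (Fin m → Elt D) → Elt N)
    [SetTerm p] [SetTerm x] [SetTerm y] :
    Dfn (memRel N N) (memRel N D) (fun s X => (p s X).1 = ZFSet.pair (x s X).1 (y s X).1) := by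
  refine Dfn.subst (P := fun (s : Fin 3 → Elt N) (_ : Fin 0 → Elt D) =>
    (s 0).1 = ZFSet.pair (s 1).1 (s 2).1) ?_ ![p, x, y] ![]
    (by simp [Fin.forall_fin_succ, *]) (by simp)
  simp only [← isOrdPair_iff (Fact.out : N.IsTransitive)]
  unfold IsOrdPair IsPairSet
  infer_instance

instance dfn_pair_mem [Fact N.IsTransitive] [Nonempty (Elt N)] [Nonempty (Elt D)]
    (f x y : (Fin n → Elt N) → (Fin m → Elt D) → Elt N)
    [SetTerm f] [SetTerm x] [SetTerm y] :
    Dfn (memRel N N) (memRel N D) (fun s X => ZFSet.pair (x s X).1 (y s X).1 ∈ (f s X).1) := by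
  refine Dfn.subst (P := fun (s : Fin 3 → Elt N) (_ : Fin 0 → Elt D) =>
    ZFSet.pair (s 1).1 (s 2).1 ∈ (s 0).1) ?_ ![f, x, y] ![]
    (by simp [Fin.forall_fin_succ, *]) (by simp)
  refine Dfn.congr (P := fun s _ => ∃ p : Elt N, p.1 ∈ (s 0).1 ∧
    p.1 = ZFSet.pair (s 1).1 (s 2).1) inferInstance fun s _ => ?_
  exact ⟨fun h => ⟨⟨_, (Fact.out : N.IsTransitive).subset_of_mem (s 0).2 h⟩, h, rfl⟩,
    fun ⟨p, hp, h⟩ => h ▸ hp⟩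

end MemDfn

variable [hM : Fact (IsBetaModelMKStar M C)]

variable [Fact M.IsTransitive] [Nonempty (Elt M)] [Nonempty (Elt C)] {n m : ℕ}

omit [Fact M.IsTransitive] [Nonempty (Elt M)] [Nonempty (Elt C)] in
theorem mem_of_pair_mem_class (X : Elt C) {x y : ZFSet.{u}} (h : ZFSet.pair x y ∈ X.1) :
    x ∈ M ∧ y ∈ M :=
  mem_of_pair_mem hM.out.transitive (hM.out.subset _ X.2 h)

instance dfn_pair_mem_class (x y : (Fin n → Elt M) → (Fin m → Elt C) → Elt M)
    (X : (Fin n → Elt M) → (Fin m → Elt C) → Elt C) [SetTerm x] [SetTerm y] [ClassTerm X] :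
    Dfn (memRel M M) (memRel M C)
      (fun s Y => ZFSet.pair (x s Y).1 (y s Y).1 ∈ (X s Y).1) := by
  refine Dfn.subst (P := fun (s : Fin 2 → Elt M) (Y : Fin 1 → Elt C) =>
    ZFSet.pair (s 0).1 (s 1).1 ∈ (Y 0).1) ?_ ![x, y] ![X]
    (by simp [Fin.forall_fin_succ, *]) (by simp [*])
  refine Dfn.congr (P := fun s Y => ∃ p : Elt M, p.1 ∈ (Y 0).1 ∧
    p.1 = ZFSet.pair (s 0).1 (s 1).1) inferInstance fun s Y => ?_
  exact ⟨fun h => ⟨⟨_, hM.out.subset _ (Y 0).2 h⟩, h, rfl⟩, fun ⟨p, hp, h⟩ => h ▸ hp⟩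

/-- The `β`-property is essential here: real well-foundedness speaks of arbitrary subsets, and it
becomes a statement that quantifies over classes of the model only. -/
instance dfn_wellFounded (X : (Fin n → Elt M) → (Fin m → Elt C) → Elt C) [ClassTerm X] :
    Dfn (memRel M M) (memRel M C) (fun s Y => WellFounded (pairRel (X s Y).1)) := by
  refine Dfn.subst (P := fun (_ : Fin 0 → Elt M) (Y : Fin 1 → Elt C) =>
    WellFounded (pairRel (Y 0).1)) ?_ ![] ![X] (by simp) (by simp [*])
  simp only [← hM.out.beta, WellFoundedIn, cRelated_iff hM.out.transitive hM.out.subset]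
  infer_instance

instance dfn_pairRel (x y : (Fin n → Elt M) → (Fin m → Elt C) → Elt M)
    (X : (Fin n → Elt M) → (Fin m → Elt C) → Elt C) [SetTerm x] [SetTerm y] [ClassTerm X] :
    Dfn (memRel M M) (memRel M C) (fun s Y => pairRel (X s Y).1 (x s Y).1 (y s Y).1) :=
  dfn_pair_mem_class x y X

instance dfn_classRel (x y : (Fin n → Elt M) → (Fin m → Elt C) → Elt M)
    (X : (Fin n → Elt M) → (Fin m → Elt C) → Elt C) [SetTerm x] [SetTerm y] [ClassTerm X] :
    Dfn (memRel M M) (memRel M C) (fun s Y => classRel (X s Y).1 (x s Y).1 (y s Y).1) := by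
  unfold classRel
  infer_instance

/-! #### Closure properties of `M` and `C` -/

omit [Fact M.IsTransitive] in
theorem exists_class (P : Elt M → Prop)
    [Dfn (memRel M M) (memRel M C) fun (s : Fin 1 → Elt M) (_ : Fin 0 → Elt C) => P (s 0)] :
    ∃ Y : Elt C, ∀ x, x ∈ Y.1 ↔ ∃ h : x ∈ M, P ⟨x, h⟩ := by
  obtain ⟨Y, hY⟩ := hM.out.mkStar.mkAxioms.exists_class P
  exact ⟨Y, fun x => ⟨fun h => ⟨hM.out.subset _ Y.2 h, (hY _).1 h⟩, fun ⟨h, hP⟩ => (hY ⟨x, h⟩).2 hP⟩⟩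

theorem exists_classRelation (P : Elt M → Elt M → Prop)
    [hP : Dfn (memRel M M) (memRel M C) fun (s : Fin 2 → Elt M) (_ : Fin 0 → Elt C) => P (s 0) (s 1)] :
    ∃ Y : Elt C, (∀ p ∈ Y.1, ∃ x y : Elt M, p = ZFSet.pair x.1 y.1) ∧
      ∀ x y, ZFSet.pair x y ∈ Y.1 ↔ ∃ (hx : x ∈ M) (hy : y ∈ M), P ⟨x, hx⟩ ⟨y, hy⟩ := by
  have := @hP.apply₂
  obtain ⟨Y, hY⟩ := exists_class (C := C)
    fun p : Elt M => ∃ x y : Elt M, p.1 = ZFSet.pair x.1 y.1 ∧ P x y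
  refine ⟨Y, fun p hp => ?_, fun x y => (hY _).trans ⟨?_, ?_⟩⟩
  · obtain ⟨h, x, y, he, -⟩ := (hY p).1 hp
    exact ⟨x, y, he⟩
  · rintro ⟨h, x', y', he, hP⟩
    obtain ⟨rfl, rfl⟩ := ZFSet.pair_inj.1 he
    exact ⟨x'.2, y'.2, hP⟩
  · rintro ⟨hx, hy, hP⟩
    exact ⟨hM.out.pair_mem hx hy, ⟨x, hx⟩, ⟨y, hy⟩, rfl, hP⟩

theorem exists_replacement (P : Elt M → Elt M → Prop)
    [Dfn (memRel M M) (memRel M C) fun (s : Fin 2 → Elt M) (_ : Fin 0 → Elt C) => P (s 0) (s 1)]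
    (hP : ∀ x y y', P x y → P x y' → y = y') {a : ZFSet.{u}} (ha : a ∈ M) :
    ∃ b ∈ M, ∀ y, y ∈ b ↔ ∃ (hy : y ∈ M) (x : Elt M), x.1 ∈ a ∧ P x ⟨y, hy⟩ := by
  obtain ⟨G, hG, hGP⟩ := exists_classRelation (C := C) P
  have hrel : ∀ x y : Elt M, CRelated (memRel M M) (memRel M C) G x y ↔ P x y := fun x y => by
    rw [cRelated_iff hM.out.transitive hM.out.subset, hGP]
    exact ⟨fun ⟨_, _, h⟩ => h, fun h => ⟨x.2, y.2, h⟩⟩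
  obtain ⟨b, hb⟩ := hM.out.mkStar.mkAxioms.replacement G ⟨fun p hp =>
    let ⟨x, y, he⟩ := hG _ hp
    ⟨x, y, (isOrdPair_iff hM.out.transitive).2 he⟩,
    fun x y y' h h' => hP x y y' ((hrel _ _).1 h) ((hrel _ _).1 h')⟩ ⟨a, ha⟩
  · refine ⟨b, b.2, fun y => ⟨fun h => ?_, fun ⟨hy, x, hx, hxy⟩ =>
      (hb ⟨y, hy⟩).2 ⟨x, hx, (hrel _ _).2 hxy⟩⟩⟩
    have hy := hM.out.transitive.subset_of_mem b.2 h
    obtain ⟨x, hx, hxy⟩ := (hb ⟨y, hy⟩).1 h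
    exact ⟨hy, x, hx, (hrel _ _).1 hxy⟩

theorem exists_separation (P : Elt M → Prop)
    [Dfn (memRel M M) (memRel M C) fun (s : Fin 1 → Elt M) (_ : Fin 0 → Elt C) => P (s 0)]
    {a : ZFSet.{u}} (ha : a ∈ M) :
    ∃ b ∈ M, ∀ y, y ∈ b ↔ y ∈ a ∧ ∃ hy : y ∈ M, P ⟨y, hy⟩ := by
  obtain ⟨X, hX⟩ := exists_class (C := C) P
  obtain ⟨b, hb, h⟩ := exists_replacement (C := C) (fun x y : Elt M => x = y ∧ x.1 ∈ X.1)
    (fun x y y' h h' => h.1.symm.trans h'.1) ha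
  refine ⟨b, hb, fun y => (h y).trans ⟨?_, ?_⟩⟩
  · rintro ⟨hy, x, hx, rfl, hP⟩
    exact ⟨hx, (hX _).1 hP⟩
  · rintro ⟨hy, hyM, hP⟩
    exact ⟨hyM, ⟨y, hyM⟩, hy, rfl, (hX _).2 ⟨hyM, hP⟩⟩

theorem mem_of_class_subset (X : Elt C) {a : ZFSet.{u}} (ha : a ∈ M) (h : X.1 ⊆ a) : X.1 ∈ M := by
  obtain ⟨b, hb, hX⟩ := exists_separation (C := C) (fun x : Elt M => x.1 ∈ X.1) ha
  suffices X.1 = b from this ▸ hb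
  ext y
  rw [hX]
  exact ⟨fun hy => ⟨h hy, hM.out.subset _ X.2 hy, hy⟩, fun hy => hy.2.2⟩

/-! #### Definability of the collapse -/

/-- `B` is a bisimulation between the relations given by `X` and `Y`. -/
def IsBisim (M X Y B : ZFSet.{u}) : Prop :=
  ∀ x y : Elt M, ZFSet.pair x.1 y.1 ∈ B →
    (∀ x' : Elt M, classRel X x'.1 x.1 → ∃ y' : Elt M, classRel Y y'.1 y.1 ∧ ZFSet.pair x'.1 y'.1 ∈ B) ∧
    ∀ y' : Elt M, classRel Y y'.1 y.1 → ∃ x' : Elt M, classRel X x'.1 x.1 ∧ ZFSet.pair x'.1 y'.1 ∈ B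

omit [Fact M.IsTransitive] [Nonempty (Elt M)] [Nonempty (Elt C)] in
theorem mem_of_classRel (X : Elt C) {x y : ZFSet.{u}} (h : classRel X.1 x y) : x ∈ M ∧ y ∈ M :=
  mem_of_pair_mem_class X h.2

omit [Fact M.IsTransitive] [Nonempty (Elt M)] [Nonempty (Elt C)] in
theorem mem_collapse_class {X : Elt C} {x z : ZFSet.{u}} :
    z ∈ collapse X.1 x ↔ ∃ y : Elt M, classRel X.1 y.1 x ∧ z = collapse X.1 y.1 :=
  mem_collapse.trans ⟨fun ⟨y, hy, h⟩ => ⟨⟨y, (mem_of_classRel X hy).1⟩, hy, h⟩,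
    fun ⟨y, hy, h⟩ => ⟨y, hy, h⟩⟩

-- Induction along `X`: a bisimulation matches the predecessors of `x` and `y` in both directions,
-- and matched predecessors already have equal collapses.
omit [Fact M.IsTransitive] [Nonempty (Elt M)] [Nonempty (Elt C)] in
theorem IsBisim.collapse_eq {X Y : Elt C} {B : ZFSet.{u}} (hB : IsBisim M X.1 Y.1 B) (x : ZFSet.{u}) :
    ∀ {y : ZFSet.{u}}, x ∈ M → y ∈ M → ZFSet.pair x y ∈ B → collapse X.1 x = collapse Y.1 y := by
  induction x using (classRel_wf X.1).induction with | _ x ih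
  intro y hx hy h
  obtain ⟨h₁, h₂⟩ := hB ⟨x, hx⟩ ⟨y, hy⟩ h
  ext z
  rw [mem_collapse_class (M := M), mem_collapse_class (M := M)]
  constructor
  · rintro ⟨x', hx', rfl⟩
    obtain ⟨y', hy', h'⟩ := h₁ x' hx'
    exact ⟨y', hy', ih _ hx' x'.2 y'.2 h'⟩
  · rintro ⟨y', hy', rfl⟩
    obtain ⟨x', hx', h'⟩ := h₂ y' hy'
    exact ⟨x', hx', (ih _ hx' x'.2 y'.2 h').symm⟩

/-- The union `U` of all bisimulations that are classes is a class, by Comprehension with a class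
quantifier. Induction on `x` shows that `U` contains every pair of points with equal collapses. This
turns an equality evaluated outside the model into a definable relation between codes. -/
theorem exists_isBisim (X Y : Elt C) {x y : ZFSet.{u}} (hx : x ∈ M) (hy : y ∈ M)
    (h : collapse X.1 x = collapse Y.1 y) :
    ∃ B : Elt C, IsBisim M X.1 Y.1 B.1 ∧ ZFSet.pair x y ∈ B.1 := by
  obtain ⟨U, -, hU⟩ := exists_classRelation (M := M) (C := C) (fun x y => ∃ B : Elt C,
    (∀ x y : Elt M, ZFSet.pair x.1 y.1 ∈ B.1 →
    (∀ x' : Elt M, classRel X.1 x'.1 x.1 → ∃ y' : Elt M, classRel Y.1 y'.1 y.1 ∧ ZFSet.pair x'.1 y'.1 ∈ B.1) ∧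
    ∀ y' : Elt M, classRel Y.1 y'.1 y.1 → ∃ x' : Elt M, classRel X.1 x'.1 x.1 ∧ ZFSet.pair x'.1 y'.1 ∈ B.1)
    ∧ ZFSet.pair x.1 y.1 ∈ B.1)
  suffices key : ∀ y, y ∈ M → collapse X.1 x = collapse Y.1 y → ZFSet.pair x y ∈ U.1 by
    obtain ⟨_, _, B, hB, hxy⟩ := (hU _ _).1 (key y hy h)
    exact ⟨B, hB, hxy⟩
  clear h hy y
  induction x using (classRel_wf X.1).induction with | _ x ih
  intro y hy h
  -- `U` is itself a bisimulation, and by the induction hypothesis it matches the predecessors of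
  -- `x` and `y`; so the pair of `x` and `y` may be added. Both are written as elements of `M` to
  -- count as parameters.
  obtain ⟨B, -, hB⟩ := exists_classRelation (M := M) (C := C)
    (fun u v => ZFSet.pair u.1 v.1 ∈ U.1 ∨ u.1 = (⟨x, hx⟩ : Elt M).1 ∧ v.1 = (⟨y, hy⟩ : Elt M).1)
  have hUB : ∀ {u v}, ZFSet.pair u v ∈ U.1 → ZFSet.pair u v ∈ B.1 := fun {u v} huv => by
    obtain ⟨hu, hv⟩ := mem_of_pair_mem_class (M := M) U huv
    exact (hB u v).2 ⟨hu, hv, .inl huv⟩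
  refine (hU x y).2 ⟨hx, hy, B, ?_, (hB x y).2 ⟨hx, hy, .inr ⟨rfl, rfl⟩⟩⟩
  intro u v huv
  obtain ⟨_, _, hU' | ⟨rfl : u.1 = x, rfl : v.1 = y⟩⟩ := (hB _ _).1 huv
  · obtain ⟨_, _, B', hB', huv⟩ := (hU _ _).1 hU'
    obtain ⟨h₁, h₂⟩ := hB' u v huv
    constructor
    · intro u' hu'
      obtain ⟨v', hv', h'⟩ := h₁ u' hu'
      exact ⟨v', hv', hUB ((hU _ _).2 ⟨u'.2, v'.2, B', hB', h'⟩)⟩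
    · intro v' hv'
      obtain ⟨u', hu', h'⟩ := h₂ v' hv'
      exact ⟨u', hu', hUB ((hU _ _).2 ⟨u'.2, v'.2, B', hB', h'⟩)⟩
  · constructor
    · intro u' hu'
      obtain ⟨v', hv', h'⟩ := (mem_collapse_class (M := M)).1 (h ▸ collapse_mem_collapse hu')
      exact ⟨v', hv', hUB (ih u' hu' u'.2 v' v'.2 h')⟩
    · intro v' hv'
      obtain ⟨u', hu', h'⟩ := (mem_collapse_class (M := M)).1 (h.symm ▸ collapse_mem_collapse hv')
      exact ⟨u', hu', hUB (ih u' hu' u'.2 v' v'.2 h'.symm)⟩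

theorem collapse_eq_iff (X Y : Elt C) {x y : ZFSet.{u}} (hx : x ∈ M) (hy : y ∈ M) :
    collapse X.1 x = collapse Y.1 y ↔
      ∃ B : Elt C, IsBisim M X.1 Y.1 B.1 ∧ ZFSet.pair x y ∈ B.1 :=
  ⟨exists_isBisim X Y hx hy, fun ⟨_, hB, h⟩ => hB.collapse_eq x hx hy h⟩

instance dfn_collapse_eq (X Y : (Fin n → Elt M) → (Fin m → Elt C) → Elt C)
    (x y : (Fin n → Elt M) → (Fin m → Elt C) → Elt M)
    [ClassTerm X] [ClassTerm Y] [SetTerm x] [SetTerm y] :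
    Dfn (memRel M M) (memRel M C)
      (fun s Z => collapse (X s Z).1 (x s Z).1 = collapse (Y s Z).1 (y s Z).1) := by
  refine Dfn.subst (P := fun (s : Fin 2 → Elt M) (Z : Fin 2 → Elt C) =>
    collapse (Z 0).1 (s 0).1 = collapse (Z 1).1 (s 1).1) ?_ ![x, y] ![X, Y]
    (by simp [Fin.forall_fin_succ, *]) (by simp [Fin.forall_fin_succ, *])
  refine Dfn.congr (P := fun s Z => ∃ B : Elt C, IsBisim M (Z 0).1 (Z 1).1 B.1 ∧
    ZFSet.pair (s 0).1 (s 1).1 ∈ B.1) ?_ fun s Z => collapse_eq_iff _ _ (s 0).2 (s 1).2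
  unfold IsBisim
  infer_instance

/-! #### Definability of the comparison of ranks -/

omit [Fact M.IsTransitive] [Nonempty (Elt M)] [Nonempty (Elt C)] [hM : Fact (IsBetaModelMKStar M C)] in
theorem rank_le_rank_iff {x y : ZFSet.{u}} :
    x.rank ≤ y.rank ↔ ∀ x' ∈ x, ∃ y' ∈ y, x'.rank ≤ y'.rank := by
  rw [ZFSet.rank_le_iff]
  simp only [ZFSet.lt_rank_iff]

/-- The argument for bisimulations, made one-sided: comparison of ranks is the largest relation
under which every element of `u` has a partner in `v`. No rank function inside the model is needed.
-/
theorem rank_le_rank_iff_exists {x y : ZFSet.{u}} (hx : x ∈ M) (hy : y ∈ M) :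
    x.rank ≤ y.rank ↔ ∃ B : Elt C, (∀ u v : Elt M, ZFSet.pair u.1 v.1 ∈ B.1 → ∀ u' : Elt M,
      u'.1 ∈ u.1 → ∃ v' : Elt M, v'.1 ∈ v.1 ∧ ZFSet.pair u'.1 v'.1 ∈ B.1) ∧
      ZFSet.pair x y ∈ B.1 := by
  have ht := hM.out.transitive
  constructor
  · obtain ⟨U, -, hU⟩ := exists_classRelation (M := M) (C := C) (fun x y => ∃ B : Elt C,
      (∀ u v : Elt M, ZFSet.pair u.1 v.1 ∈ B.1 → ∀ u' : Elt M,
      u'.1 ∈ u.1 → ∃ v' : Elt M, v'.1 ∈ v.1 ∧ ZFSet.pair u'.1 v'.1 ∈ B.1) ∧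
      ZFSet.pair x.1 y.1 ∈ B.1)
    suffices key : ∀ y, y ∈ M → x.rank ≤ y.rank → ZFSet.pair x y ∈ U.1 by
      intro h
      obtain ⟨_, _, B, hB, hxy⟩ := (hU _ _).1 (key y hy h)
      exact ⟨B, hB, hxy⟩
    clear hy y
    induction x using ZFSet.inductionOn with | _ x ih
    intro y hy h
    obtain ⟨B, -, hB⟩ := exists_classRelation (M := M) (C := C)
      (fun u v => ZFSet.pair u.1 v.1 ∈ U.1 ∨ u.1 = (⟨x, hx⟩ : Elt M).1 ∧ v.1 = (⟨y, hy⟩ : Elt M).1)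
    have hUB : ∀ {u v}, ZFSet.pair u v ∈ U.1 → ZFSet.pair u v ∈ B.1 := fun {u v} huv => by
      obtain ⟨hu, hv⟩ := mem_of_pair_mem_class (M := M) U huv
      exact (hB u v).2 ⟨hu, hv, .inl huv⟩
    refine (hU x y).2 ⟨hx, hy, B, ?_, (hB x y).2 ⟨hx, hy, .inr ⟨rfl, rfl⟩⟩⟩
    intro u v huv u' hu'
    obtain ⟨_, _, hU' | ⟨rfl : u.1 = x, rfl : v.1 = y⟩⟩ := (hB _ _).1 huv
    · obtain ⟨_, _, B', hB', huv⟩ := (hU _ _).1 hU'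
      obtain ⟨v', hv', h'⟩ := hB' u v huv u' hu'
      exact ⟨v', hv', hUB ((hU _ _).2 ⟨u'.2, v'.2, B', hB', h'⟩)⟩
    · obtain ⟨v', hv', h'⟩ := rank_le_rank_iff.1 h u' hu'
      exact ⟨⟨v', ht.subset_of_mem hy hv'⟩, hv', hUB (ih u' hu' u'.2 v' (ht.subset_of_mem hy hv') h')⟩
  · rintro ⟨B, hB, h⟩
    induction x using ZFSet.inductionOn generalizing y with | _ x ih
    refine rank_le_rank_iff.2 fun x' hx' => ?_
    obtain ⟨v', hv', h'⟩ := hB ⟨x, hx⟩ ⟨y, hy⟩ h ⟨x', ht.subset_of_mem hx hx'⟩ hx'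
    exact ⟨v', hv', ih x' hx' (ht.subset_of_mem hx hx') v'.2 h'⟩

instance dfn_rank_le (x y : (Fin n → Elt M) → (Fin m → Elt C) → Elt M)
    [SetTerm x] [SetTerm y] :
    Dfn (memRel M M) (memRel M C) (fun s Z => (x s Z).1.rank ≤ (y s Z).1.rank) := by
  refine Dfn.subst (P := fun (s : Fin 2 → Elt M) (_ : Fin 0 → Elt C) =>
    (s 0).1.rank ≤ (s 1).1.rank) ?_ ![x, y] ![]
    (by simp [Fin.forall_fin_succ, *]) (by simp)
  refine Dfn.congr (P := fun s _ => _) ?_ fun s _ =>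
    rank_le_rank_iff_exists (C := C) (s 0).2 (s 1).2
  infer_instance

end BetaModel

theorem infinity_iff {N : ZFSet.{u}} (hN : N.IsTransitive) :
    Infinity (memRel N N) ↔ ∃ x ∈ N, ∅ ∈ x ∧ ∀ y ∈ x, insert y y ∈ x := by
  have hsub : ∀ {x : Elt N} {y}, y ∈ x.1 → y ∈ N := fun {x} {y} h => hN.subset_of_mem x.2 h
  have hempty : ∀ e : Elt N, (∀ w, ¬ memRel N N w e) ↔ e.1 = ∅ := fun e => by
    rw [ZFSet.eq_empty]
    exact ⟨fun h w hw => h ⟨w, hsub hw⟩ hw, fun h w hw => h _ hw⟩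
  have hsucc : ∀ s y : Elt N, IsSucc (memRel N N) s y ↔ s.1 = insert y.1 y.1 := fun s y => by
    constructor
    · intro h
      ext w
      rw [ZFSet.mem_insert_iff]
      refine ⟨fun hw => ((h ⟨w, hsub hw⟩).1 hw).symm.imp_left (congrArg Subtype.val), ?_⟩
      rintro (rfl | hw)
      · exact (h y).2 (.inr rfl)
      · exact (h ⟨w, hsub hw⟩).2 (.inl hw)
    · intro h w
      simp only [memRel, h, ZFSet.mem_insert_iff, Subtype.ext_iff, or_comm]
  simp only [Infinity, hempty, hsucc]
  constructor
  · rintro ⟨x, ⟨e, he, he'⟩, h⟩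
    refine ⟨x, x.2, he' ▸ he, fun y hy => ?_⟩
    obtain ⟨s, hs, hs'⟩ := h ⟨y, hsub hy⟩ hy
    exact hs' ▸ hs
  · rintro ⟨x, hx, he, h⟩
    exact ⟨⟨x, hx⟩, ⟨⟨∅, hN.subset_of_mem hx he⟩, he, rfl⟩, fun y hy =>
      ⟨⟨_, hN.subset_of_mem hx (h y.1 hy)⟩, h y.1 hy, rfl⟩⟩

/-- The set of all collapses of points of `M` under relations in `C`. -/
noncomputable def codedModel (M C : ZFSet.{u}) : ZFSet.{u} :=
  ZFSet.range fun p : Elt C × Elt M => collapse p.1.1 p.2.1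

/-! ### The coded model -/

section

variable {M C : ZFSet.{u}}

theorem mem_codedModel {x : ZFSet.{u}} :
    x ∈ codedModel M C ↔ ∃ (X : Elt C) (a : Elt M), collapse X.1 a.1 = x := by
  simp only [codedModel, ZFSet.mem_range, Prod.exists]

/-- The element of the coded model with the code `(X, a)`. -/
noncomputable def decode (X : Elt C) (a : Elt M) : Elt (codedModel M C) :=
  ⟨collapse X.1 a.1, mem_codedModel.2 ⟨X, a, rfl⟩⟩

theorem exists_decode (x : Elt (codedModel M C)) : ∃ (X : Elt C) (a : Elt M), decode X a = x := by
  obtain ⟨X, a, h⟩ := mem_codedModel.1 x.2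
  exact ⟨X, a, Subtype.ext h⟩

variable [hM : Fact (IsBetaModelMKStar M C)]

theorem isTransitive_codedModel : (codedModel M C).IsTransitive := by
  intro x hx y hy
  obtain ⟨X, a, rfl⟩ := mem_codedModel.1 hx
  obtain ⟨b, -, rfl⟩ := (mem_collapse_class (M := M)).1 hy
  exact mem_codedModel.2 ⟨X, b, rfl⟩

variable [Fact M.IsTransitive] [Nonempty (Elt M)] [Nonempty (Elt C)] {n m : ℕ}

/-! #### Definability of predicates of coded sets -/

instance dfn_collapse_mem (X Y : (Fin n → Elt M) → (Fin m → Elt C) → Elt C)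
    (x y : (Fin n → Elt M) → (Fin m → Elt C) → Elt M)
    [ClassTerm X] [ClassTerm Y] [SetTerm x] [SetTerm y] :
    Dfn (memRel M M) (memRel M C)
      (fun s Z => collapse (X s Z).1 (x s Z).1 ∈ collapse (Y s Z).1 (y s Z).1) := by
  refine Dfn.subst (P := fun (s : Fin 2 → Elt M) (Z : Fin 2 → Elt C) =>
    collapse (Z 0).1 (s 0).1 ∈ collapse (Z 1).1 (s 1).1) ?_ ![x, y] ![X, Y]
    (by simp [Fin.forall_fin_succ, *]) (by simp [Fin.forall_fin_succ, *])
  refine Dfn.congr (P := fun s Z => _) ?_ fun s Z => mem_collapse_class (M := M)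
  infer_instance

/-- The members of a collapse are collapses of points of `M`, so pairing unfolds to quantifiers over
points and inherits definability from equality and membership. -/
theorem collapse_eq_pairSet_iff {X : Elt C} {x y z : ZFSet.{u}} :
    collapse X.1 x = {y, z} ↔ y ∈ collapse X.1 x ∧ z ∈ collapse X.1 x ∧
      ∀ x' : Elt M, classRel X.1 x'.1 x → collapse X.1 x'.1 = y ∨ collapse X.1 x'.1 = z := by
  constructor
  · intro h
    simp only [h, ZFSet.mem_pair, true_or, or_true, true_and]
    intro x' hx'
    rw [← ZFSet.mem_pair, ← h]
    exact collapse_mem_collapse hx'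
  · rintro ⟨hy, hz, h⟩
    ext w
    rw [ZFSet.mem_pair]
    constructor
    · intro hw
      obtain ⟨x', hx', rfl⟩ := (mem_collapse_class (M := M)).1 hw
      exact h x' hx'
    · rintro (rfl | rfl) <;> assumption

instance dfn_collapse_eq_pairSet (X Y Z : (Fin n → Elt M) → (Fin m → Elt C) → Elt C)
    (x y z : (Fin n → Elt M) → (Fin m → Elt C) → Elt M)
    [ClassTerm X] [ClassTerm Y] [ClassTerm Z] [SetTerm x] [SetTerm y] [SetTerm z] :
    Dfn (memRel M M) (memRel M C) (fun s W => collapse (X s W).1 (x s W).1 =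
      {collapse (Y s W).1 (y s W).1, collapse (Z s W).1 (z s W).1}) := by
  refine Dfn.subst (P := fun (s : Fin 3 → Elt M) (W : Fin 3 → Elt C) =>
    collapse (W 0).1 (s 0).1 = {collapse (W 1).1 (s 1).1, collapse (W 2).1 (s 2).1}) ?_
    ![x, y, z] ![X, Y, Z]
    (by simp [Fin.forall_fin_succ, *]) (by simp [Fin.forall_fin_succ, *])
  refine Dfn.congr (P := fun s W => _) ?_ fun s W => collapse_eq_pairSet_iff (M := M)
  infer_instance

theorem collapse_eq_pair_iff {X : Elt C} {x y z : ZFSet.{u}} :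
    collapse X.1 x = ZFSet.pair y z ↔ ∃ s t : Elt M, classRel X.1 s.1 x ∧ classRel X.1 t.1 x ∧
      collapse X.1 s.1 = {y, y} ∧ collapse X.1 t.1 = {y, z} ∧
      collapse X.1 x = {collapse X.1 s.1, collapse X.1 t.1} := by
  constructor
  · intro h
    have h₁ : {y} ∈ collapse X.1 x := h ▸ by simp [ZFSet.pair]
    have h₂ : {y, z} ∈ collapse X.1 x := h ▸ by simp [ZFSet.pair]
    obtain ⟨s, hs, hs'⟩ := (mem_collapse_class (M := M)).1 h₁
    obtain ⟨t, ht, ht'⟩ := (mem_collapse_class (M := M)).1 h₂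
    exact ⟨s, t, hs, ht, by simp [← hs'], ht'.symm, by rw [← hs', ← ht', h]; rfl⟩
  · rintro ⟨s, t, -, -, h₁, h₂, h₃⟩
    rw [h₃, h₁, h₂, ZFSet.pair_eq_singleton]
    rfl

instance dfn_collapse_eq_pair (X Y Z : (Fin n → Elt M) → (Fin m → Elt C) → Elt C)
    (x y z : (Fin n → Elt M) → (Fin m → Elt C) → Elt M)
    [ClassTerm X] [ClassTerm Y] [ClassTerm Z] [SetTerm x] [SetTerm y] [SetTerm z] :
    Dfn (memRel M M) (memRel M C) (fun s W => collapse (X s W).1 (x s W).1 =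
      ZFSet.pair (collapse (Y s W).1 (y s W).1) (collapse (Z s W).1 (z s W).1)) := by
  refine Dfn.subst (P := fun (s : Fin 3 → Elt M) (W : Fin 3 → Elt C) =>
    collapse (W 0).1 (s 0).1 = ZFSet.pair (collapse (W 1).1 (s 1).1) (collapse (W 2).1 (s 2).1)) ?_
    ![x, y, z] ![X, Y, Z]
    (by simp [Fin.forall_fin_succ, *]) (by simp [Fin.forall_fin_succ, *])
  refine Dfn.congr (P := fun s W => _) ?_ fun s W => collapse_eq_pair_iff (M := M)
  infer_instance

-- The class is the membership relation of `M`. Through it, elements of `M` are coded sets too, so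
-- they can be compared with other coded sets in definable predicates.
variable (M C) in
theorem exists_mem_class : ∃ R : Elt C, ∀ x ∈ M, collapse R.1 x = x := by
  obtain ⟨R, hR, hR'⟩ := exists_classRelation (M := M) (C := C) fun x y => x.1 ∈ y.1
  have hwf : WellFounded (pairRel R.1) := by
    refine Subrelation.wf (r := (· ∈ ·)) (fun {x y} h => ?_) ZFSet.mem_wf
    obtain ⟨_, _, h⟩ := (hR' x y).1 h
    exact h
  refine ⟨R, fun x => ?_⟩
  induction x using ZFSet.inductionOn with | _ x ih
  intro hx
  ext z
  rw [mem_collapse]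
  constructor
  · rintro ⟨y, hy, rfl⟩
    obtain ⟨h, _, h'⟩ := (hR' y x).1 ((classRel_iff hwf).1 hy)
    exact (ih y h' h).symm ▸ h'
  · intro hz
    have hzM := hM.out.transitive.subset_of_mem hx hz
    exact ⟨z, (classRel_iff hwf).2 ((hR' z x).2 ⟨hzM, hx, hz⟩), (ih z hz hzM).symm⟩

omit [Fact M.IsTransitive] [Nonempty (Elt M)] [Nonempty (Elt C)] hM in
theorem IsBetaModelMKStar.exists_empty (hM : IsBetaModelMKStar M C) : ∃ e : Elt M, e.1 = ∅ := by
  obtain ⟨x, hx, he, -⟩ := (infinity_iff hM.transitive).1 hM.mkStar.mkAxioms.infinity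
  exact ⟨⟨∅, hM.transitive.subset_of_mem hx he⟩, rfl⟩

/-! ### Bounding and images for coded sets -/

theorem exists_section (B : Elt C) (i : Elt M) :
    ∃ A : Elt C, ∀ z : Elt M, z.1 ∈ A.1 ↔ ZFSet.pair i.1 z.1 ∈ B.1 := by
  obtain ⟨A, hA⟩ := exists_class (M := M) (C := C) fun z => ZFSet.pair i.1 z.1 ∈ B.1
  exact ⟨A, fun z => (hA _).trans ⟨fun ⟨_, h⟩ => h, fun h => ⟨z.2, h⟩⟩⟩

/-- The set of the collapses, under the sections `(B)_i`, of the points selected by `P`. -/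
theorem exists_sectionImage (B : Elt C) (P : Elt M → Elt M → Prop)
    [hP : Dfn (memRel M M) (memRel M C) fun (s : Fin 2 → Elt M) (_ : Fin 0 → Elt C) =>
      P (s 0) (s 1)] :
    ∃ z ∈ codedModel M C, ∀ w, w ∈ z ↔ ∃ (i : Elt M) (A : Elt C) (a : Elt M),
      (∀ z : Elt M, z.1 ∈ A.1 ↔ ZFSet.pair i.1 z.1 ∈ B.1) ∧ P i a ∧ w = collapse A.1 a.1 := by
  have := @hP.apply₂
  obtain ⟨e, he⟩ := hM.out.exists_empty
  -- The empty set is not an ordered pair, so `e` can serve as a new top point.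
  have hne : ∀ x y : ZFSet.{u}, ZFSet.pair x y ≠ e.1 := fun x y h => by
    have : ({x} : ZFSet.{u}) ∈ (∅ : ZFSet.{u}) := he ▸ h ▸ by simp [ZFSet.pair]
    exact ZFSet.notMem_empty _ this
  -- `R` is the disjoint union of the sections, with `x` in the section at `i` represented by `⟨i,
  -- x⟩`, and with `e` above the selected points. As `classRel` empties ill-founded sections, `R` is
  -- always well-founded.
  obtain ⟨R, -, hR⟩ := exists_classRelation (M := M) (C := C) fun u v => ∃ i x : Elt M,
    u.1 = ZFSet.pair i.1 x.1 ∧ ((v.1 = e.1 ∧ P i x) ∨ ∃ y : Elt M, v.1 = ZFSet.pair i.1 y.1 ∧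
      ∃ A : Elt C, (∀ z : Elt M, z.1 ∈ A.1 ↔ ZFSet.pair i.1 z.1 ∈ B.1) ∧ classRel A.1 x.1 y.1)
  choose sec hsec using exists_section (M := M) (C := C) B
  have hsecu : ∀ i (A : Elt C), (∀ z : Elt M, z.1 ∈ A.1 ↔ ZFSet.pair i.1 z.1 ∈ B.1) → A = sec i := by
    intro i A hA
    refine Subtype.ext (ZFSet.ext fun z => ⟨fun hz => ?_, fun hz => ?_⟩)
    · exact (hsec i ⟨z, hM.out.subset _ A.2 hz⟩).2 ((hA _).1 hz)
    · exact (hA ⟨z, hM.out.subset _ (sec i).2 hz⟩).2 ((hsec i _).1 hz)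
  have hpair : ∀ (i y : Elt M) (u : ZFSet.{u}), ZFSet.pair u (ZFSet.pair i.1 y.1) ∈ R.1 ↔
      ∃ x : Elt M, u = ZFSet.pair i.1 x.1 ∧ classRel (sec i).1 x.1 y.1 := by
    intro i y u
    rw [hR]
    constructor
    · rintro ⟨hu, hv, i', x, rfl, ⟨h, -⟩ | ⟨y', h, A, hA, hxy⟩⟩
      · exact absurd h (hne _ _)
      · obtain ⟨h₁, h₂⟩ := ZFSet.pair_inj.1 h
        obtain rfl := Subtype.ext h₁
        obtain rfl := Subtype.ext h₂
        exact ⟨x, rfl, hsecu _ A hA ▸ hxy⟩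
    · rintro ⟨x, rfl, h⟩
      exact ⟨hM.out.pair_mem i.2 x.2, hM.out.pair_mem i.2 y.2, i, x, rfl,
        .inr ⟨y, rfl, sec i, hsec i, h⟩⟩
  have htop : ∀ u, ZFSet.pair u e.1 ∈ R.1 ↔ ∃ i x : Elt M, u = ZFSet.pair i.1 x.1 ∧ P i x := by
    intro u
    rw [hR]
    constructor
    · rintro ⟨hu, hv, i, x, rfl, ⟨-, h⟩ | ⟨y, h, -⟩⟩
      · exact ⟨i, x, rfl, h⟩
      · exact absurd h.symm (hne _ _)
    · rintro ⟨i, x, rfl, h⟩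
      exact ⟨hM.out.pair_mem i.2 x.2, e.2, i, x, rfl, .inl ⟨rfl, h⟩⟩
  have hacc : ∀ (i : Elt M) (x : ZFSet.{u}) (hx : x ∈ M), Acc (pairRel R.1) (ZFSet.pair i.1 x) := by
    intro i x
    induction x using (classRel_wf (sec i).1).induction with | _ x ih
    intro hx
    refine ⟨_, fun u hu => ?_⟩
    obtain ⟨y, rfl, hy⟩ := (hpair i ⟨x, hx⟩ u).1 hu
    exact ih y.1 hy y.2
  have hwf : WellFounded (pairRel R.1) := by
    refine ⟨fun v => ⟨v, fun u hu => ?_⟩⟩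
    obtain ⟨_, _, i, x, rfl : u = _, -⟩ := (hR _ _).1 hu
    exact hacc i x x.2
  have hcol : ∀ (i : Elt M) (x : ZFSet.{u}) (hx : x ∈ M),
      collapse R.1 (ZFSet.pair i.1 x) = collapse (sec i).1 x := by
    intro i x
    induction x using (classRel_wf (sec i).1).induction with | _ x ih
    intro hx
    ext z
    rw [mem_collapse, mem_collapse_class (M := M)]
    simp only [classRel_iff hwf, hpair i ⟨x, hx⟩]
    constructor
    · rintro ⟨_, ⟨y, rfl, hy⟩, rfl⟩
      exact ⟨y, hy, ih y.1 hy y.2⟩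
    · rintro ⟨y, hy, rfl⟩
      exact ⟨_, ⟨y, rfl, hy⟩, (ih y.1 hy y.2).symm⟩
  refine ⟨collapse R.1 e.1, mem_codedModel.2 ⟨R, e, rfl⟩, fun w => ?_⟩
  rw [mem_collapse]
  simp only [classRel_iff hwf, htop]
  constructor
  · rintro ⟨_, ⟨i, x, rfl, h⟩, rfl⟩
    exact ⟨i, sec i, x, hsec i, h, hcol i x x.2⟩
  · rintro ⟨i, A, x, hA, h, rfl⟩
    obtain rfl := hsecu i A hA
    exact ⟨_, ⟨i, x, rfl, h⟩, (hcol i x x.2).symm⟩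

/-- Bounding for coded sets, from class bounding. -/
theorem exists_coded_bound (P : Elt M → Prop) (Q : Elt M → Elt C → Elt M → Prop)
    [hP : Dfn (memRel M M) (memRel M C) fun (s : Fin 1 → Elt M) (_ : Fin 0 → Elt C) => P (s 0)]
    [hQ : Dfn (memRel M M) (memRel M C) fun (s : Fin 2 → Elt M) (X : Fin 1 → Elt C) =>
      Q (s 0) (X 0) (s 1)]
    (h : ∀ i, P i → ∃ X a, Q i X a) :
    ∃ z ∈ codedModel M C, (∀ i, P i → ∃ X a, Q i X a ∧ collapse X.1 a.1 ∈ z) ∧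
      ∀ w ∈ z, ∃ i X a, P i ∧ Q i X a ∧ w = collapse X.1 a.1 := by
  have := @hP.apply₁
  have := @hQ.applyClass
  obtain ⟨B, hB⟩ := hM.out.mkStar.exists_bound (fun i A => P i → ∃ a, Q i A a) fun i => by
    by_cases hi : P i
    · obtain ⟨X, a, hX⟩ := h i hi
      exact ⟨X, fun _ => ⟨a, hX⟩⟩
    · exact ⟨Classical.arbitrary _, fun hi' => absurd hi' hi⟩
  simp only [cRelated_iff hM.out.transitive hM.out.subset] at hB
  -- Class-Bounding says nothing about sections that are not needed. Only points that are witnesses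
  -- for some `i` are selected, so that `z` contains nothing else.
  obtain ⟨z, hz, hzw⟩ := exists_sectionImage (M := M) B fun y a => ∃ (i : Elt M) (A : Elt C),
    (∀ z : Elt M, z.1 ∈ A.1 ↔ ZFSet.pair y.1 z.1 ∈ B.1) ∧ P i ∧ Q i A a
  refine ⟨z, hz, fun i hi => ?_, fun w hw => ?_⟩
  · obtain ⟨y, A, hA, hQ⟩ := hB i
    obtain ⟨a, ha⟩ := hQ hi
    exact ⟨A, a, ha, (hzw _).2 ⟨y, A, a, hA, ⟨i, A, hA, hi, ha⟩, rfl⟩⟩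
  · obtain ⟨y, A, a, hA, ⟨i, A', hA', hi, hQ⟩, rfl⟩ := (hzw _).1 hw
    have : A = A' := Subtype.ext (ZFSet.ext fun z =>
      ⟨fun hz => (hA' ⟨z, hM.out.subset _ A.2 hz⟩).2 ((hA _).1 hz),
       fun hz => (hA ⟨z, hM.out.subset _ A'.2 hz⟩).2 ((hA' _).1 hz)⟩)
    exact ⟨i, A', a, hi, hQ, this ▸ rfl⟩

/-- If all witnesses for `i` code the same set `G i`, the bound from `exists_coded_bound` is exactly
the image. -/
theorem exists_coded_image (P : Elt M → Prop) (G : Elt M → ZFSet.{u})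
    [hP : Dfn (memRel M M) (memRel M C) fun (s : Fin 1 → Elt M) (_ : Fin 0 → Elt C) => P (s 0)]
    [hG : Dfn (memRel M M) (memRel M C) fun (s : Fin 2 → Elt M) (X : Fin 1 → Elt C) =>
      collapse (X 0).1 (s 1).1 = G (s 0)]
    (h : ∀ i, P i → G i ∈ codedModel M C) :
    ∃ z ∈ codedModel M C, ∀ w, w ∈ z ↔ ∃ i, P i ∧ w = G i := by
  obtain ⟨z, hz, h₁, h₂⟩ := exists_coded_bound (C := C) P (fun i X a => collapse X.1 a.1 = G i)
    fun i hi => mem_codedModel.1 (h i hi)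
  refine ⟨z, hz, fun w => ⟨fun hw => ?_, ?_⟩⟩
  · obtain ⟨i, X, a, hi, h, rfl⟩ := h₂ w hw
    exact ⟨i, hi, h⟩
  · rintro ⟨i, hi, rfl⟩
    obtain ⟨X, a, h, ha⟩ := h₁ i hi
    exact h ▸ ha

/-! ### Closure properties of the coded model and its relation to `M` and `C` -/

theorem sets_subset_codedModel {x : ZFSet.{u}} (hx : x ∈ M) : x ∈ codedModel M C := by
  obtain ⟨R, hR⟩ := exists_mem_class M C
  exact mem_codedModel.2 ⟨R, ⟨x, hx⟩, hR x hx⟩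

theorem class_mem_codedModel (X : Elt C) : X.1 ∈ codedModel M C := by
  obtain ⟨R, hR⟩ := exists_mem_class M C
  obtain ⟨z, hz, h⟩ := exists_coded_image (M := M) (C := C) (fun x => x.1 ∈ X.1)
    (fun x => collapse R.1 x.1) fun i _ => mem_codedModel.2 ⟨R, i, rfl⟩
  suffices X.1 = z from this ▸ hz
  ext w
  rw [h]
  constructor
  · intro hw
    have := hM.out.subset _ X.2 hw
    exact ⟨⟨w, this⟩, hw, (hR w this).symm⟩
  · rintro ⟨i, hi, rfl⟩
    rwa [hR i i.2]

/-- A point `z` of `M` is its own collapse under the membership class, so lying in a given coded set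
is a definable condition on `z`, and Comprehension applies. -/
theorem mem_classes_of_subset {x : ZFSet.{u}} (hx : x ∈ codedModel M C) (h : x ⊆ M) : x ∈ C := by
  obtain ⟨R, hR⟩ := exists_mem_class M C
  obtain ⟨X, a, rfl⟩ := mem_codedModel.1 hx
  obtain ⟨Y, hY⟩ := exists_class (M := M) (C := C) fun z => collapse R.1 z.1 ∈ collapse X.1 a.1
  suffices collapse X.1 a.1 = Y.1 from this ▸ Y.2
  ext z
  rw [hY]
  exact ⟨fun hz => ⟨h hz, (hR z (h hz)).symm ▸ hz⟩, fun ⟨hz, hz'⟩ => hR z hz ▸ hz'⟩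

theorem pairSet_mem_codedModel {x y : ZFSet.{u}} (hx : x ∈ codedModel M C)
    (hy : y ∈ codedModel M C) : ({x, y} : ZFSet.{u}) ∈ codedModel M C := by
  obtain ⟨X, a, rfl⟩ := mem_codedModel.1 hx
  obtain ⟨Y, b, rfl⟩ := mem_codedModel.1 hy
  obtain ⟨e, he⟩ := hM.out.exists_empty
  have he' : ({e.1, e.1} : ZFSet.{u}) ∈ M := hM.out.pairSet_mem e.2 e.2
  -- The index `e` stands for the first set and every other index for the second; `{e}` shows that
  -- another index exists.
  obtain ⟨z, hz, h₁, h₂⟩ := exists_coded_bound (M := M) (C := C) (fun _ => True)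
    (fun i Z c => (i = e ∧ collapse Z.1 c.1 = collapse X.1 a.1) ∨
      (i ≠ e ∧ collapse Z.1 c.1 = collapse Y.1 b.1)) fun i _ => by
      by_cases hi : i = e
      · exact ⟨X, a, .inl ⟨hi, rfl⟩⟩
      · exact ⟨Y, b, .inr ⟨hi, rfl⟩⟩
  suffices {collapse X.1 a.1, collapse Y.1 b.1} = z from this ▸ hz
  ext w
  rw [ZFSet.mem_pair]
  constructor
  · rintro (rfl | rfl)
    · obtain ⟨Z, c, ⟨-, h⟩ | ⟨h, -⟩, hw⟩ := h₁ e trivial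
      · exact h ▸ hw
      · exact absurd rfl h
    · obtain ⟨Z, c, ⟨h, -⟩ | ⟨-, h⟩, hw⟩ := h₁ ⟨_, he'⟩ trivial
      · have h' : ({e.1, e.1} : ZFSet.{u}) = e.1 := congrArg Subtype.val h
        have : e.1 ∈ ({e.1, e.1} : ZFSet.{u}) := by simp
        rw [h'] at this
        exact absurd this (ZFSet.mem_irrefl _)
      · exact h ▸ hw
  · intro hw
    obtain ⟨i, Z, c, -, ⟨-, h⟩ | ⟨-, h⟩, rfl⟩ := h₂ w hw
    · exact .inl h
    · exact .inr h

theorem pair_mem_codedModel {x y : ZFSet.{u}} (hx : x ∈ codedModel M C)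
    (hy : y ∈ codedModel M C) : ZFSet.pair x y ∈ codedModel M C := by
  have h := pairSet_mem_codedModel hx hx
  rw [ZFSet.pair_eq_singleton] at h
  exact pairSet_mem_codedModel h (pairSet_mem_codedModel hx hy)

theorem sUnion_mem_codedModel {x : ZFSet.{u}} (hx : x ∈ codedModel M C) :
    ZFSet.sUnion x ∈ codedModel M C := by
  obtain ⟨X, a, rfl⟩ := mem_codedModel.1 hx
  obtain ⟨z, hz, h⟩ := exists_coded_image (M := M) (C := C)
    (fun c => ∃ b : Elt M, classRel X.1 b.1 a.1 ∧ classRel X.1 c.1 b.1)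
    (fun c => collapse X.1 c.1) fun c _ => mem_codedModel.2 ⟨X, c, rfl⟩
  suffices ZFSet.sUnion (collapse X.1 a.1) = z from this ▸ hz
  ext w
  rw [h, ZFSet.mem_sUnion]
  constructor
  · rintro ⟨v, hv, hw⟩
    obtain ⟨b, hb, rfl⟩ := (mem_collapse_class (M := M)).1 hv
    obtain ⟨c, hc, rfl⟩ := (mem_collapse_class (M := M)).1 hw
    exact ⟨c, ⟨b, hb, hc⟩, rfl⟩
  · rintro ⟨c, ⟨b, hb, hc⟩, rfl⟩
    exact ⟨_, collapse_mem_collapse hb, collapse_mem_collapse hc⟩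

/-! #### Formulas of set theory in the coded model -/

-- A variable for a coded set becomes a class variable together with a set variable, and a
-- quantifier over coded sets becomes a quantifier over codes. The atomic cases are the definability
-- of equality and membership of collapses.
open FirstOrder in
theorem dfn_realize {α : Type} {k : ℕ} (φ : setLang.BoundedFormula α k) :
    ∀ {l : ℕ} (f : α → Fin l) (g : Fin k → Fin l), Dfn (memRel M M) (memRel M C)
      fun (s : Fin l → Elt M) (X : Fin l → Elt C) =>
        @Language.BoundedFormula.Realize setLang _
          (setStructure (memRel (codedModel M C) (codedModel M C))) α k φ
          (fun i => decode (X (f i)) (s (f i))) (fun i => decode (X (g i)) (s (g i))) := by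
  let := setStructure (memRel (codedModel M C) (codedModel M C))
  have hterm : ∀ {k : ℕ} (t : setLang.Term (α ⊕ Fin k)), ∃ i, t = Language.Term.var i := fun t => by
    cases t with
    | var i => exact ⟨i, rfl⟩
    | func f _ => exact f.elim
  induction φ with
  | falsum => exact fun f g => inferInstanceAs (Dfn _ _ fun _ _ => False)
  | @equal k t₁ t₂ =>
    intro l f g
    obtain ⟨i, rfl⟩ := hterm t₁
    obtain ⟨j, rfl⟩ := hterm t₂
    refine Dfn.congr (P := fun s X => collapse (X (Sum.elim f g i)).1 (s (Sum.elim f g i)).1 =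
      collapse (X (Sum.elim f g j)).1 (s (Sum.elim f g j)).1) inferInstance fun s X => ?_
    simp only [Language.BoundedFormula.Realize, Language.Term.realize_var, decode]
    rcases i with i | i <;> rcases j with j | j <;> simp
  | @rel k l' R ts =>
    intro l f g
    cases R
    obtain ⟨i, hi⟩ := hterm (ts 0)
    obtain ⟨j, hj⟩ := hterm (ts 1)
    refine Dfn.congr (P := fun s X => collapse (X (Sum.elim f g i)).1 (s (Sum.elim f g i)).1 ∈
      collapse (X (Sum.elim f g j)).1 (s (Sum.elim f g j)).1) inferInstance fun s X => ?_
    simp only [Language.BoundedFormula.Realize, Language.Structure.RelMap, hi, hj,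
      Language.Term.realize_var, memRel, decode]
    rcases i with i | i <;> rcases j with j | j <;> simp
  | imp φ ψ ih₁ ih₂ =>
    intro l f g
    have := ih₁ f g
    have := ih₂ f g
    simp only [Language.BoundedFormula.Realize]
    infer_instance
  | @all k φ ih =>
    intro l f g
    have h := ih (l := l + 1) (Fin.succ ∘ f) (Fin.snoc (Fin.succ ∘ g) 0)
    refine Dfn.congr (P := fun s X => ∀ (Y : Elt C) (a : Elt M),
      φ.Realize (fun i => decode (X (f i)) (s (f i)))
        (Fin.snoc (fun i => decode (X (g i)) (s (g i))) (decode Y a))) ?_ fun s X => ?_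
    · have : Dfn (memRel M M) (memRel M C) fun (s : Fin (l + 1) → Elt M) (X : Fin (l + 1) → Elt C) =>
          φ.Realize (fun i => decode (X (f i).succ) (s (f i).succ))
            (Fin.snoc (fun i => decode (X (g i).succ) (s (g i).succ)) (decode (X 0) (s 0))) := by
        refine h.congr fun s X => Iff.of_eq ?_
        congr 1
        funext i
        cases i using Fin.lastCases <;> simp
      infer_instance
    · simp only [Language.BoundedFormula.Realize]
      exact ⟨fun h Y a => h _, fun h x => by obtain ⟨Y, a, rfl⟩ := exists_decode x; exact h Y a⟩

theorem dfn_sat {n : ℕ} (φ : setLang.Formula (Fin n)) : Dfn (memRel M M) (memRel M C)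
    fun (s : Fin n → Elt M) (X : Fin n → Elt C) =>
      Sat (memRel (codedModel M C) (codedModel M C)) φ fun i => decode (X i) (s i) :=
  (dfn_realize φ id Fin.elim0).congr fun s X => by
    simp only [Sat, FirstOrder.Language.Formula.Realize, id]
    exact Iff.of_eq (congrArg _ (Subsingleton.elim _ _))

/-- The members of a coded set are the collapses of the predecessors of its code, so the subset
sought is the image of a definable collection of points. -/
theorem codedModel_separation {n : ℕ} (φ : setLang.Formula (Fin (n + 1)))
    (p : Fin n → Elt (codedModel M C)) (a : Elt (codedModel M C)) :
    ∃ b : Elt (codedModel M C), ∀ x : Elt (codedModel M C), x.1 ∈ b.1 ↔ x.1 ∈ a.1 ∧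
      Sat (memRel (codedModel M C) (codedModel M C)) φ (Fin.cons x p) := by
  obtain ⟨X, a, rfl⟩ := exists_decode a
  choose Y c hYc using fun i => exists_decode (p i)
  have : Dfn (memRel M M) (memRel M C) fun (s : Fin 1 → Elt M) (_ : Fin 0 → Elt C) =>
      Sat (memRel (codedModel M C) (codedModel M C)) φ (Fin.cons (decode X (s 0)) p) := by
    refine Dfn.congr (Dfn.subst (dfn_sat φ) (Fin.cons (fun s _ => s 0) fun i _ _ => c i)
      (Fin.cons (fun _ _ => X) fun i _ _ => Y i) (Fin.forall_fin_succ.2 ⟨?_, fun i => ?_⟩)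
      (Fin.forall_fin_succ.2 ⟨?_, fun i => ?_⟩)) fun s Z => Iff.of_eq (congrArg _ (funext fun i => ?_))
    · exact inferInstanceAs (SetTerm fun s _ => s 0)
    · exact inferInstanceAs (SetTerm fun s _ => c i)
    · exact inferInstanceAs (ClassTerm fun s _ => X)
    · exact inferInstanceAs (ClassTerm fun s _ => Y i)
    · cases i using Fin.cases
      · rfl
      · simp [hYc]
  obtain ⟨z, hz, h⟩ := exists_coded_image (M := M) (C := C) (fun x => classRel X.1 x.1 a.1 ∧
    Sat (memRel (codedModel M C) (codedModel M C)) φ (Fin.cons (decode X x) p))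
    (fun x => collapse X.1 x.1) fun x _ => mem_codedModel.2 ⟨X, x, rfl⟩
  refine ⟨⟨z, hz⟩, fun x => (h x).trans ⟨?_, ?_⟩⟩
  · rintro ⟨b, ⟨hb, hS⟩, hx⟩
    obtain rfl : x = decode X b := Subtype.ext hx
    exact ⟨collapse_mem_collapse hb, hS⟩
  · rintro ⟨hx, hS⟩
    obtain ⟨b, hb, hx⟩ := (mem_collapse_class (M := M)).1 hx
    obtain rfl : x = decode X b := Subtype.ext hx
    exact ⟨b, ⟨hb, hS⟩, rfl⟩

/-- Predecessors of the code of `a` stand for its members, and codes for the witnesses are collected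
by Class-Bounding. -/
theorem codedModel_bounding {n : ℕ} (φ : setLang.Formula (Fin (n + 2)))
    (p : Fin n → Elt (codedModel M C)) (a : Elt (codedModel M C))
    (hex : ∀ x : Elt (codedModel M C), x.1 ∈ a.1 → ∃ y,
      Sat (memRel (codedModel M C) (codedModel M C)) φ (Fin.cons x (Fin.cons y p))) :
    ∃ b : Elt (codedModel M C), ∀ x : Elt (codedModel M C), x.1 ∈ a.1 →
      ∃ y : Elt (codedModel M C), y.1 ∈ b.1 ∧
        Sat (memRel (codedModel M C) (codedModel M C)) φ (Fin.cons x (Fin.cons y p)) := by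
  obtain ⟨X, a, rfl⟩ := exists_decode a
  choose Y c hYc using fun i => exists_decode (p i)
  have : Dfn (memRel M M) (memRel M C) fun (s : Fin 2 → Elt M) (Z : Fin 1 → Elt C) =>
      Sat (memRel (codedModel M C) (codedModel M C)) φ
        (Fin.cons (decode X (s 0)) (Fin.cons (decode (Z 0) (s 1)) p)) := by
    refine Dfn.congr (Dfn.subst (dfn_sat φ)
      (Fin.cons (fun s _ => s 0) (Fin.cons (fun s _ => s 1) fun i _ _ => c i))
      (Fin.cons (fun _ _ => X) (Fin.cons (fun _ Z => Z 0) fun i _ _ => Y i))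
      (Fin.forall_fin_succ.2 ⟨?_, Fin.forall_fin_succ.2 ⟨?_, fun i => ?_⟩⟩)
      (Fin.forall_fin_succ.2 ⟨?_, Fin.forall_fin_succ.2 ⟨?_, fun i => ?_⟩⟩))
      fun s Z => Iff.of_eq (congrArg _ (funext fun i => ?_))
    · exact inferInstanceAs (SetTerm fun s _ => s 0)
    · exact inferInstanceAs (SetTerm fun s _ => s 1)
    · exact inferInstanceAs (SetTerm fun s _ => c i)
    · exact inferInstanceAs (ClassTerm fun s _ => X)
    · exact inferInstanceAs (ClassTerm fun s Z => Z 0)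
    · exact inferInstanceAs (ClassTerm fun s _ => Y i)
    · cases i using Fin.cases with
      | zero => rfl
      | succ i => cases i using Fin.cases with
        | zero => rfl
        | succ i => simp [hYc]
  obtain ⟨z, hz, h, -⟩ := exists_coded_bound (M := M) (C := C) (fun x => classRel X.1 x.1 a.1)
    (fun x Z y => Sat (memRel (codedModel M C) (codedModel M C)) φ
        (Fin.cons (decode X x) (Fin.cons (decode Z y) p))) fun x hx => by
    obtain ⟨y, hy⟩ := hex (decode X x) (collapse_mem_collapse hx)
    obtain ⟨Z, c, rfl⟩ := exists_decode y
    exact ⟨Z, c, hy⟩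
  refine ⟨⟨z, hz⟩, fun x hx => ?_⟩
  obtain ⟨b, hb, hx⟩ := (mem_collapse_class (M := M)).1 hx
  obtain rfl : x = decode X b := Subtype.ext hx
  obtain ⟨Z, c, hS, hc⟩ := h b hb
  exact ⟨decode Z c, hc, hS⟩

end

/-! ### Further absoluteness for transitive sets -/

section Transitive

variable {N : ZFSet.{u}}

theorem isPowerSet_iff (hN : N.IsTransitive) {p a : Elt N} :
    IsPowerSet (memRel N N) p a ↔ ∀ z ∈ N, z ∈ p.1 ↔ z ⊆ a.1 := by
  constructor
  · intro h z hz
    exact (h ⟨z, hz⟩).trans ⟨fun h w hw => h ⟨w, hN.subset_of_mem hz hw⟩ hw, fun h w hw => h hw⟩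
  · intro h z
    exact (h z z.2).trans ⟨fun h w hw => h hw, fun h w hw => h ⟨w, hN.subset_of_mem z.2 hw⟩ hw⟩

theorem mem_toZFSet_rank {y β : ZFSet.{u}} :
    β ∈ y.rank.toZFSet ↔ ∃ z ∈ y, β = z.rank.toZFSet ∨ β ∈ z.rank.toZFSet := by
  rw [Ordinal.mem_toZFSet_iff]
  constructor
  · rintro ⟨a, ha, rfl⟩
    obtain ⟨z, hz, haz⟩ := ZFSet.lt_rank_iff.1 ha
    refine ⟨z, hz, ?_⟩
    rcases haz.eq_or_lt with rfl | h
    · exact .inl rfl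
    · exact .inr (Ordinal.toZFSet_mem_toZFSet_iff.2 h)
  · rintro ⟨z, hz, rfl | h⟩
    · exact ⟨_, ZFSet.rank_lt_of_mem hz, rfl⟩
    · obtain ⟨a, ha, rfl⟩ := Ordinal.mem_toZFSet_iff.1 h
      exact ⟨a, ha.trans (ZFSet.rank_lt_of_mem hz), rfl⟩

/-- By `∈`-induction, a rank function in the sense of `N` takes the true ranks as values, as von
Neumann ordinals. -/
theorem rank_mem_of_inV (hN : N.IsTransitive) {k x : Elt N} (h : InV (memRel N N) k x) :
    x.1.rank.toZFSet ∈ k.1 := by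
  obtain ⟨t, f, ht, hxt, ⟨⟨b, hb⟩, hf⟩, r, hxr, hr⟩ := h
  rw [isTrans_iff hN] at ht
  rw [isFunc_iff hN] at hb
  simp only [related_iff hN] at hf hxr
  have key : ∀ y : ZFSet.{u}, y ∈ t.1 → ∀ a : Elt N, ZFSet.pair y a.1 ∈ f.1 →
      a.1 = y.rank.toZFSet := by
    intro y
    induction y using ZFSet.inductionOn with | _ y ih
    intro hy a hya
    have hyN := hN.subset_of_mem t.2 hy
    have hval : ∀ z ∈ y, ∃ c : Elt N, ZFSet.pair z c.1 ∈ f.1 := fun z hz => by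
      obtain ⟨c, hc, -⟩ := hb.2 z (ht.subset_of_mem hy hz)
      exact ⟨⟨c, (mem_of_pair_mem hN (hN.subset_of_mem f.2 hc)).2⟩, hc⟩
    ext β
    rw [mem_toZFSet_rank]
    constructor
    · intro hβ
      obtain ⟨z, c, hz, hzc, h⟩ := (hf ⟨y, hyN⟩ a hya ⟨β, hN.subset_of_mem a.2 hβ⟩).1 hβ
      have hc := ih z hz (ht.subset_of_mem hy hz) c hzc
      refine ⟨z, hz, ?_⟩
      rw [← hc]
      exact h.imp (congrArg Subtype.val) id
    · rintro ⟨z, hz, h⟩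
      obtain ⟨c, hc⟩ := hval z hz
      rw [← ih z hz (ht.subset_of_mem hy hz) c hc] at h
      have hβN : β ∈ N := by
        rcases h with rfl | h
        · exact c.2
        · exact hN.subset_of_mem c.2 h
      exact (hf ⟨y, hyN⟩ a hya ⟨β, hβN⟩).2
        ⟨⟨z, hN.subset_of_mem hyN hz⟩, c, hz, hc, h.imp Subtype.ext id⟩
  rw [← key x.1 hxt r hxr]
  exact hr

theorem inV_of_rank_mem (hN : N.IsTransitive) {k x : Elt N} {t f b : ZFSet.{u}} (htN : t ∈ N)
    (hfN : f ∈ N) (hbN : b ∈ N) (ht : t.IsTransitive) (hx : x.1 ∈ t)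
    (hf : ∀ w, w ∈ f ↔ ∃ z ∈ t, w = ZFSet.pair z z.rank.toZFSet)
    (hb : ∀ z ∈ t, z.rank.toZFSet ∈ b) (hk : x.1.rank.toZFSet ∈ k.1) :
    InV (memRel N N) k x := by
  have hp : ∀ {y a}, ZFSet.pair y a ∈ f ↔ y ∈ t ∧ a = y.rank.toZFSet := fun {y a} => by
    rw [hf]
    constructor
    · rintro ⟨z, hz, h⟩
      obtain ⟨rfl, rfl⟩ := ZFSet.pair_inj.1 h
      exact ⟨hz, rfl⟩
    · rintro ⟨h, rfl⟩
      exact ⟨y, h, rfl⟩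
  refine ⟨⟨t, htN⟩, ⟨f, hfN⟩, (isTrans_iff hN).2 ht, hx, ⟨⟨⟨b, hbN⟩, (isFunc_iff hN).2 ⟨?_, ?_⟩⟩, ?_⟩,
    ⟨_, hN.subset_of_mem k.2 hk⟩, (related_iff hN).2 (hp.2 ⟨hx, rfl⟩), hk⟩
  · intro p hpf
    obtain ⟨z, hz, rfl⟩ := (hf p).1 hpf
    exact ⟨z, hz, _, hb z hz, rfl⟩
  · intro z hz
    exact ⟨_, hp.2 ⟨hz, rfl⟩, fun a ha => (hp.1 ha).2⟩
  · intro y a hya β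
    rw [related_iff hN, hp] at hya
    simp only [related_iff hN, hp, memRel, hya.2]
    rw [mem_toZFSet_rank]
    constructor
    · rintro ⟨z, hz, h⟩
      have hzt := ht.subset_of_mem hya.1 hz
      exact ⟨⟨z, hN.subset_of_mem htN hzt⟩, ⟨_, hN.subset_of_mem hbN (hb z hzt)⟩, hz, ⟨hzt, rfl⟩,
        h.imp Subtype.ext id⟩
    · rintro ⟨z, c, hz, ⟨-, hc⟩, h⟩
      exact ⟨z, hz, hc ▸ h.imp (congrArg Subtype.val) id⟩

theorem isInj_graph {ι : Type*} {P : ι → Prop} {c g : ι → ZFSet.{u}} {f a b : ZFSet.{u}}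
    (hc : ∀ i j, P i → P j → c i = c j → i = j) (hg : ∀ i j, P i → P j → g i = g j → i = j)
    (hf : ∀ w, w ∈ f ↔ ∃ i, P i ∧ w = ZFSet.pair (c i) (g i))
    (ha : ∀ w, w ∈ a ↔ ∃ i, P i ∧ w = c i) (hb : ∀ w, w ∈ b ↔ ∃ i, P i ∧ w = g i) :
    IsInj f a b ∧ ∀ y ∈ b, ∃ x, ZFSet.pair x y ∈ f := by
  have hp : ∀ {x y}, ZFSet.pair x y ∈ f ↔ ∃ i, P i ∧ x = c i ∧ y = g i := fun {x y} => by
    simp only [hf, ZFSet.pair_inj]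
  refine ⟨⟨⟨fun p hpf => ?_, fun x hx => ?_⟩, fun x x' y h h' => ?_⟩, fun y hy => ?_⟩
  · obtain ⟨i, hi, rfl⟩ := (hf p).1 hpf
    exact ⟨_, (ha _).2 ⟨i, hi, rfl⟩, _, (hb _).2 ⟨i, hi, rfl⟩, rfl⟩
  · obtain ⟨i, hi, rfl⟩ := (ha x).1 hx
    refine ⟨g i, hp.2 ⟨i, hi, rfl, rfl⟩, fun y hy => ?_⟩
    obtain ⟨j, hj, h, rfl⟩ := hp.1 hy
    rw [hc i j hi hj h]
  · obtain ⟨i, hi, rfl, rfl⟩ := hp.1 h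
    obtain ⟨j, hj, rfl, h⟩ := hp.1 h'
    rw [hg i j hi hj h]
  · obtain ⟨i, hi, rfl⟩ := (hb y).1 hy
    exact ⟨_, hp.2 ⟨i, hi, rfl, rfl⟩⟩

end Transitive

/-! ### Ranks and ordinals in `M` -/

section

variable {M C : ZFSet.{u}} [hM : Fact (IsBetaModelMKStar M C)]
variable [Fact M.IsTransitive] [Nonempty (Elt M)] [Nonempty (Elt C)] {n m : ℕ}

instance dfn_isOrdinal (x : (Fin n → Elt M) → (Fin m → Elt C) → Elt M) [SetTerm x] :
    Dfn (memRel M M) (memRel M C) (fun s Z => (x s Z).1.IsOrdinal) := by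
  refine Dfn.subst (P := fun (s : Fin 1 → Elt M) (_ : Fin 0 → Elt C) => (s 0).1.IsOrdinal)
    ?_ ![x] ![] (by simpa) (by simp)
  simp only [← isOrd_iff hM.out.transitive]
  unfold IsOrd SetTheoryModel.IsTrans
  infer_instance

-- By `∈`-induction: the set for `x` is the power set, in `M`, of the union of the sets for the
-- elements of `x`. Replacement collects the latter because comparison of ranks is definable.
include hM in
variable (C) in
theorem exists_rankSet (x : ZFSet.{u}) (hx : x ∈ M) :
    ∃ v ∈ M, ∀ z, z ∈ v ↔ z ∈ M ∧ z.rank ≤ x.rank := by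
  have ht := hM.out.transitive
  induction x using ZFSet.inductionOn with | _ x ih
  obtain ⟨b, hb, hb'⟩ := exists_replacement (M := M) (C := C)
    (fun y v => ∀ z : Elt M, z.1 ∈ v.1 ↔ z.1.rank ≤ y.1.rank) (fun y v v' h h' =>
      Subtype.ext (ZFSet.ext fun z => ⟨fun hz =>
        (h' ⟨z, ht.subset_of_mem v.2 hz⟩).2 ((h _).1 hz), fun hz =>
        (h ⟨z, ht.subset_of_mem v'.2 hz⟩).2 ((h' _).1 hz)⟩)) hx
  obtain ⟨p, hp, hp'⟩ := hM.out.exists_powerset (hM.out.sUnion_mem hb)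
  refine ⟨p, hp, fun z => (hp' z).trans (and_congr_right fun hz => ?_)⟩
  rw [rank_le_rank_iff]
  refine forall₂_congr fun z' hz' => ?_
  rw [ZFSet.mem_sUnion]
  constructor
  · rintro ⟨v, hv, hz'v⟩
    obtain ⟨hvM, y, hy, h⟩ := (hb' v).1 hv
    exact ⟨y, hy, (h ⟨z', ht.subset_of_mem hz hz'⟩).1 hz'v⟩
  · rintro ⟨y, hy, h⟩
    obtain ⟨v, hv, hv'⟩ := ih y hy (ht.subset_of_mem hx hy)
    exact ⟨v, (hb' v).2 ⟨hv, ⟨y, ht.subset_of_mem hx hy⟩, hy, fun z => (hv' z).trans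
      (and_iff_right z.2)⟩, (hv' _).2 ⟨ht.subset_of_mem hz hz', h⟩⟩

-- An ordinal is its own rank, so the rank of `x` is separated from the set in `exists_rankSet` as
-- the ordinals of smaller rank than `x`.
include hM in
variable (C) in
theorem rank_toZFSet_mem {x : ZFSet.{u}} (hx : x ∈ M) : x.rank.toZFSet ∈ M := by
  have ht := hM.out.transitive
  induction x using ZFSet.inductionOn with | _ x ih
  obtain ⟨v, hv, hv'⟩ := exists_rankSet C x hx
  obtain ⟨b, hb, hb'⟩ := exists_separation (M := M) (C := C)
    (fun β => β.1.IsOrdinal ∧ ¬ (⟨x, hx⟩ : Elt M).1.rank ≤ β.1.rank) hv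
  suffices x.rank.toZFSet = b from this ▸ hb
  ext β
  rw [hb', hv', mem_toZFSet_rank]
  constructor
  · rintro ⟨z, hz, h⟩
    have hzM := ih z hz (ht.subset_of_mem hx hz)
    have hβ : β ∈ M ∧ β.IsOrdinal ∧ β.rank ≤ z.rank := by
      rcases h with rfl | h
      · exact ⟨hzM, ZFSet.isOrdinal_toZFSet _, by simp⟩
      · refine ⟨ht.subset_of_mem hzM h, (ZFSet.isOrdinal_toZFSet _).mem h, ?_⟩
        have := (ZFSet.rank_lt_of_mem h).le
        simpa using this
    have hlt := hβ.2.2.trans_lt (ZFSet.rank_lt_of_mem hz)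
    exact ⟨⟨hβ.1, hlt.le⟩, hβ.1, hβ.2.1, not_le.2 hlt⟩
  · rintro ⟨⟨hβ, _⟩, _, ho, hlt⟩
    obtain ⟨z, hz, h⟩ := ZFSet.lt_rank_iff.1 (not_le.1 hlt)
    refine ⟨z, hz, ?_⟩
    rw [← ZFSet.IsOrdinal.toZFSet_rank_eq (x := β) ho]
    rcases h.eq_or_lt with h | h
    · exact .inl (by simp [h])
    · exact .inr (Ordinal.toZFSet_mem_toZFSet_iff.2 (by simpa using h))

variable (M C) in
theorem exists_ordinals : ∃ K : Elt C, ∀ x, x ∈ K.1 ↔ x ∈ M ∧ x.IsOrdinal := by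
  obtain ⟨K, hK⟩ := exists_class (M := M) (C := C) fun x => x.1.IsOrdinal
  exact ⟨K, fun x => (hK x).trans ⟨fun ⟨h, h'⟩ => ⟨h, h'⟩, fun ⟨h, h'⟩ => ⟨h, h'⟩⟩⟩

variable (M) in
/-- `k` is the set of all ordinals in `M`. -/
def IsOrdinalsOf (k : ZFSet.{u}) : Prop := ∀ x, x ∈ k ↔ x ∈ M ∧ x.IsOrdinal

theorem IsOrdinalsOf.isOrdinal {k : ZFSet.{u}} (hk : IsOrdinalsOf M k) (hM : M.IsTransitive) :
    k.IsOrdinal := by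
  rw [ZFSet.isOrdinal_iff_forall_mem_isOrdinal]
  refine ⟨fun x hx y hy => ?_, fun x hx => ((hk x).1 hx).2⟩
  obtain ⟨h, ho⟩ := (hk x).1 hx
  exact (hk y).2 ⟨hM.subset_of_mem h hy, ho.mem hy⟩

theorem IsOrdinalsOf.notMem {k : ZFSet.{u}} (hk : IsOrdinalsOf M k) (hM : M.IsTransitive) :
    k ∉ M := fun h => ZFSet.mem_irrefl k ((hk k).2 ⟨h, hk.isOrdinal hM⟩)

theorem IsOrdinalsOf.mem_or_eq {k : ZFSet.{u}} (hk : IsOrdinalsOf M k) (hM : M.IsTransitive)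
    {l : ZFSet.{u}} (hl : l.IsOrdinal) (h : l ⊆ M) : l = k ∨ l ∈ k :=
  (hl.subset_iff_eq_or_mem (hk.isOrdinal hM)).1 fun x hx => (hk x).2 ⟨h hx, hl.mem hx⟩

/-- `W` is a well-ordering of `M` with initial segments that are elements of `M`. -/
structure IsSetLikeWellOrder (M W : ZFSet.{u}) : Prop where
  wf : WellFounded (pairRel W)
  trans : ∀ x y z, ZFSet.pair x y ∈ W → ZFSet.pair y z ∈ W → ZFSet.pair x z ∈ W
  total : ∀ x ∈ M, ∀ y ∈ M, x = y ∨ ZFSet.pair x y ∈ W ∨ ZFSet.pair y x ∈ W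
  setLike : ∀ x ∈ M, ∃ b ∈ M, ∀ y, ZFSet.pair y x ∈ W → y ∈ b

-- Order by rank, and sets of equal rank by the global well-ordering; initial segments are then
-- bounded by the sets from `exists_rankSet`. Global Choice gives least elements only for classes,
-- and the `β`-property upgrades this to real well-foundedness.
variable (M C) in
theorem exists_setLikeWellOrder : ∃ W : Elt C, IsSetLikeWellOrder M W.1 := by
  have ht := hM.out.transitive
  obtain ⟨W₀, hirr, htrans, htot, hmin⟩ := hM.out.mkStar.mkAxioms.globalChoice
  simp only [cRelated_iff ht hM.out.subset] at hirr htrans htot hmin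
  have hwf₀ : WellFounded (pairRel W₀.1) := by
    refine (hM.out.beta W₀).1 fun X hX => ?_
    obtain ⟨a, ha, h⟩ := hmin X hX
    refine ⟨a, ha, fun b hb hba => ?_⟩
    rw [cRelated_iff ht hM.out.subset] at hba
    rcases h b hb with rfl | h
    · exact hirr _ hba
    · exact hirr _ (htrans _ _ _ h hba)
  obtain ⟨W, -, hW⟩ := exists_classRelation (M := M) (C := C) fun x y =>
    ¬ y.1.rank ≤ x.1.rank ∨ (x.1.rank ≤ y.1.rank ∧ y.1.rank ≤ x.1.rank ∧
      ZFSet.pair x.1 y.1 ∈ W₀.1)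
  have hW' : ∀ x y : ZFSet.{u}, ZFSet.pair x y ∈ W.1 ↔ x ∈ M ∧ y ∈ M ∧
      (x.rank < y.rank ∨ x.rank = y.rank ∧ ZFSet.pair x y ∈ W₀.1) := fun x y => by
    simp only [hW, exists_prop, not_le, le_antisymm_iff, and_assoc]
  refine ⟨W, ?_, fun x y z hxy hyz => ?_, fun x hx y hy => ?_, fun x hx => ?_⟩
  · refine Subrelation.wf (fun {x y} h => ?_) (InvImage.wf (fun x : ZFSet.{u} => (x.rank, x))
      (WellFounded.prod_lex (α := Ordinal) (ra := (· < ·)) wellFounded_lt hwf₀))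
    rcases ((hW' x y).1 h).2.2 with h | ⟨h, h'⟩
    · exact Prod.Lex.left _ _ h
    · simp only [InvImage, h]
      exact Prod.Lex.right _ h'
  · rw [hW'] at *
    obtain ⟨hx, hy, hxy⟩ := hxy
    obtain ⟨-, hz, hyz⟩ := hyz
    refine ⟨hx, hz, ?_⟩
    rcases hxy with h | ⟨h, h'⟩ <;> rcases hyz with g | ⟨g, g'⟩
    · exact .inl (h.trans g)
    · exact .inl (g ▸ h)
    · exact .inl (h ▸ g)
    · exact .inr ⟨h.trans g, htrans ⟨x, hx⟩ ⟨y, hy⟩ ⟨z, hz⟩ h' g'⟩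
  · simp only [hW']
    rcases lt_trichotomy x.rank y.rank with h | h | h
    · exact .inr (.inl ⟨hx, hy, .inl h⟩)
    · rcases htot ⟨x, hx⟩ ⟨y, hy⟩ with h' | h' | h'
      · exact .inl (congrArg Subtype.val h')
      · exact .inr (.inl ⟨hx, hy, .inr ⟨h, h'⟩⟩)
      · exact .inr (.inr ⟨hy, hx, .inr ⟨h.symm, h'⟩⟩)
    · exact .inr (.inr ⟨hy, hx, .inl h⟩)
  · obtain ⟨v, hv, hv'⟩ := exists_rankSet C x hx
    refine ⟨v, hv, fun y hy => ?_⟩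
    obtain ⟨hyM, -, h⟩ := (hW' _ _).1 hy
    exact (hv' y).2 ⟨hyM, h.elim le_of_lt fun h => h.1.le⟩

/-- Inductively the predecessors of `v` have collapses in `M`; as these predecessors are bounded by
a set, Replacement in `M` collects the collapses. Applied to a set-like well-ordering, this puts the
order types of initial segments into `M`. -/
theorem collapse_mem_of_setLike (D : Elt C)
    (hD : ∀ v ∈ M, ∃ b ∈ M, ∀ u, classRel D.1 u v → u ∈ b) (v : ZFSet.{u}) (hv : v ∈ M) :
    collapse D.1 v ∈ M := by
  induction v using (classRel_wf D.1).induction with | _ v ih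
  obtain ⟨R, hR⟩ := exists_mem_class M C
  obtain ⟨b, hb, hb'⟩ := hD v hv
  obtain ⟨z, hz, hz'⟩ := exists_replacement (M := M) (C := C) (fun u z =>
    classRel D.1 u.1 (⟨v, hv⟩ : Elt M).1 ∧ collapse D.1 u.1 = collapse R.1 z.1)
    (fun u z z' h h' => Subtype.ext (by rw [← hR z z.2, ← hR z' z'.2, ← h.2, ← h'.2])) hb
  suffices collapse D.1 v = z from this ▸ hz
  ext w
  rw [hz', mem_collapse_class (M := M)]
  constructor
  · rintro ⟨y, hy, rfl⟩
    have := ih y hy y.2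
    exact ⟨this, y, hb' y hy, hy, (hR _ this).symm⟩
  · rintro ⟨hw, y, -, hy, h⟩
    exact ⟨y, hy, by rw [h, hR w hw]⟩

/-! ### Enumerations in the coded model -/

theorem exists_coded_image₂ (P : Elt M → Elt M → Prop) (G : Elt M → Elt M → ZFSet.{u})
    [hP : Dfn (memRel M M) (memRel M C) fun (s : Fin 2 → Elt M) (_ : Fin 0 → Elt C) =>
      P (s 0) (s 1)]
    [hG : ∀ {n m : ℕ} (x y z : (Fin n → Elt M) → (Fin m → Elt C) → Elt M)
      (X : (Fin n → Elt M) → (Fin m → Elt C) → Elt C) [SetTerm x] [SetTerm y] [SetTerm z]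
      [ClassTerm X], Dfn (memRel M M) (memRel M C) fun s Z =>
        collapse (X s Z).1 (z s Z).1 = G (x s Z) (y s Z)]
    (h : ∀ i j, P i j → G i j ∈ codedModel M C) :
    ∃ z ∈ codedModel M C, ∀ w, w ∈ z ↔ ∃ i j, P i j ∧ w = G i j := by
  have := @hP.apply₂
  obtain ⟨z, hz, h₁, h₂⟩ := exists_coded_bound (M := M) (C := C)
    (fun p => ∃ i j : Elt M, p.1 = ZFSet.pair i.1 j.1 ∧ P i j)
    (fun p X a => ∃ i j : Elt M, p.1 = ZFSet.pair i.1 j.1 ∧ P i j ∧ collapse X.1 a.1 = G i j)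
    (by
      rintro p ⟨i, j, hp, hij⟩
      obtain ⟨X, a, h⟩ := mem_codedModel.1 (h i j hij)
      exact ⟨X, a, i, j, hp, hij, h⟩)
  refine ⟨z, hz, fun w => ⟨fun hw => ?_, ?_⟩⟩
  · obtain ⟨p, X, a, -, ⟨i, j, -, hij, h⟩, rfl⟩ := h₂ w hw
    exact ⟨i, j, hij, h⟩
  · rintro ⟨i, j, hij, rfl⟩
    obtain ⟨X, a, ⟨i', j', hp, -, h⟩, hX⟩ := h₁ ⟨_, hM.out.pair_mem i.2 j.2⟩ ⟨i, j, rfl, hij⟩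
    obtain ⟨h₁, h₂⟩ := ZFSet.pair_inj.1 hp
    obtain rfl := Subtype.ext h₁
    obtain rfl := Subtype.ext h₂
    exact h ▸ hX

/-- The class `J` indexes the elements of `x` without repetitions by way of the collapse of `R`. -/
structure IsIndexing (M R J x : ZFSet.{u}) : Prop where
  mem_iff : ∀ w, w ∈ x ↔ ∃ j : Elt M, j.1 ∈ J ∧ w = collapse R j.1
  inj : ∀ i j : Elt M, i.1 ∈ J → j.1 ∈ J → collapse R i.1 = collapse R j.1 → i = j

/-- Among the predecessors with a given collapse only the `W`-least one is kept. -/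
theorem exists_isIndexing {W : Elt C} (hW : IsSetLikeWellOrder M W.1) {x : ZFSet.{u}}
    (hx : x ∈ codedModel M C) : ∃ R J : Elt C, IsIndexing M R.1 J.1 x := by
  obtain ⟨R, a, rfl⟩ := mem_codedModel.1 hx
  obtain ⟨J, hJ⟩ := exists_class (M := M) (C := C) fun j => classRel R.1 j.1 a.1 ∧
    ∀ i : Elt M, classRel R.1 i.1 a.1 → collapse R.1 i.1 = collapse R.1 j.1 →
      ¬ ZFSet.pair i.1 j.1 ∈ W.1
  refine ⟨R, J, fun w => ?_, fun i j hi hj h => ?_⟩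
  · rw [mem_collapse_class (M := M)]
    constructor
    · rintro ⟨y, hy, rfl⟩
      obtain ⟨j, ⟨hjM, hj, hjy⟩, hmin⟩ := hW.wf.has_min
        {j | j ∈ M ∧ classRel R.1 j a.1 ∧ collapse R.1 j = collapse R.1 y} ⟨y, y.2, hy, rfl⟩
      exact ⟨⟨j, hjM⟩, (hJ j).2 ⟨hjM, hj, fun i hi hij => hmin i ⟨i.2, hi, hij.trans hjy⟩⟩, hjy.symm⟩
    · rintro ⟨j, hj, rfl⟩
      exact ⟨j, ((hJ j).1 hj).2.1, rfl⟩
  · obtain ⟨_, hi₁, hi₂⟩ := (hJ i).1 hi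
    obtain ⟨_, hj₁, hj₂⟩ := (hJ j).1 hj
    rcases hW.total i i.2 j j.2 with h' | h' | h'
    · exact Subtype.ext h'
    · exact absurd h' (hj₂ i hi₁ h)
    · exact absurd h' (hi₂ j hj₁ h.symm)

/-- The order `W` on indices is transported to the elements of `x`. It is really well-founded, so
least elements exist for all subsets `y`, whether coded or not. -/
theorem exists_coded_wellOrder {W : Elt C} (hW : IsSetLikeWellOrder M W.1) {x : ZFSet.{u}}
    (hx : x ∈ codedModel M C) : ∃ r ∈ codedModel M C,
      (∀ a ∈ x, ZFSet.pair a a ∉ r) ∧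
      (∀ a b c, ZFSet.pair a b ∈ r → ZFSet.pair b c ∈ r → ZFSet.pair a c ∈ r) ∧
      (∀ a ∈ x, ∀ b ∈ x, a = b ∨ ZFSet.pair a b ∈ r ∨ ZFSet.pair b a ∈ r) ∧
      ∀ y ⊆ x, (∃ a, a ∈ y) → ∃ a ∈ y, ∀ b ∈ y, b = a ∨ ZFSet.pair a b ∈ r := by
  obtain ⟨R, J, hJ⟩ := exists_isIndexing hW hx
  obtain ⟨r, hr, hr'⟩ := exists_coded_image₂ (M := M) (C := C)
    (fun i j => i.1 ∈ J.1 ∧ j.1 ∈ J.1 ∧ ZFSet.pair i.1 j.1 ∈ W.1)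
    (fun i j => ZFSet.pair (collapse R.1 i.1) (collapse R.1 j.1))
    (hG := fun x y z X _ _ _ _ => inferInstance) fun i j _ =>
      pair_mem_codedModel (mem_codedModel.2 ⟨R, i, rfl⟩) (mem_codedModel.2 ⟨R, j, rfl⟩)
  have hp : ∀ i j : Elt M, i.1 ∈ J.1 → j.1 ∈ J.1 →
      (ZFSet.pair (collapse R.1 i.1) (collapse R.1 j.1) ∈ r ↔ ZFSet.pair i.1 j.1 ∈ W.1) := by
    intro i j hi hj
    rw [hr']
    constructor
    · rintro ⟨i', j', ⟨hi', hj', h⟩, he⟩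
      obtain ⟨h₁, h₂⟩ := ZFSet.pair_inj.1 he
      rwa [hJ.inj i i' hi hi' h₁, hJ.inj j j' hj hj' h₂]
    · exact fun h => ⟨i, j, ⟨hi, hj, h⟩, rfl⟩
  refine ⟨r, hr, fun a ha h => ?_, fun a b c hab hbc => ?_, fun a ha b hb => ?_, fun y hy ⟨a, ha⟩ => ?_⟩
  · obtain ⟨i, hi, rfl⟩ := (hJ.mem_iff a).1 ha
    exact hW.wf.irrefl.irrefl _ ((hp i i hi hi).1 h)
  · obtain ⟨i, j, ⟨hi, hj, hij⟩, he⟩ := (hr' _).1 hab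
    obtain ⟨rfl, rfl⟩ := ZFSet.pair_inj.1 he
    obtain ⟨j', k, ⟨hj', hk, hjk⟩, he⟩ := (hr' _).1 hbc
    obtain ⟨h₁, rfl⟩ := ZFSet.pair_inj.1 he
    obtain rfl := hJ.inj j j' hj hj' h₁
    exact (hp i k hi hk).2 (hW.trans _ _ _ hij hjk)
  · obtain ⟨i, hi, rfl⟩ := (hJ.mem_iff a).1 ha
    obtain ⟨j, hj, rfl⟩ := (hJ.mem_iff b).1 hb
    rw [hp i j hi hj, hp j i hj hi]
    exact (hW.total i i.2 j j.2).imp_left fun h => by rw [h]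
  · obtain ⟨i, hi, rfl⟩ := (hJ.mem_iff a).1 (hy ha)
    obtain ⟨j, ⟨hjM, hj, hjy⟩, hmin⟩ := hW.wf.has_min
      {j | j ∈ M ∧ j ∈ J.1 ∧ collapse R.1 j ∈ y} ⟨i, i.2, hi, ha⟩
    refine ⟨_, hjy, fun b hb => ?_⟩
    obtain ⟨k, hk, rfl⟩ := (hJ.mem_iff b).1 (hy hb)
    rw [hp ⟨j, hjM⟩ k hj hk]
    rcases hW.total k k.2 j hjM with h | h | h
    · exact .inl (by rw [h])
    · exact absurd h (hmin k ⟨k.2, hk, hb⟩)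
    · exact .inr h

/-- The ordinal `l` is the order type of the index class under `W`, obtained by collapsing. Initial
segments are set-like, so each value is in `M`; but `l` itself may consist of all ordinals of `M`,
and then it is not in `M`. -/
theorem exists_enumeration {W : Elt C} (hW : IsSetLikeWellOrder M W.1) {x : ZFSet.{u}}
    (hx : x ∈ codedModel M C) : ∃ l ∈ codedModel M C, l.IsOrdinal ∧ l ⊆ M ∧
      (∃ f ∈ codedModel M C, IsInj f l x ∧ ∀ y ∈ x, ∃ z, ZFSet.pair z y ∈ f) ∧
      (∃ f ∈ codedModel M C, IsInj f x l ∧ ∀ y ∈ l, ∃ z, ZFSet.pair z y ∈ f) := by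
  obtain ⟨R, J, hJ⟩ := exists_isIndexing hW hx
  obtain ⟨D, -, hD⟩ := exists_classRelation (M := M) (C := C) fun i j =>
    i.1 ∈ J.1 ∧ j.1 ∈ J.1 ∧ ZFSet.pair i.1 j.1 ∈ W.1
  have hwf : WellFounded (pairRel D.1) :=
    Subrelation.wf (fun {i j} h => ((hD i j).1 h).2.2.2.2) hW.wf
  have hrel : ∀ {i j}, classRel D.1 i j ↔ i ∈ J.1 ∧ j ∈ J.1 ∧ ZFSet.pair i j ∈ W.1 := fun {i j} => by
    rw [classRel_iff hwf, hD]
    exact ⟨fun ⟨_, _, h⟩ => h, fun h => ⟨hM.out.subset _ J.2 h.1, hM.out.subset _ J.2 h.2.1, h⟩⟩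
  have hDM : ∀ j : Elt M, collapse D.1 j.1 ∈ M := fun j =>
    collapse_mem_of_setLike D (fun v hv => by
      obtain ⟨b, hb, h⟩ := hW.setLike v hv
      exact ⟨b, hb, fun u hu => h u (hrel.1 hu).2.2⟩) j j.2
  have hDinj : ∀ i j : Elt M, i.1 ∈ J.1 → j.1 ∈ J.1 → collapse D.1 i.1 = collapse D.1 j.1 →
      i = j := fun i j hi hj h => by
    rcases hW.total i i.2 j j.2 with h' | h' | h'
    · exact Subtype.ext h'
    · have := collapse_mem_collapse (hrel.2 ⟨hi, hj, h'⟩)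
      exact absurd (h ▸ this) (ZFSet.mem_irrefl _)
    · have := collapse_mem_collapse (hrel.2 ⟨hj, hi, h'⟩)
      exact absurd (h ▸ this) (ZFSet.mem_irrefl _)
  have htrans : ∀ j : ZFSet.{u}, (collapse D.1 j).IsTransitive := fun j v hv u hu => by
    obtain ⟨i, hi, rfl⟩ := mem_collapse.1 hv
    obtain ⟨k, hk, rfl⟩ := mem_collapse.1 hu
    obtain ⟨hk₁, -, hk₂⟩ := hrel.1 hk
    obtain ⟨-, hj, hi₂⟩ := hrel.1 hi
    exact collapse_mem_collapse (hrel.2 ⟨hk₁, hj, hW.trans _ _ _ hk₂ hi₂⟩)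
  obtain ⟨l, hl, hl'⟩ := exists_coded_image (M := M) (C := C) (fun j => j.1 ∈ J.1)
    (fun j => collapse D.1 j.1) fun j _ => mem_codedModel.2 ⟨D, j, rfl⟩
  obtain ⟨f, hf, hf'⟩ := exists_coded_image (M := M) (C := C) (fun j => j.1 ∈ J.1)
    (fun j => ZFSet.pair (collapse D.1 j.1) (collapse R.1 j.1)) fun j _ =>
      pair_mem_codedModel (mem_codedModel.2 ⟨D, j, rfl⟩) (mem_codedModel.2 ⟨R, j, rfl⟩)
  obtain ⟨g, hg, hg'⟩ := exists_coded_image (M := M) (C := C) (fun j => j.1 ∈ J.1)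
    (fun j => ZFSet.pair (collapse R.1 j.1) (collapse D.1 j.1)) fun j _ =>
      pair_mem_codedModel (mem_codedModel.2 ⟨R, j, rfl⟩) (mem_codedModel.2 ⟨D, j, rfl⟩)
  refine ⟨l, hl, ?_, ?_, ⟨f, hf, isInj_graph hDinj hJ.inj hf' hl' hJ.mem_iff⟩,
    ⟨g, hg, isInj_graph hJ.inj hDinj hg' hJ.mem_iff hl'⟩⟩
  · rw [ZFSet.isOrdinal_iff_forall_mem_isTransitive]
    constructor
    · intro v hv u hu
      obtain ⟨j, hj, rfl⟩ := (hl' v).1 hv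
      obtain ⟨i, hi, rfl⟩ := (mem_collapse_class (M := M)).1 hu
      exact (hl' _).2 ⟨i, (hrel.1 hi).1, rfl⟩
    · intro v hv
      obtain ⟨j, hj, rfl⟩ := (hl' v).1 hv
      exact htrans _
  · intro v hv
    obtain ⟨j, hj, rfl⟩ := (hl' v).1 hv
    exact hDM j

/-! ### The ordinals of `M` as strongly inaccessible and largest cardinal -/

theorem exists_image_mem {f a b : ZFSet.{u}} (hf : f ∈ codedModel M C) (ha : a ∈ M) (hb : b ⊆ M)
    (hfab : IsFun f a b) : ∃ r ∈ M, ∀ y, y ∈ r ↔ ∃ x ∈ a, ZFSet.pair x y ∈ f := by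
  have ht := hM.out.transitive
  have hfC : f ∈ C := mem_classes_of_subset hf fun p hp => by
    obtain ⟨x, hx, y, hy, rfl⟩ := hfab.1 p hp
    exact hM.out.pair_mem (ht.subset_of_mem ha hx) (hb hy)
  obtain ⟨r, hr, h⟩ := exists_replacement (M := M) (C := C)
    (fun x y => ZFSet.pair x.1 y.1 ∈ (⟨f, hfC⟩ : Elt C).1) (fun x y y' h h' => by
      obtain ⟨x', hx', y', hy', he⟩ := hfab.1 _ h
      obtain ⟨rfl, rfl⟩ := ZFSet.pair_inj.1 he
      exact Subtype.ext ((hfab.2 _ hx').unique h h')) ha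
  refine ⟨r, hr, fun y => (h y).trans ⟨?_, ?_⟩⟩
  · rintro ⟨hy, x, hx, hxy⟩
    exact ⟨x, hx, hxy⟩
  · rintro ⟨x, hx, hxy⟩
    exact ⟨(mem_of_pair_mem_class (M := M) ⟨f, hfC⟩ hxy).2, ⟨x, ht.subset_of_mem ha hx⟩, hx, hxy⟩

/-- Otherwise Replacement would make the ordinals of `M` an element of `M`. -/
theorem not_surjective_ordinals {k : ZFSet.{u}} (hk : IsOrdinalsOf M k) {f a : ZFSet.{u}}
    (hf : f ∈ codedModel M C) (ha : a ∈ M) (hfa : IsFun f a k) :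
    ¬ ∀ y ∈ k, ∃ x, ZFSet.pair x y ∈ f := by
  intro h
  obtain ⟨r, hr, hr'⟩ := exists_image_mem hf ha (fun x hx => ((hk x).1 hx).1) hfa
  refine hk.notMem hM.out.transitive ?_
  suffices k = r from this ▸ hr
  ext y
  rw [hr']
  constructor
  · intro hy
    obtain ⟨x, hx⟩ := h y hy
    obtain ⟨x', hx', y', hy', he⟩ := hfa.1 _ hx
    obtain ⟨rfl, rfl⟩ := ZFSet.pair_inj.1 he
    exact ⟨x, hx', hx⟩
  · rintro ⟨x, hx, hxy⟩
    obtain ⟨x', hx', y', hy', he⟩ := hfa.1 _ hxy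
    obtain ⟨rfl, rfl⟩ := ZFSet.pair_inj.1 he
    exact hy'

theorem IsBetaModelMKStar.insert_mem (hM : IsBetaModelMKStar M C) {x : ZFSet.{u}} (hx : x ∈ M) :
    insert x x ∈ M := by
  have h := hM.sUnion_mem (hM.pairSet_mem (hM.pairSet_mem hx hx) hx)
  rw [ZFSet.pair_eq_singleton, ZFSet.sUnion_pair, ← ZFSet.insert_eq] at h
  exact h

theorem isStronglyInaccessible_ordinals {W : Elt C} (hW : IsSetLikeWellOrder M W.1)
    {k : Elt (codedModel M C)} (hk : IsOrdinalsOf M k.1) :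
    IsStronglyInaccessible (memRel (codedModel M C) (codedModel M C)) k := by
  have ht := hM.out.transitive
  have hT := isTransitive_codedModel (M := M) (C := C)
  have hkM : k.1 ⊆ M := fun x hx => ((hk x).1 hx).1
  constructor
  · refine ⟨(isOrd_iff hT).2 (hk.isOrdinal ht), ?_⟩
    rintro a ha ⟨f, hf⟩
    rw [isBijection_iff hT] at hf
    exact not_surjective_ordinals hk f.2 (hkM ha) hf.1.1 hf.2
  · obtain ⟨x, hx, he, hs⟩ := (infinity_iff ht).1 hM.out.mkStar.mkAxioms.infinity
    -- The inductive set need not be `ω`, but the supremum of the ordinals in it is a limit ordinal.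
    obtain ⟨y, hy, hy'⟩ := exists_separation (M := M) (C := C) (fun β => β.1.IsOrdinal) hx
    have hyM := hM.out.sUnion_mem hy
    have hmem : ∀ β, β ∈ y ↔ β ∈ x ∧ β.IsOrdinal := fun β => (hy' β).trans
      ⟨fun ⟨h, _, h'⟩ => ⟨h, h'⟩, fun ⟨h, h'⟩ => ⟨h, ht.subset_of_mem hx h, h'⟩⟩
    have hord : (ZFSet.sUnion y).IsOrdinal := by
      rw [ZFSet.isOrdinal_iff_forall_mem_isOrdinal]
      refine ⟨ZFSet.IsTransitive.sUnion' fun β hβ => ((hmem β).1 hβ).2.isTransitive, fun z hz => ?_⟩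
      obtain ⟨β, hβ, hz⟩ := ZFSet.mem_sUnion.1 hz
      exact ((hmem β).1 hβ).2.mem hz
    have hsucc : ∀ β ∈ y, insert β β ∈ y := fun β hβ => by
      obtain ⟨h₁, h₂⟩ := (hmem β).1 hβ
      exact (hmem _).2 ⟨hs β h₁, ZFSet.isOrdinal_succ h₂⟩
    have hsub : ∀ β ∈ y, β ∈ ZFSet.sUnion y := fun β hβ =>
      ZFSet.mem_sUnion.2 ⟨_, hsucc β hβ, ZFSet.mem_insert _ _⟩
    refine ⟨⟨_, sets_subset_codedModel hyM⟩, (hk _).2 ⟨hyM, hord⟩, (isOrd_iff hT).2 hord,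
      ⟨⟨∅, sets_subset_codedModel (ht.subset_of_mem hx he)⟩,
        hsub ∅ ((hmem _).2 ⟨he, ZFSet.isOrdinal_empty⟩)⟩, fun z hz => ?_⟩
    obtain ⟨β, hβ, hzβ⟩ := ZFSet.mem_sUnion.1 hz
    exact ⟨⟨β, sets_subset_codedModel (ht.subset_of_mem hy hβ)⟩, hsub β hβ, hzβ⟩
  · intro a ha f hf
    rw [isFunc_iff hT] at hf
    obtain ⟨r, hr, hr'⟩ := exists_image_mem f.2 (hkM ha) hkM hf
    have hrk : ∀ y ∈ r, y ∈ k.1 := fun y hy => by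
      obtain ⟨x, hx, hxy⟩ := (hr' y).1 hy
      obtain ⟨x', hx', y', hy', he⟩ := hf.1 _ hxy
      obtain ⟨rfl, rfl⟩ := ZFSet.pair_inj.1 he
      exact hy'
    have hord : (ZFSet.sUnion r).IsOrdinal := by
      rw [ZFSet.isOrdinal_iff_forall_mem_isOrdinal]
      refine ⟨ZFSet.IsTransitive.sUnion' fun β hβ => ((hk β).1 (hrk β hβ)).2.isTransitive,
        fun z hz => ?_⟩
      obtain ⟨β, hβ, hz⟩ := ZFSet.mem_sUnion.1 hz
      exact ((hk β).1 (hrk β hβ)).2.mem hz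
    -- A value of `f` may equal the supremum, so the strict bound is its successor.
    have hS := hM.out.insert_mem (hM.out.sUnion_mem hr)
    refine ⟨⟨_, sets_subset_codedModel hS⟩, (hk _).2 ⟨hS, ZFSet.isOrdinal_succ hord⟩,
      fun x y hxy => ?_⟩
    rw [related_iff hT] at hxy
    obtain ⟨x', hx', y', hy', he⟩ := hf.1 _ hxy
    obtain ⟨h₁, h₂⟩ := ZFSet.pair_inj.1 he
    have hyr : y.1 ∈ r := (hr' _).2 ⟨x.1, h₁ ▸ hx', hxy⟩
    have := (((hk y.1).1 (hrk _ hyr)).2.subset_iff_eq_or_mem hord).1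
      fun z hz => ZFSet.mem_sUnion.2 ⟨_, hyr, hz⟩
    exact ZFSet.mem_insert_iff.2 this
  · intro a ha
    obtain ⟨p, hp, hp'⟩ := hM.out.exists_powerset (hkM ha)
    refine ⟨⟨p, sets_subset_codedModel hp⟩, (isPowerSet_iff hT).2 fun z hz => (hp' z).trans
      ⟨fun h => h.2, fun h => ⟨?_, h⟩⟩, ?_⟩
    -- The power set formed in `M` is also the one of the coded model: a coded subset of a set in
    -- `M` is a class, hence a set in `M`.
    · have hzC : z ∈ C := mem_classes_of_subset hz
        fun w hw => ht.subset_of_mem (hkM ha) (h hw)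
      exact mem_of_class_subset ⟨z, hzC⟩ (hkM ha) h
    · obtain ⟨l, hl, hord, hlM, -, f, hf, hinj, hsurj⟩ :=
        exists_enumeration hW (sets_subset_codedModel hp)
      -- Length `k` is impossible, since it would map the set `p` of `M` onto all ordinals of `M`.
      rcases hk.mem_or_eq ht hord hlM with rfl | h
      · exact absurd hsurj (not_surjective_ordinals hk hf hp hinj.1)
      · exact ⟨⟨l, hl⟩, h, ⟨f, hf⟩, (isInjection_iff hT).2 hinj⟩

/-- An ordinal above `k` is enumerated in length at most `k`, hence in bijection with a smaller
ordinal. -/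
theorem isLargestCard_ordinals {W : Elt C} (hW : IsSetLikeWellOrder M W.1)
    {k : Elt (codedModel M C)} (hk : IsOrdinalsOf M k.1) :
    IsLargestCard (memRel (codedModel M C) (codedModel M C)) k := by
  have ht := hM.out.transitive
  have hT := isTransitive_codedModel (M := M) (C := C)
  refine ⟨(isStronglyInaccessible_ordinals hW hk).card, fun m hm => ?_⟩
  rcases ((isOrd_iff hT).1 hm.1).mem_trichotomous (hk.isOrdinal ht) with h | h | h
  · exact .inr h
  · exact .inl (Subtype.ext h)
  · exfalso
    obtain ⟨l, hl, hord, hlM, ⟨f, hf, hbij⟩, -⟩ := exists_enumeration hW m.2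
    refine hm.2 ⟨l, hl⟩ ?_ ⟨⟨f, hf⟩, (isBijection_iff hT).2 hbij⟩
    change l ∈ m.1
    rcases hk.mem_or_eq ht hord hlM with rfl | h'
    · exact h
    · exact ((isOrd_iff hT).1 hm.1).mem_trans h' h

theorem exists_injection_ordinals {W : Elt C} (hW : IsSetLikeWellOrder M W.1)
    {k : ZFSet.{u}} (hk : IsOrdinalsOf M k) {x : ZFSet.{u}} (hx : x ∈ codedModel M C) :
    ∃ f ∈ codedModel M C, IsInj f x k := by
  have ht := hM.out.transitive
  obtain ⟨l, hl, hord, hlM, -, f, hf, hinj, -⟩ := exists_enumeration hW hx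
  refine ⟨f, hf, ⟨fun p hp => ?_, hinj.1.2⟩, hinj.2⟩
  obtain ⟨x, hx, y, hy, he⟩ := hinj.1.1 p hp
  exact ⟨x, hx, y, (hk y).2 ⟨hlM hy, hord.mem hy⟩, he⟩

/-- From left to right, the rank function on the set from `exists_rankSet` is coded. From right to
left, `∈`-induction makes `x` a subset of `M`, hence a class, and its rank bounds it by an element
of `M`. -/
theorem mem_sets_iff_inV {k : Elt (codedModel M C)} (hk : IsOrdinalsOf M k.1) (x : ZFSet.{u}) :
    x ∈ M ↔ ∃ h : x ∈ codedModel M C,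
      InV (memRel (codedModel M C) (codedModel M C)) k ⟨x, h⟩ := by
  have ht := hM.out.transitive
  have hT := isTransitive_codedModel (M := M) (C := C)
  constructor
  · intro hx
    obtain ⟨R, hR⟩ := exists_mem_class M C
    obtain ⟨v, hv, hv'⟩ := exists_rankSet C x hx
    have hdfn : Dfn (memRel M M) (memRel M C) fun (s : Fin 2 → Elt M) (X : Fin 1 → Elt C) =>
        collapse (X 0).1 (s 1).1 = ZFSet.pair (s 0).1 (s 0).1.rank.toZFSet := by
      -- The rank of a set is the only ordinal of the same rank, which is expressible by comparisons
      -- of ranks.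
      refine Dfn.congr (P := fun s X => ∃ β : Elt M, β.1.IsOrdinal ∧ β.1.rank ≤ (s 0).1.rank ∧
        (s 0).1.rank ≤ β.1.rank ∧ collapse (X 0).1 (s 1).1 =
          ZFSet.pair (collapse R.1 (s 0).1) (collapse R.1 β.1)) inferInstance fun s X => ?_
      constructor
      · intro h
        have hβ := rank_toZFSet_mem C (s 0).2
        exact ⟨⟨_, hβ⟩, ZFSet.isOrdinal_toZFSet _, by simp, by simp,
          by rw [hR _ (s 0).2, hR _ hβ, h]⟩
      · rintro ⟨β, ho, h₁, h₂, h⟩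
        rw [h, hR _ (s 0).2, hR _ β.2, ← h₁.antisymm h₂, ho.toZFSet_rank_eq]
    obtain ⟨f, hf, hf'⟩ := exists_coded_image (M := M) (C := C)
      (fun z => z.1 ∈ (⟨v, hv⟩ : Elt M).1) (fun z => ZFSet.pair z.1 z.1.rank.toZFSet)
      fun z _ => pair_mem_codedModel (sets_subset_codedModel z.2)
        (sets_subset_codedModel (rank_toZFSet_mem C z.2))
    have hrk : ∀ z ∈ M, z.rank.toZFSet ∈ k.1 := fun z hz =>
      (hk _).2 ⟨rank_toZFSet_mem C hz, ZFSet.isOrdinal_toZFSet _⟩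
    refine ⟨sets_subset_codedModel hx, inV_of_rank_mem hT (sets_subset_codedModel hv) hf k.2
      (fun z hz w hw => ?_) ((hv' x).2 ⟨hx, le_rfl⟩) (fun w => (hf' w).trans ?_)
      (fun z hz => hrk z (ht.subset_of_mem hv hz)) (hrk x hx)⟩
    · obtain ⟨hzM, hz⟩ := (hv' z).1 hz
      exact (hv' w).2 ⟨ht.subset_of_mem hzM hw, (ZFSet.rank_lt_of_mem hw).le.trans hz⟩
    · exact ⟨fun ⟨i, hi, h⟩ => ⟨i, hi, h⟩,
        fun ⟨i, hi, h⟩ => ⟨⟨i, ht.subset_of_mem hv hi⟩, hi, h⟩⟩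
  · rintro ⟨h, hV⟩
    have hr : x.rank.toZFSet ∈ k.1 := rank_mem_of_inV hT hV
    clear hV
    induction x using ZFSet.inductionOn with | _ x ih
    have hxM : x ⊆ M := fun z hz => ih z hz (hT.subset_of_mem h hz)
      ((hk.isOrdinal ht).mem_trans
        (Ordinal.toZFSet_mem_toZFSet_iff.2 (ZFSet.rank_lt_of_mem hz)) hr)
    obtain ⟨v, hv, hv'⟩ := exists_rankSet C _ ((hk _).1 hr).1
    refine mem_of_class_subset ⟨x, mem_classes_of_subset h hxM⟩ hv fun z hz =>
      (hv' z).2 ⟨hxM hz, ?_⟩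
    rw [Ordinal.rank_toZFSet]
    exact (ZFSet.rank_lt_of_mem hz).le

/-! ### The coded model satisfies (a), (b) and (c) -/

theorem zfcMinus_codedModel : ZFCMinus (memRel (codedModel M C) (codedModel M C)) := by
  have ht := hM.out.transitive
  have hT := isTransitive_codedModel (M := M) (C := C)
  refine ⟨fun x y h => ?_, fun x ⟨y, hy⟩ => ?_, fun x y => ?_, fun x => ?_, ?_,
    fun n φ p a => codedModel_separation φ p a,
    fun n φ p a hex => codedModel_bounding φ p a hex, fun x => ?_⟩
  · exact Subtype.ext (ZFSet.ext fun z => ⟨fun hz => (h ⟨z, hT.subset_of_mem x.2 hz⟩).1 hz,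
      fun hz => (h ⟨z, hT.subset_of_mem y.2 hz⟩).2 hz⟩)
  · obtain ⟨z, hz, h⟩ := ZFSet.mem_wf.has_min {z | z ∈ x.1} ⟨y.1, hy⟩
    exact ⟨⟨z, hT.subset_of_mem x.2 hz⟩, hz, fun w hw hwz => h w.1 hw hwz⟩
  · exact ⟨⟨_, pairSet_mem_codedModel x.2 y.2⟩, (isPairSet_iff hT).2 rfl⟩
  · refine ⟨⟨_, sUnion_mem_codedModel x.2⟩, fun w => ZFSet.mem_sUnion.trans ⟨?_, ?_⟩⟩
    · rintro ⟨z, hz, hw⟩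
      exact ⟨⟨z, hT.subset_of_mem x.2 hz⟩, hz, hw⟩
    · rintro ⟨z, hz, hw⟩
      exact ⟨z, hz, hw⟩
  · obtain ⟨x, hx, h⟩ := (infinity_iff ht).1 hM.out.mkStar.mkAxioms.infinity
    exact (infinity_iff hT).2 ⟨x, sets_subset_codedModel hx, h⟩
  · obtain ⟨W, hW⟩ := exists_setLikeWellOrder M C
    obtain ⟨r, hr, h₁, h₂, h₃, h₄⟩ := exists_coded_wellOrder hW x.2
    refine ⟨⟨r, hr⟩, ?_⟩
    simp only [IsWellOrderOf, related_iff hT]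
    refine ⟨fun a ha => h₁ a ha, fun a b c _ _ _ => h₂ a b c, fun a b ha hb =>
      (h₃ a ha b hb).imp_left Subtype.ext, fun y ⟨a, ha⟩ hy => ?_⟩
    obtain ⟨b, hb, h⟩ := h₄ y.1 (fun z hz => hy ⟨z, hT.subset_of_mem y.2 hz⟩ hz) ⟨a, ha⟩
    exact ⟨⟨b, hT.subset_of_mem y.2 hb⟩, hb, fun c hc => (h c hc).imp_left Subtype.ext⟩

theorem isAssociatedModel_codedModel : IsAssociatedModel M C (codedModel M C) := by
  have ht := hM.out.transitive
  have hT := isTransitive_codedModel (M := M) (C := C)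
  obtain ⟨W, hW⟩ := exists_setLikeWellOrder M C
  obtain ⟨K, hK⟩ := exists_ordinals M C
  have hk : IsOrdinalsOf M (⟨K.1, class_mem_codedModel K⟩ : Elt (codedModel M C)).1 := hK
  refine ⟨hT, ⟨zfcMinus_codedModel, _, isStronglyInaccessible_ordinals hW hk, fun x => ?_⟩, ?_,
    _, mem_sets_iff_inV hk, isLargestCard_ordinals hW hk, isStronglyInaccessible_ordinals hW hk⟩
  · obtain ⟨f, hf, hinj⟩ := exists_injection_ordinals hW hk x.2
    exact ⟨⟨f, hf⟩, (isInjection_iff hT).2 hinj⟩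
  · ext X
    rw [ZFSet.mem_inter, ZFSet.mem_powerset]
    exact ⟨fun h => ⟨hM.out.subset _ h, class_mem_codedModel ⟨X, h⟩⟩,
      fun h => mem_classes_of_subset h.2 h.1⟩

end

/-! ### Transitive models of `ZFC⁻` -/

section

variable {N : ZFSet.{u}} [hT : Fact N.IsTransitive] [Nonempty (Elt N)]

theorem SetTheoryModel.ZFCMinus.pairSet_mem (hN : ZFCMinus (memRel N N)) {x y : ZFSet.{u}}
    (hx : x ∈ N) (hy : y ∈ N) : ({x, y} : ZFSet.{u}) ∈ N := by
  obtain ⟨z, hz⟩ := hN.pairing ⟨x, hx⟩ ⟨y, hy⟩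
  rw [isPairSet_iff hT.out] at hz
  exact hz ▸ z.2

theorem SetTheoryModel.ZFCMinus.pair_mem (hN : ZFCMinus (memRel N N)) {x y : ZFSet.{u}}
    (hx : x ∈ N) (hy : y ∈ N) : ZFSet.pair x y ∈ N := by
  have h := hN.pairSet_mem hx hx
  rw [ZFSet.pair_eq_singleton] at h
  exact hN.pairSet_mem h (hN.pairSet_mem hx hy)

theorem SetTheoryModel.ZFCMinus.sUnion_mem (hN : ZFCMinus (memRel N N)) {x : ZFSet.{u}}
    (hx : x ∈ N) : ZFSet.sUnion x ∈ N := by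
  obtain ⟨y, hy⟩ := hN.union ⟨x, hx⟩
  suffices h : ZFSet.sUnion x = y.1 from h ▸ y.2
  ext w
  rw [ZFSet.mem_sUnion]
  constructor
  · rintro ⟨z, hz, hw⟩
    have hzN := hT.out.subset_of_mem hx hz
    exact (hy ⟨w, hT.out.subset_of_mem hzN hw⟩).2 ⟨⟨z, hzN⟩, hz, hw⟩
  · intro hw
    obtain ⟨z, hz, hw⟩ := (hy ⟨w, hT.out.subset_of_mem y.2 hw⟩).1 hw
    exact ⟨z, hz, hw⟩

theorem SetTheoryModel.ZFCMinus.insert_mem (hN : ZFCMinus (memRel N N)) {x y : ZFSet.{u}}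
    (hx : x ∈ N) (hy : y ∈ N) : insert x y ∈ N := by
  have h := hN.sUnion_mem (hN.pairSet_mem (hN.pairSet_mem hx hx) hy)
  rw [ZFSet.pair_eq_singleton, ZFSet.sUnion_pair, ← ZFSet.insert_eq] at h
  exact h

theorem SetTheoryModel.ZFCMinus.exists_subset (hN : ZFCMinus (memRel N N)) (P : Elt N → Prop)
    [Dfn (memRel N N) (memRel N N) fun (s : Fin 1 → Elt N) (_ : Fin 0 → Elt N) => P (s 0)]
    {a : ZFSet.{u}} (ha : a ∈ N) : ∃ b ∈ N, ∀ x, x ∈ b ↔ x ∈ a ∧ ∃ h : x ∈ N, P ⟨x, h⟩ := by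
  obtain ⟨b, hb⟩ := hN.exists_sep P ⟨a, ha⟩
  refine ⟨b, b.2, fun x => ⟨fun hx => ?_, fun ⟨hx, h, hP⟩ => (hb ⟨x, h⟩).2 ⟨hx, hP⟩⟩⟩
  have := (hb ⟨x, hT.out.subset_of_mem b.2 hx⟩).1 hx
  exact ⟨this.1, _, this.2⟩

theorem SetTheoryModel.ZFCMinus.exists_collection (hN : ZFCMinus (memRel N N))
    (P : Elt N → Elt N → Prop)
    [Dfn (memRel N N) (memRel N N) fun (s : Fin 2 → Elt N) (_ : Fin 0 → Elt N) => P (s 0) (s 1)]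
    {a : ZFSet.{u}} (ha : a ∈ N) (h : ∀ x : Elt N, x.1 ∈ a → ∃ y, P x y) :
    ∃ b ∈ N, ∀ x : Elt N, x.1 ∈ a → ∃ y : Elt N, y.1 ∈ b ∧ P x y := by
  obtain ⟨b, hb⟩ := hN.exists_bound P ⟨a, ha⟩ h
  exact ⟨b, b.2, hb⟩

/-- Without Power Set the product comes from two applications of Bounding. A superset suffices, as
Separation cuts out relations later. -/
theorem SetTheoryModel.ZFCMinus.exists_prod (hN : ZFCMinus (memRel N N)) {a b : ZFSet.{u}}
    (ha : a ∈ N) (hb : b ∈ N) : ∃ d ∈ N, ∀ x ∈ a, ∀ y ∈ b, ZFSet.pair x y ∈ d := by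
  obtain ⟨d, hd, h⟩ := hN.exists_collection (fun x c => ∀ y : Elt N, y.1 ∈ (⟨b, hb⟩ : Elt N).1 →
    ZFSet.pair x.1 y.1 ∈ c.1) ha fun x hx => by
      obtain ⟨c, hc, h⟩ := hN.exists_collection (fun y p => p.1 = ZFSet.pair x.1 y.1) hb
        fun y hy => ⟨⟨_, hN.pair_mem x.2 y.2⟩, rfl⟩
      refine ⟨⟨c, hc⟩, fun y hy => ?_⟩
      obtain ⟨p, hp, he⟩ := h y hy
      exact he ▸ hp
  refine ⟨_, hN.sUnion_mem hd, fun x hx y hy => ?_⟩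
  obtain ⟨c, hc, h⟩ := h ⟨x, hT.out.subset_of_mem ha hx⟩ hx
  exact ZFSet.mem_sUnion.2 ⟨c, hc, h ⟨y, hT.out.subset_of_mem hb hy⟩ hy⟩

/-- By `∈`-induction, which avoids recursion on `ω` inside `N`: collect transitive sets around the
elements of `x`, discard the non-transitive members of the bound, take the union and add `x`. -/
theorem SetTheoryModel.ZFCMinus.exists_transitive (hN : ZFCMinus (memRel N N)) {x : ZFSet.{u}}
    (hx : x ∈ N) : ∃ t ∈ N, t.IsTransitive ∧ x ∈ t := by
  have ht := hT.out
  induction x using ZFSet.inductionOn with | _ x ih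
  have htr : ∀ {t : Elt N}, (∀ u v : Elt N, v.1 ∈ t.1 → u.1 ∈ v.1 → u.1 ∈ t.1) ↔
      t.1.IsTransitive := fun {t} => ⟨fun h v hv u hu => by
        have hv' := ht.subset_of_mem t.2 hv
        exact h ⟨u, ht.subset_of_mem hv' hu⟩ ⟨v, hv'⟩ hv hu, fun h u v hv hu => h.subset_of_mem hv hu⟩
  obtain ⟨b, hb, h⟩ := hN.exists_collection (fun y t =>
    (∀ u v : Elt N, v.1 ∈ t.1 → u.1 ∈ v.1 → u.1 ∈ t.1) ∧ y.1 ∈ t.1) hx fun y hy => by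
      obtain ⟨t, htN, h, hyt⟩ := ih y.1 hy y.2
      exact ⟨⟨t, htN⟩, htr.2 h, hyt⟩
  obtain ⟨c, hc, hc'⟩ := hN.exists_subset (fun t =>
    ∀ u v : Elt N, v.1 ∈ t.1 → u.1 ∈ v.1 → u.1 ∈ t.1) hb
  refine ⟨_, hN.insert_mem hx (hN.sUnion_mem hc), fun v hv u hu => ?_, ZFSet.mem_insert _ _⟩
  refine ZFSet.mem_insert_of_mem _ ?_
  rcases ZFSet.mem_insert_iff.1 hv with rfl | hv
  · obtain ⟨t, htb, h, hut⟩ := h ⟨u, ht.subset_of_mem hx hu⟩ hu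
    exact ZFSet.mem_sUnion.2 ⟨t, (hc' _).2 ⟨htb, t.2, h⟩, hut⟩
  · obtain ⟨t, htc, hvt⟩ := ZFSet.mem_sUnion.1 hv
    obtain ⟨-, h, h'⟩ := (hc' _).1 htc
    exact ZFSet.mem_sUnion.2 ⟨t, htc, htr.1 h' v hvt hu⟩

/-- Mostowski collapses exist in transitive models of `ZFC⁻`. -/
theorem SetTheoryModel.ZFCMinus.collapse_mem (hN : ZFCMinus (memRel N N)) {R : ZFSet.{u}}
    (hR : R ∈ N) (hwf : WellFounded (pairRel R)) {a : ZFSet.{u}} (ha : a ∈ N) :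
    collapse R a ∈ N := by
  have ht := hT.out
  let r : Elt N := ⟨R, hR⟩
  have hsub : ∀ {f x y : ZFSet.{u}}, f ∈ N → ZFSet.pair x y ∈ f → x ∈ N ∧ y ∈ N :=
    fun {f x y} hf h => mem_of_pair_mem ht (ht.subset_of_mem hf h)
  -- The left side says, with quantifiers over `N` only, that `f` is defined on all predecessors of
  -- points of its domain and obeys the recursion of the collapse. The right side says that such an
  -- `f` is a restriction of the true collapse.
  have hatt : ∀ f : Elt N, (∀ u v : Elt N, ZFSet.pair u.1 v.1 ∈ f.1 →
      (∀ u' : Elt N, ZFSet.pair u'.1 u.1 ∈ r.1 → ∃ v' : Elt N, ZFSet.pair u'.1 v'.1 ∈ f.1) ∧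
      ∀ w : Elt N, w.1 ∈ v.1 ↔ ∃ u' : Elt N, ZFSet.pair u'.1 u.1 ∈ r.1 ∧
        ZFSet.pair u'.1 w.1 ∈ f.1) ↔
      ∀ u v, ZFSet.pair u v ∈ f.1 → v = collapse R u ∧
        ∀ u', ZFSet.pair u' u ∈ R → ZFSet.pair u' (collapse R u') ∈ f.1 := by
    intro f
    constructor
    · intro h
      have key : ∀ u v, ZFSet.pair u v ∈ f.1 → v = collapse R u := by
        intro u
        induction u using hwf.induction with | _ u ih
        intro v huv
        obtain ⟨huN, hvN⟩ := hsub f.2 huv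
        obtain ⟨h₁, h₂⟩ := h ⟨u, huN⟩ ⟨v, hvN⟩ huv
        ext w
        rw [mem_collapse]
        simp only [classRel_iff hwf]
        constructor
        · intro hw
          obtain ⟨u', hu', hw'⟩ := (h₂ ⟨w, ht.subset_of_mem hvN hw⟩).1 hw
          exact ⟨u', hu', ih u' hu' w hw'⟩
        · rintro ⟨u', hu', rfl⟩
          obtain ⟨v', hv'⟩ := h₁ ⟨u', (hsub hR hu').1⟩ hu'
          have he := ih u' hu' v' hv'
          rw [← he]
          exact (h₂ v').2 ⟨⟨u', (hsub hR hu').1⟩, hu', hv'⟩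
      refine fun u v huv => ⟨key u v huv, fun u' hu' => ?_⟩
      obtain ⟨huN, hvN⟩ := hsub f.2 huv
      obtain ⟨v', hv'⟩ := (h ⟨u, huN⟩ ⟨v, hvN⟩ huv).1 ⟨u', (hsub hR hu').1⟩ hu'
      rw [← key _ _ hv']
      exact hv'
    · intro h u v huv
      obtain ⟨h₁, h₂⟩ := h u v huv
      refine ⟨fun u' hu' => ⟨⟨_, (hsub f.2 (h₂ u' hu')).2⟩, h₂ u' hu'⟩, fun w => ?_⟩
      rw [h₁, mem_collapse]
      simp only [classRel_iff hwf]
      constructor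
      · rintro ⟨u', hu', hw⟩
        exact ⟨⟨u', (hsub hR hu').1⟩, hu', hw ▸ h₂ u' hu'⟩
      · rintro ⟨u', hu', hw⟩
        exact ⟨u', hu', (h _ _ hw).1⟩
  suffices h : ∃ f : Elt N, (∀ u v, ZFSet.pair u v ∈ f.1 → v = collapse R u ∧
        ∀ u', ZFSet.pair u' u ∈ R → ZFSet.pair u' (collapse R u') ∈ f.1) ∧
        ZFSet.pair a (collapse R a) ∈ f.1 by
    obtain ⟨f, -, hf⟩ := h
    exact (hsub f.2 hf).2
  induction a using hwf.induction with | _ b ih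
  obtain ⟨c, hc, hc'⟩ := hN.exists_subset (fun y => ZFSet.pair y.1 (⟨b, ha⟩ : Elt N).1 ∈ r.1)
    (hN.sUnion_mem (hN.sUnion_mem hR))
  obtain ⟨d, hd, hd'⟩ := hN.exists_collection (fun y f => (∀ u v : Elt N,
      ZFSet.pair u.1 v.1 ∈ f.1 →
      (∀ u' : Elt N, ZFSet.pair u'.1 u.1 ∈ r.1 → ∃ v' : Elt N, ZFSet.pair u'.1 v'.1 ∈ f.1) ∧
      ∀ w : Elt N, w.1 ∈ v.1 ↔ ∃ u' : Elt N, ZFSet.pair u'.1 u.1 ∈ r.1 ∧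
        ZFSet.pair u'.1 w.1 ∈ f.1) ∧ ∃ v : Elt N, ZFSet.pair y.1 v.1 ∈ f.1) hc fun y hy => by
    obtain ⟨_, _, hyb⟩ := (hc' _).1 hy
    obtain ⟨f, hf, hyf⟩ := ih y hyb y.2
    exact ⟨f, (hatt f).2 hf, ⟨_, (hsub f.2 hyf).2⟩, hyf⟩
  -- The bound may contain other sets, which are removed. What remains agrees with the true
  -- collapse, so its union is again a partial collapse, and it is defined at all predecessors of
  -- `b`.
  obtain ⟨e, he, he'⟩ := hN.exists_subset (fun f => ∀ u v : Elt N,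
      ZFSet.pair u.1 v.1 ∈ f.1 →
      (∀ u' : Elt N, ZFSet.pair u'.1 u.1 ∈ r.1 → ∃ v' : Elt N, ZFSet.pair u'.1 v'.1 ∈ f.1) ∧
      ∀ w : Elt N, w.1 ∈ v.1 ↔ ∃ u' : Elt N, ZFSet.pair u'.1 u.1 ∈ r.1 ∧
        ZFSet.pair u'.1 w.1 ∈ f.1) hd
  have hF : ∀ u v, ZFSet.pair u v ∈ ZFSet.sUnion e → v = collapse R u ∧
      ∀ u', ZFSet.pair u' u ∈ R → ZFSet.pair u' (collapse R u') ∈ ZFSet.sUnion e := by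
    intro u v huv
    obtain ⟨f, hf, huv⟩ := ZFSet.mem_sUnion.1 huv
    obtain ⟨-, hfN, hf'⟩ := (he' f).1 hf
    obtain ⟨h₁, h₂⟩ := (hatt ⟨f, hfN⟩).1 hf' u v huv
    exact ⟨h₁, fun u' hu' => ZFSet.mem_sUnion.2 ⟨f, hf, h₂ u' hu'⟩⟩
  have hchild : ∀ y, ZFSet.pair y b ∈ R → ZFSet.pair y (collapse R y) ∈ ZFSet.sUnion e := by
    intro y hy
    have hyN := (hsub hR hy).1
    obtain ⟨f, hfd, hf, v, hv⟩ := hd' ⟨y, hyN⟩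
      ((hc' y).2 ⟨(mem_sUnion_sUnion_of_pair_mem hy).1, hyN, hy⟩)
    rw [← ((hatt f).1 hf y v hv).1]
    exact ZFSet.mem_sUnion.2 ⟨f, (he' f).2 ⟨hfd, f.2, hf⟩, hv⟩
  have hFN := hN.sUnion_mem he
  obtain ⟨V, hV, hV'⟩ := hN.exists_subset (fun w => ∃ u : Elt N,
    ZFSet.pair u.1 (⟨b, ha⟩ : Elt N).1 ∈ r.1 ∧ ZFSet.pair u.1 w.1 ∈ (⟨_, hFN⟩ : Elt N).1)
    (hN.sUnion_mem (hN.sUnion_mem hFN))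
  have hVb : V = collapse R b := by
    ext w
    rw [hV', mem_collapse]
    simp only [classRel_iff hwf]
    constructor
    · rintro ⟨-, hw, u, hu, huw⟩
      exact ⟨u, hu, (hF _ _ huw).1⟩
    · rintro ⟨u, hu, rfl⟩
      have h := hchild u hu
      obtain ⟨huN, hwN⟩ := hsub hFN h
      exact ⟨(mem_sUnion_sUnion_of_pair_mem h).2, hwN, ⟨u, huN⟩, hu, h⟩
  refine ⟨⟨insert (ZFSet.pair b V) (ZFSet.sUnion e), hN.insert_mem (hN.pair_mem ha hV) hFN⟩,
    fun u v huv => ?_, hVb ▸ ZFSet.mem_insert _ _⟩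
  rcases ZFSet.mem_insert_iff.1 huv with h | h
  · obtain ⟨rfl, rfl⟩ := ZFSet.pair_inj.1 h
    exact ⟨hVb, fun u' hu' => ZFSet.mem_insert_of_mem _ (hchild u' hu')⟩
  · exact ⟨(hF u v h).1, fun u' hu' => ZFSet.mem_insert_of_mem _ ((hF u v h).2 u' hu')⟩

/-- Ordinals are their own ranks, so the rank function on `β ∪ {β}` is the identity, which is a set
in `N`. This places the ordinals below `κ` in `M`. -/
theorem inV_of_mem_ordinal (hN : ZFCMinus (memRel N N)) {k : Elt N} (hk : k.1.IsOrdinal)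
    {β : Elt N} (hβ : β.1 ∈ k.1) : InV (memRel N N) k β := by
  have ht := hT.out
  have ho := hk.mem hβ
  have hs : (insert β.1 β.1 : ZFSet.{u}).IsOrdinal := ZFSet.isOrdinal_succ ho
  have hsN : insert β.1 β.1 ∈ N := hN.insert_mem β.2 β.2
  have hrank : ∀ z ∈ (insert β.1 β.1 : ZFSet.{u}), z.rank.toZFSet = z :=
    fun z hz => (hs.mem hz).toZFSet_rank_eq
  obtain ⟨d, hd, hd'⟩ := hN.exists_prod hsN hsN
  obtain ⟨f, hf, hf'⟩ := hN.exists_subset (fun p => ∃ z : Elt N,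
    z.1 ∈ (⟨_, hsN⟩ : Elt N).1 ∧ p.1 = ZFSet.pair z.1 z.1) hd
  refine inV_of_rank_mem ht hsN hf hsN hs.isTransitive (ZFSet.mem_insert _ _) (fun w => ?_)
    (fun z hz => (hrank z hz).symm ▸ hz) (ho.toZFSet_rank_eq.symm ▸ hβ)
  rw [hf']
  constructor
  · rintro ⟨-, hw, z, hz, h⟩
    exact ⟨z, hz, by rw [hrank z hz]; exact h⟩
  · rintro ⟨z, hz, rfl⟩
    rw [hrank z hz]
    have hzN := ht.subset_of_mem hsN hz
    exact ⟨hd' z hz z hz, hN.pair_mem hzN hzN, ⟨z, hzN⟩, hz, rfl⟩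

/-- A set that is injected by `j` into a set of points is the collapse of a relation on them. -/
theorem SetTheoryModel.ZFCMinus.exists_code (hN : ZFCMinus (memRel N N)) {t j k : ZFSet.{u}}
    (hjN : j ∈ N) (hkN : k ∈ N) (htr : t.IsTransitive) (hj : IsInj j t k) :
    ∃ R ∈ N, (∀ p ∈ R, ∃ u ∈ k, ∃ v ∈ k, p = ZFSet.pair u v) ∧ WellFounded (pairRel R) ∧
      ∀ x ∈ t, ∃ a ∈ k, collapse R a = x := by
  have ht := hT.out
  have hval : ∀ {y u}, ZFSet.pair y u ∈ j → y ∈ t ∧ u ∈ k := fun {y u} h => by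
    obtain ⟨y', hy, u', hu, he⟩ := hj.1.1 _ h
    obtain ⟨rfl, rfl⟩ := ZFSet.pair_inj.1 he
    exact ⟨hy, hu⟩
  obtain ⟨d, hd, hd'⟩ := hN.exists_prod hkN hkN
  obtain ⟨R, hR, hR'⟩ := hN.exists_subset (fun p => ∃ u v y z : Elt N, p.1 = ZFSet.pair u.1 v.1 ∧
    ZFSet.pair y.1 u.1 ∈ (⟨j, hjN⟩ : Elt N).1 ∧ ZFSet.pair z.1 v.1 ∈ (⟨j, hjN⟩ : Elt N).1 ∧
    y.1 ∈ z.1) hd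
  have hrel : ∀ {u v}, ZFSet.pair u v ∈ R ↔
      ∃ y z, ZFSet.pair y u ∈ j ∧ ZFSet.pair z v ∈ j ∧ y ∈ z := fun {u v} => by
    rw [hR']
    constructor
    · rintro ⟨_, _, u', v', y, z, h, hy, hz, hyz⟩
      obtain ⟨rfl, rfl⟩ := ZFSet.pair_inj.1 h
      exact ⟨y, z, hy, hz, hyz⟩
    · rintro ⟨y, z, hy, hz, hyz⟩
      obtain ⟨hyN, huN⟩ := mem_of_pair_mem ht (ht.subset_of_mem hjN hy)
      obtain ⟨hzN, hvN⟩ := mem_of_pair_mem ht (ht.subset_of_mem hjN hz)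
      exact ⟨hd' u (hval hy).2 v (hval hz).2, hN.pair_mem huN hvN, ⟨u, huN⟩, ⟨v, hvN⟩, ⟨y, hyN⟩,
        ⟨z, hzN⟩, rfl, hy, hz, hyz⟩
  have hacc : ∀ z v, ZFSet.pair z v ∈ j → Acc (pairRel R) v := by
    intro z
    induction z using ZFSet.inductionOn with | _ z ih
    intro v hzv
    refine ⟨_, fun u hu => ?_⟩
    obtain ⟨y, z', hy, hz', hyz⟩ := hrel.1 hu
    obtain rfl := hj.2 _ _ _ hzv hz'
    exact ih y hyz u hy
  have hwf : WellFounded (pairRel R) := by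
    refine ⟨fun v => ⟨v, fun u hu => ?_⟩⟩
    obtain ⟨y, z, hy, -, -⟩ := hrel.1 hu
    exact hacc y u hy
  have hcol : ∀ z v, ZFSet.pair z v ∈ j → collapse R v = z := by
    intro z
    induction z using ZFSet.inductionOn with | _ z ih
    intro v hzv
    ext w
    rw [mem_collapse]
    simp only [classRel_iff hwf, hrel]
    constructor
    · rintro ⟨u, ⟨y, z', hy, hz', hyz⟩, rfl⟩
      obtain rfl := hj.2 _ _ _ hzv hz'
      rwa [ih y hyz u hy]
    · intro hw
      obtain ⟨u, hu, -⟩ := hj.1.2 w (htr.subset_of_mem (hval hzv).1 hw)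
      exact ⟨u, ⟨w, z, hu, hzv, hw⟩, (ih w hw u hu).symm⟩
  refine ⟨R, hR, fun p hp => ?_, hwf, fun x hx => ?_⟩
  · obtain ⟨_, _, u, v, y, z, h, hy, hz, -⟩ := (hR' p).1 hp
    exact ⟨u, (hval hy).2, v, (hval hz).2, h⟩
  · obtain ⟨a, ha, -⟩ := hj.1.2 x hx
    exact ⟨a, (hval ha).2, hcol x a ha⟩

end

/-! ### Uniqueness of the associated model -/

theorem IsAssociatedModel.eq_codedModel {M C N : ZFSet.{u}} (hM : IsBetaModelMKStar M C)
    (hN : IsAssociatedModel M C N) : N = codedModel M C := by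
  have hT := hN.transitive
  have : Fact N.IsTransitive := ⟨hT⟩
  obtain ⟨k, hkV, hkL, hkI⟩ := hN.sets
  have : Nonempty (Elt N) := ⟨k⟩
  have hZ := hN.setMKStar.zfcMinus
  have hMN : ∀ {x}, x ∈ M → x ∈ N := fun hx => ((hkV _).1 hx).1
  have hC : ∀ {X}, X ∈ C ↔ X ⊆ M ∧ X ∈ N := fun {X} => by
    rw [hN.classes, ZFSet.mem_inter, ZFSet.mem_powerset]
  have hkM : ∀ {β}, β ∈ k.1 → β ∈ M := fun {β} hβ => (hkV β).2
    ⟨hT.subset_of_mem k.2 hβ, inV_of_mem_ordinal hZ ((isOrd_iff hT).1 hkL.1.1) hβ⟩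
  ext x
  constructor
  · intro hx
    obtain ⟨k', hk', hinj⟩ := hN.setMKStar.inaccessible
    -- The inaccessible cardinal from the axioms of SetMK* is not assumed to be the `κ` of (c), but
    -- it is at most the largest cardinal.
    have hk'M : ∀ {β}, β ∈ k'.1 → β ∈ M := fun {β} hβ => by
      rcases hkL.2 k' hk'.card with rfl | h
      · exact hkM hβ
      · exact hkM (((isOrd_iff hT).1 hkL.1.1).mem_trans hβ h)
    obtain ⟨t, htN, htr, hxt⟩ := hZ.exists_transitive hx
    obtain ⟨j, hj⟩ := hinj ⟨t, htN⟩
    rw [isInjection_iff hT] at hj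
    obtain ⟨R, hR, hRk, hwf, hcol⟩ := hZ.exists_code j.2 k'.2 htr hj
    obtain ⟨a, ha, rfl⟩ := hcol x hxt
    refine mem_codedModel.2 ⟨⟨R, hC.2 ⟨fun p hp => ?_, hR⟩⟩, ⟨a, hk'M ha⟩, rfl⟩
    obtain ⟨u, hu, v, hv, rfl⟩ := hRk p hp
    exact hM.pair_mem (hk'M hu) (hk'M hv)
  · intro hx
    obtain ⟨X, a, rfl⟩ := mem_codedModel.1 hx
    by_cases hwf : WellFounded (pairRel X.1)
    · exact hZ.collapse_mem (hC.1 X.2).2 hwf (hMN a.2)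
    -- By convention, all points of an ill-founded class collapse to the empty set.
    · obtain ⟨e, he⟩ := hM.exists_empty
      suffices collapse X.1 a.1 = e.1 from this ▸ hMN e.2
      rw [he, ZFSet.eq_empty]
      intro y hy
      obtain ⟨b, hb, -⟩ := mem_collapse.1 hy
      exact hwf hb.1

/-! ### Isomorphic transitive closures -/

theorem reflTransGen_antisymm {α : Type*} {r : α → α → Prop} (hr : WellFounded r) {x y : α}
    (h : Relation.ReflTransGen r x y) (h' : Relation.ReflTransGen r y x) : x = y := by
  rcases Relation.reflTransGen_iff_eq_or_transGen.1 h with h₁ | h₁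
  · exact h₁.symm
  · exact absurd (h₁.trans_left h') (hr.transGen.irrefl.irrefl x)

/-- By `∈`-induction the isomorphism fixes every point, so each of `x` and `y` lies in the
transitive closure of the singleton of the other; Foundation then makes them equal. -/
theorem eq_of_tcMem_iso {x y : ZFSet.{u}} (e : tcMem x ≃r tcMem y) : x = y := by
  have key : ∀ v (hv : Relation.ReflTransGen (fun v w : ZFSet.{u} => v ∈ w) v x),
      (e ⟨v, hv⟩).1 = v := by
    intro v
    induction v using ZFSet.inductionOn with | _ v ih
    intro hv
    ext w
    constructor
    · intro hw
      obtain ⟨⟨w', hw'⟩, he⟩ := e.surjective ⟨w, Relation.ReflTransGen.head hw (e ⟨v, hv⟩).2⟩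
      have hmem : w' ∈ v := by
        refine (e.map_rel_iff (a := ⟨w', hw'⟩) (b := ⟨v, hv⟩)).1 ?_
        rw [he]
        exact hw
      have := ih w' hmem hw'
      rw [he] at this
      exact (show w = w' from this) ▸ hmem
    · intro hw
      have hw' : Relation.ReflTransGen (fun v w : ZFSet.{u} => v ∈ w) w x := .head hw hv
      have : tcMem y (e ⟨w, hw'⟩) (e ⟨v, hv⟩) := e.map_rel_iff.2 hw
      rw [← ih w hw hw']
      exact this
  have hx := (e ⟨x, .refl⟩).2
  rw [key] at hx
  obtain ⟨⟨v, hv⟩, he⟩ := e.surjective ⟨y, .refl⟩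
  have hv' := key v hv
  rw [he] at hv'
  obtain rfl : y = v := hv'
  exact reflTransGen_antisymm ZFSet.mem_wf hx hv

/-! ### Trees and their collapse -/

/-- A subtree contains all `R`-predecessors of its points, so an isomorphism preserves collapses
pointwise. -/
theorem collapse_eq_of_subtreeIso {R y z : ZFSet.{u}} (hwf : WellFounded (pairRel R))
    (h : SubtreeIso R y z) : collapse R y = collapse R z := by
  obtain ⟨e⟩ := h
  have key : ∀ v (hv : Relation.ReflTransGen (pairRel R) v y),
      collapse R v = collapse R (e ⟨v, hv⟩).1 := by
    intro v
    induction v using hwf.induction with | _ v ih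
    intro hv
    ext w
    rw [mem_collapse, mem_collapse]
    simp only [classRel_iff hwf]
    constructor
    · rintro ⟨u, hu, rfl⟩
      have hu' : Relation.ReflTransGen (pairRel R) u y := .head (show pairRel R u v from hu) hv
      exact ⟨_, e.map_rel_iff.2 (show subtreeRel R y ⟨u, hu'⟩ ⟨v, hv⟩ from hu), ih u hu hu'⟩
    · rintro ⟨u, hu, rfl⟩
      obtain ⟨⟨u', hu'⟩, he⟩ := e.surjective ⟨u, Relation.ReflTransGen.head hu (e ⟨v, hv⟩).2⟩
      have hrel : pairRel R u' v := by
        refine (e.map_rel_iff (a := ⟨u', hu'⟩) (b := ⟨v, hv⟩)).1 ?_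
        rw [he]
        exact hu
      refine ⟨u', hrel, ?_⟩
      rw [ih u' hrel hu', he]
  -- The top is the point to which all others are connected, a property that isomorphisms preserve.
  have hz : (e ⟨y, .refl⟩).1 = z := by
    refine reflTransGen_antisymm hwf (e ⟨y, .refl⟩).2 ?_
    obtain ⟨⟨v, hv⟩, he⟩ := e.surjective ⟨z, .refl⟩
    suffices ∀ w (hw : Relation.ReflTransGen (pairRel R) w y),
        Relation.ReflTransGen (pairRel R) (e ⟨w, hw⟩).1 (e ⟨y, .refl⟩).1 by
      have := this v hv
      rwa [he] at this
    intro w hw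
    induction hw using Relation.ReflTransGen.head_induction_on with
    | refl => exact .refl
    | head h hw ih =>
      exact .head (e.map_rel_iff.2
        (show subtreeRel R y ⟨_, Relation.ReflTransGen.head h hw⟩ ⟨_, hw⟩ from h)) ih
  rw [key y .refl, hz]

/-- Elements below `y` and below `z` match if the chains that connect them to `y` and to `z` have
the same collapses. -/
inductive Matching (R y z : ZFSet.{u}) : ZFSet.{u} → ZFSet.{u} → Prop
  | top : Matching R y z y z
  | step {u w u' w' : ZFSet.{u}} : Matching R y z u w → pairRel R u' u → pairRel R w' w →
      collapse R u' = collapse R w' → Matching R y z u' w'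

section Matching

variable {R y z : ZFSet.{u}}

theorem Matching.symm {u w : ZFSet.{u}} (h : Matching R y z u w) : Matching R z y w u := by
  induction h with
  | top => exact .top
  | step _ h₁ h₂ h₃ ih => exact .step ih h₂ h₁ h₃.symm

theorem Matching.left {u w : ZFSet.{u}} (h : Matching R y z u w) :
    Relation.ReflTransGen (pairRel R) u y := by
  induction h with
  | top => exact .refl
  | step _ h₁ _ _ ih => exact .head h₁ ih

theorem Matching.collapse_eq (hyz : collapse R y = collapse R z) {u w : ZFSet.{u}}
    (h : Matching R y z u w) : collapse R u = collapse R w := by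
  cases h with
  | top => exact hyz
  | step _ _ _ h => exact h

theorem Matching.exists_right (hwf : WellFounded (pairRel R)) (hyz : collapse R y = collapse R z)
    {u : ZFSet.{u}} (h : Relation.ReflTransGen (pairRel R) u y) : ∃ w, Matching R y z u w := by
  induction h using Relation.ReflTransGen.head_induction_on with
  | refl => exact ⟨z, .top⟩
  | @head u' u h _ ih =>
    obtain ⟨w, hw⟩ := ih
    have := collapse_mem_collapse ((classRel_iff hwf).2 h)
    rw [hw.collapse_eq hyz] at this
    obtain ⟨w', hw', he⟩ := mem_collapse.1 this
    exact ⟨w', .step hw h hw'.2 he⟩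

variable (hwf : WellFounded (pairRel R))
  (hpar : ∀ v p q, pairRel R v p → pairRel R v q → p = q)

include hwf in
theorem not_pairRel_of_reflTransGen {v : ZFSet.{u}} (h : Relation.ReflTransGen (pairRel R) v y) :
    ¬ pairRel R y v := fun h' =>
  hwf.transGen.irrefl.irrefl y (Relation.TransGen.head' h' h)

-- Unique parents make the last step of a matching recoverable, and siblings with distinct collapses
-- leave only one choice in it.
include hwf hpar in
theorem Matching.right_unique
    (hz : ∀ v, Relation.ReflTransGen (pairRel R) v z → ∀ p q, pairRel R p v → pairRel R q v →
      collapse R p = collapse R q → p = q) {u w : ZFSet.{u}} (h : Matching R y z u w) :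
    ∀ {w'}, Matching R y z u w' → w = w' := by
  induction h with
  | top =>
    intro w' h'
    cases h' with
    | top => rfl
    | step h'' h₁ _ _ => exact absurd h₁ (not_pairRel_of_reflTransGen hwf h''.left)
  | step h h₁ h₂ h₃ ih =>
    intro w' h'
    cases h' with
    | top => exact absurd h₁ (not_pairRel_of_reflTransGen hwf h.left)
    | step h' h₁' h₂' h₃' =>
      obtain rfl := hpar _ _ _ h₁ h₁'
      obtain rfl := ih h'
      exact hz _ h.symm.left _ _ h₂ h₂' (h₃.symm.trans h₃')

include hwf hpar in
theorem Matching.pairRel_right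
    (hz : ∀ v, Relation.ReflTransGen (pairRel R) v z → ∀ p q, pairRel R p v → pairRel R q v →
      collapse R p = collapse R q → p = q) {u w u' w' : ZFSet.{u}} (h : Matching R y z u w)
    (h' : Matching R y z u' w') (hu : pairRel R u' u) : pairRel R w' w := by
  cases h' with
  | top => exact absurd hu (not_pairRel_of_reflTransGen hwf h.left)
  | step h' h₁ h₂ h₃ =>
    obtain rfl := hpar _ _ _ hu h₁
    rwa [h.right_unique hwf hpar hz h']

-- The matching is total on both sides because the collapses agree, and single-valued both ways by
-- `Matching.right_unique`; the reversed matching is the inverse.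
include hwf hpar in
theorem subtreeIso_of_collapse_eq
    (hy : ∀ v, Relation.ReflTransGen (pairRel R) v y → ∀ p q, pairRel R p v → pairRel R q v →
      collapse R p = collapse R q → p = q)
    (hz : ∀ v, Relation.ReflTransGen (pairRel R) v z → ∀ p q, pairRel R p v → pairRel R q v →
      collapse R p = collapse R q → p = q)
    (hyz : collapse R y = collapse R z) : SubtreeIso R y z := by
  choose f hf using fun u : Subtree R y => Matching.exists_right hwf hyz u.2
  choose g hg using fun w : Subtree R z => Matching.exists_right hwf hyz.symm w.2
  refine ⟨⟨⟨fun u => ⟨f u, (hf u).symm.left⟩, fun w => ⟨g w, (hg w).symm.left⟩, fun u => ?_,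
    fun w => ?_⟩, fun {u u'} => ⟨fun h => ?_, fun h => ?_⟩⟩⟩
  · exact Subtype.ext ((hg _).right_unique hwf hpar hy (hf u).symm)
  · exact Subtype.ext ((hf _).right_unique hwf hpar hz (hg w).symm)
  · exact (hf u').symm.pairRel_right hwf hpar hy (hf u).symm h
  · exact (hf u').pairRel_right hwf hpar hz (hf u) h

end Matching

/-! ### The set coded by a coding pair -/

section CodingPair

variable {C M₀ R a : ZFSet.{u}}

theorem IsCodingPair.mem_of_pairRel (h : IsCodingPair C M₀ R a) {x y : ZFSet.{u}}
    (hxy : pairRel R x y) : x ∈ M₀ ∧ y ∈ M₀ := by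
  obtain ⟨x', hx, y', hy, he⟩ := h.rel_on _ hxy
  obtain ⟨rfl, rfl⟩ := ZFSet.pair_inj.1 he
  exact ⟨hx, hy⟩

/-- Unique distance to the top puts two parents of `v` at the same level, where nodes share no
predecessor. -/
theorem IsCodingPair.parent_unique (h : IsCodingPair C M₀ R a) {v p q : ZFSet.{u}}
    (hp : pairRel R v p) (hq : pairRel R v q) : p = q := by
  by_contra hne
  obtain ⟨hv, hp₀⟩ := h.mem_of_pairRel hp
  have hq₀ := (h.mem_of_pairRel hq).2
  obtain ⟨n, hn, -⟩ := h.dist p hp₀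
  obtain ⟨m, hm, -⟩ := h.dist q hq₀
  have := (h.dist v hv).unique (y₁ := n + 1) (y₂ := m + 1) ⟨p, hp, hn⟩ ⟨q, hq, hm⟩
  obtain rfl : n = m := by omega
  exact h.disjoint n p hp₀ q hq₀ hn hm hne v hp hq

/-- Siblings have non-isomorphic subtrees. To conclude that their collapses differ,
`subtreeIso_of_collapse_eq` needs the present claim throughout both subtrees, hence the induction
along the transitive closure of `R`. -/
theorem IsCodingPair.collapse_inj (h : IsCodingPair C M₀ R a) (x : ZFSet.{u}) :
    ∀ p q, pairRel R p x → pairRel R q x → collapse R p = collapse R q → p = q := by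
  have key : ∀ x, ∀ v, Relation.ReflTransGen (pairRel R) v x → ∀ p q, pairRel R p v →
      pairRel R q v → collapse R p = collapse R q → p = q := by
    intro x
    induction x using h.wf.transGen.induction with | _ x ih
    have hx : ∀ p q, pairRel R p x → pairRel R q x → collapse R p = collapse R q → p = q := by
      intro p q hp hq hpq
      by_contra hne
      obtain ⟨hp₀, hx₀⟩ := h.mem_of_pairRel hp
      exact h.not_iso x hx₀ p hp₀ q (h.mem_of_pairRel hq).1 hne hp hq
        (subtreeIso_of_collapse_eq h.wf (fun _ _ _ => h.parent_unique) (ih p (.single hp))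
          (ih q (.single hq)) hpq)
    intro v hv
    rcases Relation.reflTransGen_iff_eq_or_transGen.1 hv with rfl | hv
    · exact hx
    · exact ih v hv v .refl
  exact key x x .refl

theorem IsCodingPair.subtreeIso_iff (h : IsCodingPair C M₀ R a) {y z : ZFSet.{u}} :
    SubtreeIso R y z ↔ collapse R y = collapse R z :=
  ⟨collapse_eq_of_subtreeIso h.wf, subtreeIso_of_collapse_eq h.wf (fun _ _ _ => h.parent_unique)
    (fun v _ => h.collapse_inj v) (fun v _ => h.collapse_inj v)⟩

theorem IsCodingPair.collapse_mem_tc (h : IsCodingPair C M₀ R a) {y : ZFSet.{u}} (hy : y ∈ M₀) :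
    Relation.ReflTransGen (fun v w : ZFSet.{u} => v ∈ w) (collapse R y) (collapse R a) := by
  obtain ⟨n, hn, -⟩ := h.dist y hy
  clear hy
  induction n generalizing y with
  | zero =>
    obtain rfl : y = a := hn
    exact .refl
  | succ n ih =>
    obtain ⟨w, hw, hn⟩ := hn
    exact .head (collapse_mem_collapse ((classRel_iff h.wf).2 hw)) (ih hn)

theorem IsCodingPair.nonempty_iso (h : IsCodingPair C M₀ R a) :
    Nonempty (quotRel M₀ R ≃r tcMem (collapse R a)) := by
  let f : Quotient (nodeSetoid M₀ R) → TCSingleton (collapse R a) :=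
    Quotient.lift (fun y => ⟨collapse R y.1, h.collapse_mem_tc y.2⟩) fun y z hyz =>
      Subtype.ext (h.subtreeIso_iff.1 hyz)
  have hinj : Function.Injective f := by
    rintro ⟨y⟩ ⟨z⟩ hyz
    exact Quotient.sound (h.subtreeIso_iff.2 (congrArg Subtype.val hyz))
  have hsurj : Function.Surjective f := by
    rintro ⟨v, hv⟩
    suffices ∃ y ∈ M₀, collapse R y = v by
      obtain ⟨y, hy, he⟩ := this
      exact ⟨Quotient.mk _ ⟨y, hy⟩, Subtype.ext he⟩
    induction hv using Relation.ReflTransGen.head_induction_on with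
    | refl => exact ⟨a, h.top_mem, rfl⟩
    | head hvw _ ih =>
      obtain ⟨y, hy, rfl⟩ := ih
      obtain ⟨x, hx, rfl⟩ := mem_collapse.1 hvw
      exact ⟨x, (h.mem_of_pairRel hx.2).1, rfl⟩
  refine ⟨⟨Equiv.ofBijective f ⟨hinj, hsurj⟩, fun {p q} => ⟨?_, ?_⟩⟩⟩
  · obtain ⟨y, rfl⟩ := Quotient.exists_rep p
    obtain ⟨z, rfl⟩ := Quotient.exists_rep q
    intro hyz
    obtain ⟨x, hx, he⟩ := mem_collapse.1 (show collapse R y.1 ∈ collapse R z.1 from hyz)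
    exact ⟨⟨x, (h.mem_of_pairRel hx.2).1⟩, z,
      Quotient.sound (h.subtreeIso_iff.2 he.symm), rfl, hx.2⟩
  · rintro ⟨y, z, rfl, rfl, hyz⟩
    exact collapse_mem_collapse ((classRel_iff h.wf).2 hyz)

theorem IsCodingPair.isCodingPairFor (h : IsCodingPair C M₀ R a) :
    IsCodingPairFor C M₀ R (collapse R a) := by
  obtain ⟨e⟩ := h.nonempty_iso
  exact ⟨⟨a, h⟩, ⟨e⟩, fun y ⟨e'⟩ => eq_of_tcMem_iso (e'.symm.trans e)⟩

theorem IsCodingPairFor.exists_eq_collapse {x : ZFSet.{u}} (h : IsCodingPairFor C M₀ R x) :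
    ∃ a, IsCodingPair C M₀ R a ∧ x = collapse R a := by
  obtain ⟨⟨a, ha⟩, -, hu⟩ := h
  exact ⟨a, ha, (hu _ ha.nonempty_iso).symm⟩

end CodingPair

/-! ### Unravelling a relation to a coding pair -/

section Unravel

variable {M C : ZFSet.{u}} [hM : Fact (IsBetaModelMKStar M C)]
variable [Fact M.IsTransitive] [Nonempty (Elt M)] [Nonempty (Elt C)]

/-- Reachability along a relation is given by a class if the relation has no infinite chains
backwards. -/
theorem exists_reachable_class (G : Elt M → Elt M → Prop)
    [hG : Dfn (memRel M M) (memRel M C) fun (s : Fin 2 → Elt M) (_ : Fin 0 → Elt C) =>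
      G (s 0) (s 1)]
    (hwf : WellFounded G) (r : Elt M) :
    ∃ T : Elt C, ∀ t : Elt M, t.1 ∈ T.1 ↔ Relation.ReflTransGen G r t := by
  have := @hG.apply₂
  -- Finite chains are avoided: `T` is the intersection of all classes that contain `r` and are
  -- closed under `G`.
  obtain ⟨T, hT⟩ := exists_class (M := M) (C := C) fun t => ∀ X : Elt C, r.1 ∈ X.1 →
    (∀ s c : Elt M, s.1 ∈ X.1 → G s c → c.1 ∈ X.1) → t.1 ∈ X.1
  have hT' : ∀ t : Elt M, t.1 ∈ T.1 ↔ ∀ X : Elt C, r.1 ∈ X.1 →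
      (∀ s c : Elt M, s.1 ∈ X.1 → G s c → c.1 ∈ X.1) → t.1 ∈ X.1 := fun t =>
    (hT t).trans ⟨fun ⟨_, h⟩ => h, fun h => ⟨t.2, h⟩⟩
  have hclosed : ∀ s c : Elt M, s.1 ∈ T.1 → G s c → c.1 ∈ T.1 := fun s c hs hc =>
    (hT' c).2 fun X hr hX => hX s c ((hT' s).1 hs X hr hX) hc
  refine ⟨T, fun t => ⟨fun ht => ?_, fun ht => ?_⟩⟩
  · induction t using hwf.induction with | _ t ih
    by_contra hne
    -- If `t` is not reachable, removing it from `T` leaves a closed class, since by induction any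
    -- `G`-predecessor of `t` in `T` is reachable; this contradicts the minimality of `T`.
    obtain ⟨X, hX⟩ := exists_class (M := M) (C := C) fun s => s.1 ∈ T.1 ∧ s ≠ t
    have hX' : ∀ s : Elt M, s.1 ∈ X.1 ↔ s.1 ∈ T.1 ∧ s ≠ t := fun s =>
      (hX s).trans ⟨fun ⟨_, h⟩ => h, fun h => ⟨s.2, h⟩⟩
    refine ((hX' t).1 ((hT' t).1 ht X ((hX' r).2 ⟨?_, ?_⟩) fun s c hs hc => (hX' c).2
      ⟨hclosed s c ((hX' s).1 hs).1 hc, ?_⟩)).2 rfl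
    · exact (hT' r).2 fun X hr _ => hr
    · rintro rfl
      exact hne .refl
    · rintro rfl
      exact hne ((ih s hc ((hX' s).1 hs).1).tail hc)
  · induction ht with
    | refl => exact (hT' r).2 fun X hr _ => hr
    | tail _ h ih => exact hclosed _ _ ih h

/-- Of the predecessors of `x` with the same collapse only the `W`-least stays. No collapse changes,
and distinct siblings now have distinct collapses. -/
theorem exists_pruned {W : Elt C} (hW : IsSetLikeWellOrder M W.1) (X : Elt C) :
    ∃ R : Elt C, WellFounded (pairRel R.1) ∧ (∀ x, collapse R.1 x = collapse X.1 x) ∧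
      ∀ x y z, pairRel R.1 y x → pairRel R.1 z x → collapse X.1 y = collapse X.1 z → y = z := by
  obtain ⟨R, -, hR⟩ := exists_classRelation (M := M) (C := C) fun y x => classRel X.1 y.1 x.1 ∧
    ∀ z : Elt M, classRel X.1 z.1 x.1 → collapse X.1 z.1 = collapse X.1 y.1 →
      ¬ ZFSet.pair z.1 y.1 ∈ W.1
  have hwf : WellFounded (pairRel R.1) :=
    Subrelation.wf (fun {y x} h => ((hR y x).1 h).2.2.1) (classRel_wf X.1)
  refine ⟨R, hwf, fun x => ?_, fun x y z hy hz h => ?_⟩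
  · induction x using (classRel_wf X.1).induction with | _ x ih
    ext w
    rw [mem_collapse, mem_collapse]
    simp only [classRel_iff hwf, hR]
    constructor
    · rintro ⟨y, ⟨_, _, hy, -⟩, rfl⟩
      exact ⟨y, hy, ih y hy⟩
    · rintro ⟨y, hy, rfl⟩
      obtain ⟨hyM, hxM⟩ := mem_of_classRel (M := M) X hy
      obtain ⟨j, ⟨hjM, hj, hjy⟩, hmin⟩ := hW.wf.has_min
        {j | j ∈ M ∧ classRel X.1 j x ∧ collapse X.1 j = collapse X.1 y} ⟨y, hyM, hy, rfl⟩
      exact ⟨j, ⟨hjM, hxM, hj, fun i hi hij => hmin i ⟨i.2, hi, hij.trans hjy⟩⟩,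
        by rw [ih j hj, hjy]⟩
  · obtain ⟨hyM, hxM, hy, hy'⟩ := (hR y x).1 hy
    obtain ⟨hzM, _, hz, hz'⟩ := (hR z x).1 hz
    rcases hW.total y hyM z hzM with h' | h' | h'
    · exact h'
    · exact absurd h' (hz' ⟨y, hyM⟩ hy h)
    · exact absurd h' (hy' ⟨z, hzM⟩ hz h.symm)

/-- The pruned relation is unravelled into the tree of its descending paths from `a`. A node is `⟨x,
s⟩` with `x` the current point and `s` the parent node, and the root is `⟨a, ∅⟩`. As a node contains
its parent, parents and distances are unique. -/
theorem exists_isCodingPair (X : Elt C) (a : Elt M) :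
    ∃ M₀ Q r, IsCodingPair C M₀ Q r ∧ collapse Q r = collapse X.1 a.1 := by
  obtain ⟨W, hW⟩ := exists_setLikeWellOrder M C
  obtain ⟨R, hwf, hcol, hinj⟩ := exists_pruned hW X
  obtain ⟨e, he⟩ := hM.out.exists_empty
  have hne : ∀ x y : ZFSet.{u}, ZFSet.pair x y ≠ e.1 := fun x y h => by
    have : ({x} : ZFSet.{u}) ∈ (∅ : ZFSet.{u}) := he ▸ h ▸ by simp [ZFSet.pair]
    exact ZFSet.notMem_empty _ this
  have hlt : ∀ x y : ZFSet.{u}, y.rank < (ZFSet.pair x y).rank := fun x y =>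
    (ZFSet.rank_lt_of_mem (y := y) (x := {x, y}) (by simp)).trans
      (ZFSet.rank_lt_of_mem (by simp [ZFSet.pair]))
  let r : Elt M := ⟨ZFSet.pair a.1 e.1, hM.out.pair_mem a.2 e.2⟩
  -- Ranks grow along paths away from the root, so the relation from parent to child is
  -- well-founded, as `exists_reachable_class` requires.
  have hG : WellFounded fun t c : Elt M => ∃ x y s : Elt M, t.1 = ZFSet.pair x.1 s.1 ∧
      c.1 = ZFSet.pair y.1 t.1 ∧ ZFSet.pair y.1 x.1 ∈ R.1 := by
    refine Subrelation.wf (fun {t c} h => ?_)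
      (InvImage.wf (fun t : Elt M => t.1.rank) (wellFounded_lt (α := Ordinal.{u})))
    obtain ⟨x, y, s, -, h, -⟩ := h
    simp only [InvImage, h]
    exact hlt _ _
  obtain ⟨T, hT⟩ := exists_reachable_class (M := M) (C := C) _ hG r
  have hrT : r.1 ∈ T.1 := (hT r).2 .refl
  have hTM : ∀ {t}, t ∈ T.1 → t ∈ M := fun {t} ht => hM.out.subset _ T.2 ht
  have hTpair : ∀ t ∈ T.1, ∃ x s : Elt M, t = ZFSet.pair x.1 s.1 := fun t ht => by
    rcases Relation.ReflTransGen.cases_tail ((hT ⟨t, hTM ht⟩).1 ht) with h | ⟨s, -, x, y, s', -, h, -⟩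
    · exact ⟨a, e, congrArg Subtype.val h⟩
    · exact ⟨y, s, h⟩
  obtain ⟨Q, hQp, hQ⟩ := exists_classRelation (M := M) (C := C) fun c t => t.1 ∈ T.1 ∧
    ∃ x y s : Elt M, t.1 = ZFSet.pair x.1 s.1 ∧ c.1 = ZFSet.pair y.1 t.1 ∧
      ZFSet.pair y.1 x.1 ∈ R.1
  have hrel : ∀ {c x s : ZFSet.{u}}, pairRel Q.1 c (ZFSet.pair x s) ↔ ZFSet.pair x s ∈ T.1 ∧
      ∃ y, c = ZFSet.pair y (ZFSet.pair x s) ∧ pairRel R.1 y x := fun {c x s} => by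
    refine (hQ _ _).trans ⟨?_, ?_⟩
    · rintro ⟨_, _, ht, x', y, s', h, hc, hyx⟩
      obtain ⟨rfl, rfl⟩ := ZFSet.pair_inj.1 h
      exact ⟨ht, y, hc, hyx⟩
    · rintro ⟨ht, y, rfl, hyx⟩
      obtain ⟨hyM, hxM⟩ := mem_of_pair_mem_class (M := M) R hyx
      have htM := hTM ht
      exact ⟨hM.out.pair_mem hyM htM, htM, ht, ⟨x, hxM⟩, ⟨y, hyM⟩,
        ⟨s, (mem_of_pair_mem hM.out.transitive htM).2⟩, rfl, rfl, hyx⟩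
  have hQT : ∀ {c t}, pairRel Q.1 c t → c ∈ T.1 ∧ t ∈ T.1 := fun {c t} h => by
    obtain ⟨hc, ht, htT, h⟩ := (hQ _ _).1 h
    exact ⟨(hT ⟨c, hc⟩).2 (((hT ⟨t, ht⟩).1 htT).tail h), htT⟩
  have hQpair : ∀ {c t}, pairRel Q.1 c t → ∃ y, c = ZFSet.pair y t := fun {c t} h => by
    obtain ⟨_, _, _, _, y, _, _, h, -⟩ := (hQ _ _).1 h
    exact ⟨y, h⟩
  have hQwf : WellFounded (pairRel Q.1) := by
    have hacc : ∀ x s, Acc (pairRel Q.1) (ZFSet.pair x s) := by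
      intro x
      induction x using hwf.induction with | _ x ih
      intro s
      refine ⟨_, fun c hc => ?_⟩
      obtain ⟨-, y, rfl, hy⟩ := hrel.1 hc
      exact ih y hy _
    refine ⟨fun t => ⟨t, fun c hc => ?_⟩⟩
    obtain ⟨y, rfl⟩ := hQpair hc
    exact hacc y t
  have hQcol : ∀ x s, ZFSet.pair x s ∈ T.1 → collapse Q.1 (ZFSet.pair x s) = collapse R.1 x := by
    intro x
    induction x using hwf.induction with | _ x ih
    intro s hs
    ext w
    rw [mem_collapse, mem_collapse]
    simp only [classRel_iff hQwf, classRel_iff hwf]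
    constructor
    · rintro ⟨c, hc, rfl⟩
      have hcT := (hQT hc).1
      obtain ⟨-, y, rfl, hy⟩ := hrel.1 hc
      exact ⟨y, hy, ih y hy _ hcT⟩
    · rintro ⟨y, hy, rfl⟩
      have hc := hrel.2 ⟨hs, y, rfl, hy⟩
      exact ⟨_, hc, (ih y hy _ (hQT hc).1).symm⟩
  -- The second component of the root is empty, while the parent of any node is an ordered pair.
  have hroot : ∀ {t}, ¬ pairRel Q.1 r.1 t := fun {t} h => by
    obtain ⟨y, hy⟩ := hQpair h
    obtain ⟨-, rfl⟩ := ZFSet.pair_inj.1 hy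
    obtain ⟨x, s, hxs⟩ := hTpair _ (hQT h).2
    exact hne _ _ hxs.symm
  have hpar : ∀ {v p q}, pairRel Q.1 v p → pairRel Q.1 v q → p = q := fun {v p q} hp hq => by
    obtain ⟨y, rfl⟩ := hQpair hp
    obtain ⟨z, hz⟩ := hQpair hq
    exact (ZFSet.pair_inj.1 hz).2
  refine ⟨T.1, Q.1, r.1, ⟨T.2, Q.2, hrT, fun p hp => ?_, fun t ht => ?_, ?_, ?_, hQwf⟩, ?_⟩
  · obtain ⟨x, y, rfl⟩ := hQp p hp
    exact ⟨x.1, (hQT hp).1, y.1, (hQT hp).2, rfl⟩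
  · have hex : ∃ n, HasDist Q.1 n t r.1 := by
      have h := (hT ⟨t, hTM ht⟩).1 ht
      suffices ∀ t : Elt M, Relation.ReflTransGen (fun t c : Elt M => ∃ x y s : Elt M,
          t.1 = ZFSet.pair x.1 s.1 ∧ c.1 = ZFSet.pair y.1 t.1 ∧ ZFSet.pair y.1 x.1 ∈ R.1) r t →
          ∃ n, HasDist Q.1 n t.1 r.1 from this _ h
      intro t h
      induction h with
      | refl => exact ⟨0, rfl⟩
      | @tail t c h hc ih =>
        obtain ⟨n, hn⟩ := ih
        exact ⟨n + 1, t.1, (hQ _ _).2 ⟨c.2, t.2, (hT t).2 h, hc⟩, hn⟩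
    have huniq : ∀ n m t, HasDist Q.1 n t r.1 → HasDist Q.1 m t r.1 → n = m := by
      intro n
      induction n with
      | zero =>
        rintro (_ | m) t h h'
        · rfl
        · obtain ⟨w, hw, -⟩ := h'
          exact absurd ((show t = r.1 from h) ▸ hw) hroot
      | succ n ih =>
        rintro (_ | m) t ⟨w, hw, h⟩ h'
        · exact absurd ((show t = r.1 from h') ▸ hw) hroot
        · obtain ⟨w', hw', h'⟩ := h'
          rw [ih m w h (hpar hw hw' ▸ h')]
    obtain ⟨n, hn⟩ := hex
    exact ⟨n, hn, fun m hm => huniq m n t hm hn⟩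
  · intro x hx y hy z hz hne' hyx hzx hiso
    have h := collapse_eq_of_subtreeIso hQwf hiso
    obtain ⟨x, s, rfl⟩ := hTpair x hx
    obtain ⟨-, y, rfl, hy'⟩ := hrel.1 hyx
    obtain ⟨-, z, rfl, hz'⟩ := hrel.1 hzx
    rw [hQcol _ _ hy, hQcol _ _ hz, hcol, hcol] at h
    exact hne' (by rw [hinj _ _ _ hy' hz' h])
  · intro n y _ z _ _ _ hne' v hy hz
    exact hne' (hpar hy hz)
  · rw [hQcol _ _ hrT, hcol]

theorem mem_codedSets_iff {x : ZFSet.{u}} : x ∈ codedSets C ↔ x ∈ codedModel M C := by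
  constructor
  · rintro ⟨M₀, R, h⟩
    obtain ⟨a, ha, rfl⟩ := h.exists_eq_collapse
    exact mem_codedModel.2 ⟨⟨R, ha.mem_rel⟩, ⟨a, hM.out.subset _ ha.mem_dom ha.top_mem⟩, rfl⟩
  · intro hx
    obtain ⟨X, a, rfl⟩ := mem_codedModel.1 hx
    obtain ⟨M₀, Q, r, h, he⟩ := exists_isCodingPair X a
    exact ⟨M₀, Q, he ▸ h.isCodingPairFor⟩

end Unravel

theorem theorem8 (M C : ZFSet.{u}) (hMC : IsBetaModelMKStar M C) :
    ∃ Mplus : ZFSet.{u}, (∀ x, x ∈ Mplus ↔ x ∈ codedSets C) ∧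
      IsAssociatedModel M C Mplus ∧
      ∀ N : ZFSet.{u}, IsAssociatedModel M C N → N = Mplus := by
  have : Fact (IsBetaModelMKStar M C) := ⟨hMC⟩
  have : Fact M.IsTransitive := ⟨hMC.transitive⟩
  have := hMC.nonempty_sets
  have := hMC.nonempty_classes
  exact ⟨codedModel M C, fun x => mem_codedSets_iff.symm, isAssociatedModel_codedModel,
    fun N hN => hN.eq_codedModel hMC⟩
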